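/- Let $k$ be a field of characteristic $0$ and $H$ a cocommutative Hopf algebra over $k$. For left $H$-modules $M,N$ and $n\ge 1$, let $C^n(M,N)$ be the $k$-space of $H^{\otimes n}$-linear maps $f:M^{\otimes n}\to H^{\otimes n}\otimes_H N$ ($H$ acting on $H^{\otimes n}$ on the right through the iterated coproduct) that are skew-symmetric, $f(x_1,\dots,x_n)=\mathrm{sgn}(\sigma)\,(\sigma\otimes_H\mathrm{id})f(x_{\sigma(1)},\dots,x_{\sigma(n)})$ for $\sigma\in S_n$, where $\sigma\otimes_H\mathrm{id}$ moves the $i$-th factor of $H^{\otimes n}$ to the $\sigma(i)$-th place. For $f\in C^{m+1}(M,M)$, $g\in C^{n+1}(M,M)$ put $$f\circledcirc g\,(x_1,\dots,x_{m+n+1})=\sum_{\sigma}\mathrm{sgn}(\sigma)(\sigma\otimes_H\mathrm{id})\,f\big(g(x_{\sigma(1)},\dots,x_{\sigma(n+1)}),x_{\sigma(n+2)},\dots,x_{\sigma(m+n+1)}\big),$$ the sum being over the $(n+1,m)$-shuffles, and let $[f,g]=f\circledcirc g-(-1)^{mn}g\circledcirc f$ (the Nijenhuis–Richardson bracket); here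 $f(g(\cdots),\cdots)$ is the usual composition of pseudo-multilinear maps: if $g(\cdots)=\sum b\otimes_H z$ and $f(z,\cdots)=\sum c\otimes_H y$, it is $\sum (b\otimes 1^{\otimes m})\,(\Delta^{(n+1)}\otimes \mathrm{id}^{\otimes m})(c)\otimes_H y$, with $\Delta^{(n+1)}:H\to H^{\otimes(n+1)}$ the iterated coproduct. An $H$-linear map $T:M\to N$ is regarded as the element $u\mapsto 1\otimes_H T(u)$ of $C^1(M,N)$. Let $\mathfrak g,\mathfrak h$ be left $H$-modules and let $\mathfrak G=\mathfrak g\oplus\mathfrak h$ be a quasi-twilled Lie pseudoalgebra: a Lie pseudoalgebra with pseudobracket $\Omega\in C^2(\mathfrak G,\mathfrak G)$, so that $\Omega(x,\Omega(y,z))=\Omega(\Omega(x,y),z)+((12)\otimes_H\mathrm{id})\,\Omega(y,\Omega(x,z))$ for all $x,y,z\in\mathfrak G$, in which $\mathfrak h$ is a Lie pseudosubalgebra. Let $$\pi:\mathfrak g\otimes\mathfrak g\to H^{\otimes2}\otimes_H\mathfrak g,\quad \theta:\mathfrak g\otimes\mathfrak g\to H^{\otimes2}\otimes_H\mathfrak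 h,\quad \eta:\mathfrak g\otimes\mathfrak h\to H^{\otimes2}\otimes_H\mathfrak g,\quad \rho:\mathfrak g\otimes\mathfrak h\to H^{\otimes2}\otimes_H\mathfrak h,\quad \mu:\mathfrak h\otimes\mathfrak h\to H^{\otimes2}\otimes_H\mathfrak h$$ be the components of $\Omega$. Each is extended to an element of $C^2(\mathfrak G,\mathfrak G)$ in the evident way: $\pi,\theta,\mu$ by composition with the projections of $\mathfrak G$ onto $\mathfrak g$, $\mathfrak h$ and the inclusions of $\mathfrak g$, $\mathfrak h$ into $\mathfrak G$, and $\alpha=\eta$ or $\rho$ by $((x_1,u_1),(x_2,u_2))\mapsto \alpha(x_1,u_2)-((12)\otimes_H\mathrm{id})\,\alpha(x_2,u_1)$. Likewise $f\in C^{n+1}(\mathfrak h,\mathfrak g)$ is identified with the element $((x_0,u_0),\dots,(x_n,u_n))\mapsto (f(u_0,\dots,u_n),0)$ of $C^{n+1}(\mathfrak G,\mathfrak G)$. A type II deformation map is an $H$-linear map $T:\mathfrak h\to\mathfrak g$ such that for all $u,v\in\mathfrak h$ $$\pi(Tu,Tv)+\eta(Tu,v)-((12)\otimes_H\mathrm{id})\,\eta(Tv,u)=(\mathrm{id}\otimes_H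 T)\big(\rho(Tu,v)-((12)\otimes_H\mathrm{id})\,\rho(Tv,u)+\mu(u,v)+\theta(Tu,Tv)\big).$$ A curved V-datum $(\mathfrak J,\mathfrak K,P,\Delta)$ over $k$ consists of a $\mathbb Z$-graded Lie algebra $\mathfrak J$, an abelian graded Lie subalgebra $\mathfrak K$, a linear map $P:\mathfrak J\to\mathfrak J$ with $P^2=P$ and image $\mathfrak K$ whose kernel is a graded Lie subalgebra, and an element $\Delta\in\mathfrak J^1$ with $[\Delta,\Delta]=0$. A curved $L_\infty$-algebra is a $\mathbb Z$-graded $k$-space $\mathfrak K$ with graded symmetric $k$-multilinear operations $l_n:\mathfrak K^{n}\to\mathfrak K$ ($n\ge0$) of degree $1$ such that for all $n\ge 0$ and homogeneous $x_1,\dots,x_n$ $$\sum_{i=0}^n\ \sum_{\sigma\in \mathrm{Sh}(i,n-i)}\epsilon(\sigma)\,l_{n-i+1}\big(l_i(x_{\sigma(1)},\dots,x_{\sigma(i)}),x_{\sigma(i+1)},\dots,x_{\sigma(n)}\big)=0,$$ with $\epsilon(\sigma)$ the Koszul sign. A Maurer–Cartan element of it is an element $x$ of degree $0$ such that only finitely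 many $l_n(x,\dots,x)$ are nonzero and $\sum_{n\ge0}\frac1{n!}l_n(x,\dots,x)=0$. **Theorem.** Put $\mathfrak J=\bigoplus_{n\ge0}C^{n+1}(\mathfrak G,\mathfrak G)$, with $C^{n+1}$ in degree $n$ and with the bracket $[\cdot,\cdot]$; let $\mathfrak K=\bigoplus_{n\ge0}C^{n+1}(\mathfrak h,\mathfrak g)\subseteq\mathfrak J$; let $P:\mathfrak J\to\mathfrak J$ send a cochain to its component $\mathfrak h^{\otimes (n+1)}\to H^{\otimes (n+1)}\otimes_H\mathfrak g$; and let $\Delta=\pi+\rho+\mu+\eta+\theta$. Then: 1. $\Delta=\Omega$, $P$ is the identity on $\mathfrak K$, and $(\mathfrak J,\mathfrak K,P,\Delta)$ is a curved V-datum. 2. The derived brackets $l_n(f_1,\dots,f_n)=P[\cdots[[\Delta,f_1],f_2],\cdots,f_n]$ (with $l_0=P(\Delta)$) make $\mathfrak K$ a curved $L_\infty$-algebra, and for all $f,g,h\in\mathfrak K$ $$l_0=0,\qquad l_1(f)=[\mu+\eta,f],\qquad l_2(f,g)=[[\pi+\rho,f],g],\qquad l_3(f,g,h)=[[[\theta,f],g],h],\qquad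 l_n=0\ \ (n\ge4).$$ 3. An $H$-linear map $T:\mathfrak h\to\mathfrak g$ is a type II deformation map if and only if $T\in C^1(\mathfrak h,\mathfrak g)$ is a Maurer–Cartan element of $(\mathfrak K,\{l_n\})$. -/

import Mathlib

open scoped TensorProduct DirectSum

noncomputable section

namespace Pseudo


/-! ## Tensor powers of a cocommutative Hopf algebra and iterated coproducts -/

section Coproduct

/-- The tensor power `H^{⊗ J}` over `k`, a `k`-algebra with the factorwise product. -/
abbrev HPow (k H : Type*) [Field k] [Ring H] [HopfAlgebra k H] (J : Type*) : Type _ :=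
  ⨂[k] _ : J, H

variable {k H : Type*} [Field k] [Ring H] [HopfAlgebra k H]
variable {I J J₀ : Type*}

/-- Algebra homomorphisms `φ i : H → A` with pairwise commuting images induce
`H^{⊗ I} → A`, `⊗ᵢ hᵢ ↦ ∏ᵢ φ i (hᵢ)`. -/
def piLift [Fintype I] {A : Type*} [Ring A] [Algebra k A] (φ : I → H →ₐ[k] A)
    (hφ : Pairwise fun i j => ∀ a b, Commute (φ i a) (φ j b)) : HPow k H I →ₐ[k] A :=
  let F : (I → H) →* A :=
    MonoidHom.noncommPiCoprod (fun i => ((φ i : H →ₐ[k] A) : H →* A)) hφ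
  have key : ∀ [DecidableEq I] (m : I → H) (i : I) (x : H),
      F (Function.update m i x) = F (Function.update m i 1) * φ i x := by
    intro _ m i x
    have h : Function.update m i x = Function.update m i 1 * Pi.mulSingle i x := by
      ext j
      by_cases hj : j = i
      · subst hj; simp
      · simp [hj]
    rw [h, map_mul]
    congr 1
    exact MonoidHom.noncommPiCoprod_mulSingle (fun i => ((φ i : H →ₐ[k] A) : H →* A)) i x
  PiTensorProduct.liftAlgHom
    { toFun := F
      map_update_add' := by
        intro _ m i x y
        rw [key m i (x + y), key m i x, key m i y, map_add, mul_add]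
      map_update_smul' := by
        intro _ m i c x
        rw [key m i (c • x), key m i x, map_smul, mul_smul_comm] }
    (map_one F) (map_mul F)

lemma piLift_single [Fintype I] [DecidableEq I] {A : Type*} [Ring A] [Algebra k A]
    (φ : I → H →ₐ[k] A)
    (hφ : Pairwise fun i j => ∀ a b, Commute (φ i a) (φ j b)) (i : I) (a : H) :
    piLift φ hφ (PiTensorProduct.singleAlgHom (R := k) (A := fun _ : I => H) i a) = φ i a := by
  have h := MonoidHom.noncommPiCoprod_mulSingle
    (fun i => ((φ i : H →ₐ[k] A) : H →* A)) (hcomm := hφ) i a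
  simpa [piLift] using h

/-- `ι j : H → H^{⊗ J}` puts an element in the `j`-th factor and `1` in all others. -/
def factor (k : Type*) {H : Type*} [Field k] [Ring H] [HopfAlgebra k H] {J : Type*}
    [DecidableEq J] (j : J) : H →ₐ[k] HPow k H J :=
  PiTensorProduct.singleAlgHom (R := k) (A := fun _ : J => H) j

lemma factor_commute [DecidableEq J] {i j : J} (hij : i ≠ j) (a b : H) :
    Commute (factor k i a) (factor k j b) := by
  simp only [factor, PiTensorProduct.singleAlgHom_apply]
  exact Commute.tprod (R := k) (A := fun _ : J => H)
    (Pi.mulSingle_commute (f := fun _ : J => H) hij a b)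

/-- For injective `e : J₀ → J`, the map `H^{⊗ J₀} → H^{⊗ J}` that moves the `i`-th factor to the
`e i`-th place and puts `1` in the places outside the range of `e`. -/
def place (k : Type*) {H : Type*} [Field k] [Ring H] [HopfAlgebra k H] {J₀ J : Type*}
    [Fintype J₀] [DecidableEq J] (e : J₀ → J)
    (he : Function.Injective e) : HPow k H J₀ →ₐ[k] HPow k H J :=
  piLift (fun i => factor k (e i)) fun _ _ hij a b => factor_commute (he.ne hij) a b

lemma place_factor [Fintype J₀] [DecidableEq J₀] [DecidableEq J] (e : J₀ → J)
    (he : Function.Injective e) (i : J₀) (a : H) :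
    place k e he (factor k i a) = factor k (e i) a :=
  piLift_single _ _ i a

lemma factor_commute_place [Fintype J₀] [DecidableEq J] (e : J₀ → J)
    (he : Function.Injective e) {j : J} (hj : ∀ l, e l ≠ j) (a : H) (b : HPow k H J₀) :
    Commute (factor k j a) (place k e he b) := by
  induction b using PiTensorProduct.induction_on with
  | smul_tprod r h =>
    rw [map_smul]
    refine Commute.smul_right ?_ r
    have : place k e he (PiTensorProduct.tprod k h) = MonoidHom.noncommPiCoprod
        (fun i => ((factor k (e i) : H →ₐ[k] HPow k H J) : H →* HPow k H J))
        (fun _ _ hij a b => factor_commute (he.ne hij) a b) h :=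
      PiTensorProduct.lift.tprod _
    rw [this]
    exact MonoidHom.commute_noncommPiCoprod _
      (fun i x => factor_commute (fun h => hj i h.symm) a x) h
  | add x y hx hy =>
    rw [map_add]
    exact hx.add_right hy

lemma hpow_ext {A : Type*} [Ring A] [Algebra k A] [Fintype J] [DecidableEq J]
    {f g : HPow k H J →ₐ[k] A} (h : ∀ j a, f (factor k j a) = g (factor k j a)) : f = g :=
  PiTensorProduct.algHom_ext (R := k) (A := fun _ : J => H) fun j => AlgHom.ext fun a => h j a

lemma place_place_eq [Fintype J] [DecidableEq J] [Fintype J₀] [DecidableEq J₀] {e : J₀ → J} (he : Function.Injective e) (ρ : Equiv.Perm J)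
    (α : Equiv.Perm J₀) (h : ∀ l, ρ (e l) = e (α l)) (b : HPow k H J₀) :
    place k ρ ρ.injective (place k e he b) = place k e he (place k α α.injective b) := by
  have : (place k ρ ρ.injective).comp (place k e he) =
      (place k e he).comp (place (H := H) k α α.injective) :=
    hpow_ext fun j a => by simp [place_factor, h]
  exact congr($this b)

lemma place_tprod [Fintype J] [DecidableEq J] (σ : Equiv.Perm J) (h : J → H) :
    place k σ σ.injective (PiTensorProduct.tprod k h) =
      (PiTensorProduct.tprod k (h ∘ σ.symm) : HPow k H J) := by
  let F : (J → H) →* HPow k H J :=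
    ((place k σ σ.injective : HPow k H J →ₐ[k] HPow k H J) : HPow k H J →* HPow k H J).comp
      (PiTensorProduct.tprodMonoidHom k (A := fun _ : J => H))
  let F' : (J → H) →* HPow k H J :=
    (PiTensorProduct.tprodMonoidHom k (A := fun _ : J => H)).comp
      { toFun := fun h => h ∘ σ.symm
        map_one' := rfl
        map_mul' := fun _ _ => rfl }
  have : F = F' := by
    refine MonoidHom.pi_ext fun j a => ?_
    change place k σ σ.injective (factor k j a) =
      PiTensorProduct.tprod k (Pi.mulSingle j a ∘ σ.symm)
    rw [place_factor, factor, PiTensorProduct.singleAlgHom_apply]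
    congr 1
    ext i
    by_cases hi : i = σ j
    · subst hi; simp
    · have : σ.symm i ≠ j := fun h => hi (by rw [← h, σ.apply_symm_apply])
      simp [hi, this]
  exact congr($this h)

lemma conv_map_mul {A : Type*} [Ring A] [Algebra k A] {f g : WithConv (H →ₗ[k] A)}
    (hf : ∀ a b, f (a * b) = f a * f b) (hg : ∀ a b, g (a * b) = g a * g b)
    (h : ∀ a b, Commute (f a) (g b)) (a b : H) : (f * g) (a * b) = (f * g) a * (f * g) b := by
  obtain ra := Coalgebra.Repr.arbitrary k a
  obtain rb := Coalgebra.Repr.arbitrary k b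
  rw [ra.convMul_apply, rb.convMul_apply, LinearMap.convMul_apply, Bialgebra.comul_mul,
    ← ra.eq, ← rb.eq]
  simp only [Finset.sum_mul_sum, map_sum, Algebra.TensorProduct.tmul_mul_tmul,
    TensorProduct.map_tmul, LinearMap.mul'_apply]
  refine Finset.sum_congr rfl fun i _ => Finset.sum_congr rfl fun j _ => ?_
  change f _ * g _ = _
  rw [hf, hg, mul_assoc, mul_assoc, ← mul_assoc (f (rb.left j)), (h _ _).eq, mul_assoc]

/-- Postcomposition of a convolution product with an algebra homomorphism. -/
lemma comp_conv {A B : Type*} [Ring A] [Algebra k A] [Ring B] [Algebra k B] (F : A →ₐ[k] B)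
    (f g : WithConv (H →ₗ[k] A)) (a : H) : F ((f * g) a) =
      ((WithConv.toConv (F.toLinearMap ∘ₗ f.ofConv) : WithConv (H →ₗ[k] B)) *
        WithConv.toConv (F.toLinearMap ∘ₗ g.ofConv)) a :=
  congr($(LinearMap.algHom_comp_convMul_distrib F f g) a)

lemma place_comp_place [Fintype J] [DecidableEq J] (σ τ : Equiv.Perm J) :
    (place k σ σ.injective).comp (place k τ τ.injective) =
      (place k (σ * τ : Equiv.Perm J) (σ * τ).injective : HPow k H J →ₐ[k] HPow k H J) :=
  hpow_ext fun j a => by simp [place_factor]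

lemma place_one [Fintype J] [DecidableEq J] : place k (1 : Equiv.Perm J) (Equiv.injective (1 : Equiv.Perm J)) =
      AlgHom.id k (HPow k H J) :=
  hpow_ext fun j a => by simp [place_factor]

variable [Coalgebra.IsCocomm k H]

lemma conv_commute {A : Type*} [Ring A] [Algebra k A] {f g : H →ₗ[k] A}
    (h : ∀ a b, Commute (f a) (g b)) : Commute (WithConv.toConv f) (WithConv.toConv g) := by
  have e : LinearMap.mul' k A ∘ₗ TensorProduct.map f g
      = LinearMap.mul' k A ∘ₗ TensorProduct.map g f ∘ₗ
        (TensorProduct.comm k H H).toLinearMap := by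
    ext a b
    simpa using (h a b).eq
  ext a
  have := congr($e (Coalgebra.comul a))
  simpa [LinearMap.convMul_def] using this

lemma factor_conv_commute [DecidableEq J] (S : Finset J) :
    (S : Set J).Pairwise (Function.onFun Commute fun j : J =>
      WithConv.toConv ((factor k j : H →ₐ[k] HPow k H J).toLinearMap)) :=
  fun _ _ _ _ hij => conv_commute fun a b => factor_commute hij a b

/-- The convolution product `∏_{j ∈ S} ι j`, that is `a ↦` the iterated coproduct of `a`
spread over the factors in `S`, with `1` in the factors outside `S`. -/
def coprodLin (k : Type*) {H : Type*} [Field k] [Ring H] [HopfAlgebra k H]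
    [Coalgebra.IsCocomm k H] {J : Type*} [DecidableEq J] (S : Finset J) :
    WithConv (H →ₗ[k] HPow k H J) :=
  S.noncommProd (fun j => WithConv.toConv (factor k j).toLinearMap) (factor_conv_commute S)

lemma coprodLin_mem [DecidableEq J] (S : Finset J) (B : Subalgebra k (HPow k H J))
    (hB : ∀ j ∈ S, ∀ a : H, factor k j a ∈ B) (a : H) : coprodLin k S a ∈ B := by
  have : ∀ a, (coprodLin k S : WithConv (H →ₗ[k] HPow k H J)) a ∈ B := by
    refine Finset.noncommProd_induction S _ _
      (fun f : WithConv (H →ₗ[k] HPow k H J) => ∀ a, f a ∈ B) ?_ ?_ ?_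
    · intro f g hf hg a
      rw [(Coalgebra.Repr.arbitrary k a).convMul_apply]
      exact sum_mem fun i _ => mul_mem (hf _) (hg _)
    · intro a
      rw [LinearMap.convOne_apply]
      exact B.algebraMap_mem _
    · intro j hj a
      exact hB j hj a
  exact this a

lemma coprodLin_commute [DecidableEq J] {S T : Finset J} (hST : Disjoint S T) (a b : H) :
    Commute (coprodLin k S a) (coprodLin k T b) := by
  have h1 : ∀ j ∈ S, ∀ c : H, Commute (factor k j c) (coprodLin k T b) := by
    intro j hj c
    have : coprodLin k T b ∈ Subalgebra.centralizer k {factor k j c} := by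
      refine coprodLin_mem T _ (fun i hi d => ?_) b
      rw [Subalgebra.mem_centralizer_iff]
      rintro _ rfl
      exact factor_commute (Finset.disjoint_left.1 hST hj |> fun h h' => h (h' ▸ hi)) c d
    rw [Subalgebra.mem_centralizer_iff] at this
    exact this _ rfl
  have : coprodLin k S a ∈ Subalgebra.centralizer k {coprodLin k T b} := by
    refine coprodLin_mem S _ (fun i hi d => ?_) a
    rw [Subalgebra.mem_centralizer_iff]
    rintro _ rfl
    exact (h1 i hi d).symm
  rw [Subalgebra.mem_centralizer_iff] at this
  exact (this _ rfl).symm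

lemma coprodLin_insert [DecidableEq J] {S : Finset J} {j : J} (hj : j ∉ S) :
    (coprodLin k (insert j S) : WithConv (H →ₗ[k] HPow k H J)) =
      WithConv.toConv (factor k j).toLinearMap * coprodLin k S :=
  Finset.noncommProd_insert_of_notMem _ _ _ _ hj

lemma coprodLin_empty [DecidableEq J] :
    (coprodLin k (∅ : Finset J) : WithConv (H →ₗ[k] HPow k H J)) = 1 :=
  Finset.noncommProd_empty _ _

lemma coprodLin_singleton [DecidableEq J] (j : J) :
    (coprodLin k ({j} : Finset J) : WithConv (H →ₗ[k] HPow k H J)) =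
      WithConv.toConv (factor k j).toLinearMap :=
  Finset.noncommProd_singleton _ _

lemma factor_commute_coprodLin [DecidableEq J] {S : Finset J} {j : J} (hj : j ∉ S) (a b : H) :
    Commute (factor k j a) (coprodLin k S b) := by
  have := coprodLin_commute (k := k) (S := {j}) (T := S) (by simpa using hj) a b
  rwa [coprodLin_singleton] at this

/-- The iterated coproduct of `H` spread over the factors in `S ⊆ J`, as an algebra
homomorphism `H → H^{⊗ J}`. -/
def coprodOn (k : Type*) {H : Type*} [Field k] [Ring H] [HopfAlgebra k H]
    [Coalgebra.IsCocomm k H] {J : Type*} [DecidableEq J] (S : Finset J) :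
    H →ₐ[k] HPow k H J :=
  AlgHom.ofLinearMap (coprodLin k S).ofConv
    (by
      induction S using Finset.induction_on with
      | empty => simp [coprodLin_empty, LinearMap.convOne_def]
      | insert j S hj ih =>
        rw [coprodLin_insert hj, LinearMap.convMul_def]
        simp [ih, Algebra.TensorProduct.one_def])
    (by
      induction S using Finset.induction_on with
      | empty =>
        intro a b
        simp [coprodLin_empty, LinearMap.convOne_def]
      | insert j S hj ih =>
        rw [coprodLin_insert hj]
        exact conv_map_mul (fun a b => map_mul (factor k j) a b) ih
          (fun a b => factor_commute_coprodLin hj a b))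

lemma coprodOn_apply [DecidableEq J] (S : Finset J) (a : H) :
    coprodOn k S a = coprodLin k S a := rfl

/-- The iterated coproduct `Δ^{(J)} : H → H^{⊗ J}`, `a ↦ a₍₁₎ ⊗ ⋯ ⊗ a₍ₙ₎` with `n = |J|`. -/
def coprod (k : Type*) {H : Type*} [Field k] [Ring H] [HopfAlgebra k H]
    [Coalgebra.IsCocomm k H] (J : Type*) [DecidableEq J] [Fintype J] : H →ₐ[k] HPow k H J :=
  coprodOn k Finset.univ

/-- For `τ : J → I`, the map `H^{⊗ I} → H^{⊗ J}` that applies the iterated coproduct to each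
factor, the `i`-th factor being spread over the fibre `τ⁻¹(i)`. -/
def expand (k : Type*) {H : Type*} [Field k] [Ring H] [HopfAlgebra k H]
    [Coalgebra.IsCocomm k H] {I J : Type*}
    [Fintype I] [DecidableEq I] [Fintype J] [DecidableEq J] (τ : J → I) :
    HPow k H I →ₐ[k] HPow k H J :=
  piLift (fun i => coprodOn k (Finset.univ.filter fun j => τ j = i)) fun _ _ hij a b =>
    coprodLin_commute (Finset.disjoint_filter.2 fun _ _ h h' => hij (h.symm.trans h')) a b

lemma expand_factor [Fintype I] [DecidableEq I] [Fintype J] [DecidableEq J] (τ : J → I)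
    (i : I) (a : H) : expand k τ (factor k i a) =
      coprodOn k (Finset.univ.filter fun j => τ j = i) a :=
  piLift_single _ _ i a

lemma place_coprodOn [Fintype J₀] [DecidableEq J₀] [DecidableEq J] (e : J₀ → J)
    (he : Function.Injective e) (S : Finset J₀) (a : H) :
    place k e he (coprodOn k S a) = coprodOn k (S.image e) a := by
  induction S using Finset.induction_on generalizing a with
  | empty => simp [coprodOn_apply, coprodLin_empty]
  | insert j S hj ih =>
    have h1 : (place k e he).toLinearMap ∘ₗ (coprodLin k S).ofConv =
        (coprodLin k (S.image e) : WithConv (H →ₗ[k] HPow k H J)).ofConv := LinearMap.ext ih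
    have h2 : (place k e he).toLinearMap ∘ₗ (factor k j).toLinearMap =
        (factor k (e j) : H →ₐ[k] HPow k H J).toLinearMap :=
      LinearMap.ext fun a => place_factor e he j a
    rw [Finset.image_insert, coprodOn_apply, coprodOn_apply, coprodLin_insert hj,
      coprodLin_insert (by simpa [he.eq_iff] using hj), comp_conv, h1, WithConv.ofConv_toConv, h2]

lemma coprodOn_union [DecidableEq J] {S T : Finset J} (h : Disjoint S T) :
    (coprodLin k (S ∪ T) : WithConv (H →ₗ[k] HPow k H J)) = coprodLin k S * coprodLin k T :=
  Finset.noncommProd_union_of_disjoint h _ _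

lemma expand_coprodOn [Fintype I] [DecidableEq I] [Fintype J] [DecidableEq J] (τ : J → I)
    (S : Finset I) (a : H) : expand k τ (coprodOn k S a) =
      coprodOn k (Finset.univ.filter fun j => τ j ∈ S) a := by
  induction S using Finset.induction_on generalizing a with
  | empty => simp [coprodOn_apply, coprodLin_empty]
  | insert i S hi ih =>
    have h1 : (expand k τ).toLinearMap ∘ₗ (coprodLin k S).ofConv =
        (coprodLin k (Finset.univ.filter fun j => τ j ∈ S) :
          WithConv (H →ₗ[k] HPow k H J)).ofConv := LinearMap.ext ih
    have h2 : (expand k τ).toLinearMap ∘ₗ (factor k i).toLinearMap =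
        (coprodLin k (Finset.univ.filter fun j => τ j = i) :
          WithConv (H →ₗ[k] HPow k H J)).ofConv := LinearMap.ext fun a => expand_factor τ i a
    have h3 : (Finset.univ.filter fun j => τ j ∈ insert i S) =
        (Finset.univ.filter fun j => τ j = i) ∪ (Finset.univ.filter fun j => τ j ∈ S) := by
      ext j; simp
    rw [h3, coprodOn_apply, coprodOn_apply, coprodLin_insert hi,
      coprodOn_union (Finset.disjoint_filter.2 fun j _ (h : τ j = i) h' => hi (h ▸ h')), comp_conv, h1,
      WithConv.ofConv_toConv, h2]

lemma place_coprod [Fintype J] [DecidableEq J] (σ : Equiv.Perm J) (a : H) :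
    place k σ σ.injective (coprod k J a) = coprod k J a := by
  rw [coprod, place_coprodOn, Finset.image_univ_equiv]

lemma expand_coprod [Fintype I] [DecidableEq I] [Fintype J] [DecidableEq J] (τ : J → I)
    (a : H) : expand k τ (coprod k I a) = coprod k J a := by
  rw [coprod, coprod, expand_coprodOn]
  simp

end Coproduct


/-! ## The modules `H^{⊗ J} ⊗_H M` -/

section PseudoTensor

variable (k : Type*) {H : Type*} [Field k] [Ring H] [HopfAlgebra k H] [Coalgebra.IsCocomm k H]
variable {I J J₀ : Type*} [Fintype I] [DecidableEq I] [Fintype J] [DecidableEq J]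
  [Fintype J₀] [DecidableEq J₀]
variable {M N N' : Type*} [AddCommGroup M] [Module k M] [Module H M]
  [AddCommGroup N] [Module k N] [Module H N] [AddCommGroup N'] [Module k N'] [Module H N']

/-- The relations `b Δ^{(J)}(a) ⊗ z = b ⊗ a z`, as an `H^{⊗ J}`-submodule of `H^{⊗ J} ⊗_k M`. -/
def balanceRel (k H J M : Type*) [Field k] [Ring H] [HopfAlgebra k H] [Coalgebra.IsCocomm k H]
    [Fintype J] [DecidableEq J] [AddCommGroup M] [Module k M] [Module H M] :
    Submodule (HPow k H J) (HPow k H J ⊗[k] M) :=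
  Submodule.span (HPow k H J)
    {t | ∃ (a : H) (z : M), t = coprod k J a ⊗ₜ[k] z - 1 ⊗ₜ[k] (a • z)}

/-- `H^{⊗ J} ⊗_H M`, where `H^{⊗ J}` is a right `H`-module through the iterated coproduct
`Δ^{(J)} : H → H^{⊗ J}`: the quotient of `H^{⊗ J} ⊗_k M` by `b Δ^{(J)}(a) ⊗ z = b ⊗ a z`.
It is a left module over the algebra `H^{⊗ J}`. -/
def PTensor (k H J M : Type*) [Field k] [Ring H] [HopfAlgebra k H] [Coalgebra.IsCocomm k H]
    [Fintype J] [DecidableEq J] [AddCommGroup M] [Module k M] [Module H M] : Type _ :=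
  (HPow k H J ⊗[k] M) ⧸ balanceRel k H J M

instance PTensor.instAddCommGroup : AddCommGroup (PTensor k H J M) :=
  inferInstanceAs (AddCommGroup ((HPow k H J ⊗[k] M) ⧸ balanceRel k H J M))

instance PTensor.instModuleHPow : Module (HPow k H J) (PTensor k H J M) :=
  inferInstanceAs (Module (HPow k H J) ((HPow k H J ⊗[k] M) ⧸ balanceRel k H J M))

instance PTensor.instModule : Module k (PTensor k H J M) :=
  inferInstanceAs (Module k ((HPow k H J ⊗[k] M) ⧸ balanceRel k H J M))

instance PTensor.instIsScalarTower : IsScalarTower k (HPow k H J) (PTensor k H J M) :=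
  inferInstanceAs (IsScalarTower k (HPow k H J) ((HPow k H J ⊗[k] M) ⧸ balanceRel k H J M))

instance PTensor.instSMulCommClass : SMulCommClass k (HPow k H J) (PTensor k H J M) :=
  IsScalarTower.to_smulCommClass

/-- The class `b ⊗_H z`. -/
def PTensor.mk (b : HPow k H J) (z : M) : PTensor k H J M :=
  (balanceRel k H J M).mkQ (b ⊗ₜ[k] z)

variable {k}

lemma PTensor.mk_balance (b : HPow k H J) (a : H) (z : M) :
    PTensor.mk k (b * coprod k J a) z = PTensor.mk k b (a • z) := by
  refine (Submodule.Quotient.eq _).2 ?_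
  have := (balanceRel k H J M).smul_mem b (Submodule.subset_span ⟨a, z, rfl⟩)
  simpa [smul_sub, TensorProduct.smul_tmul'] using this

lemma PTensor.smul_mk (c b : HPow k H J) (z : M) :
    c • PTensor.mk k b z = PTensor.mk k (c * b) z := by
  have := ((balanceRel k H J M).mkQ.map_smul c (b ⊗ₜ[k] z)).symm
  rwa [TensorProduct.smul_tmul', smul_eq_mul] at this

lemma PTensor.induction {p : PTensor k H J M → Prop} (h0 : p 0)
    (hmk : ∀ b z, p (PTensor.mk k b z)) (hadd : ∀ x y, p x → p y → p (x + y))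
    (x : PTensor k H J M) : p x := by
  obtain ⟨t, rfl⟩ := Submodule.Quotient.mk_surjective _ x
  induction t using TensorProduct.induction_on with
  | zero => exact h0
  | tmul b z => exact hmk b z
  | add s t hs ht => exact hadd _ _ hs ht

/-- Maps out of `H^{⊗ J} ⊗_H M`. -/
def PTensor.lift {V : Type*} [AddCommGroup V] [Module k V]
    (B : HPow k H J →ₗ[k] M →ₗ[k] V)
    (hB : ∀ b a z, B (b * coprod k J a) z = B b (a • z)) : PTensor k H J M →ₗ[k] V :=
  Submodule.liftQ ((balanceRel k H J M).restrictScalars k) (TensorProduct.lift B) (by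
    intro t ht
    rw [Submodule.restrictScalars_mem] at ht
    rw [LinearMap.mem_ker]
    suffices h : ∀ c : HPow k H J, TensorProduct.lift B (c • t) = 0 by simpa using h 1
    refine Submodule.span_induction
      (p := fun t _ => ∀ c : HPow k H J, TensorProduct.lift B (c • t) = 0) ?_ ?_ ?_ ?_ ht
    · rintro _ ⟨a, z, rfl⟩ c
      simp [smul_sub, TensorProduct.smul_tmul', hB]
    · simp
    · intro x y _ _ hx hy c
      rw [smul_add, map_add, hx, hy, add_zero]
    · intro d x _ hx c
      rw [smul_smul]
      exact hx _)

lemma PTensor.lift_mk {V : Type*} [AddCommGroup V] [Module k V]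
    (B : HPow k H J →ₗ[k] M →ₗ[k] V)
    (hB : ∀ b a z, B (b * coprod k J a) z = B b (a • z)) (b : HPow k H J) (z : M) :
    PTensor.lift B hB (PTensor.mk k b z) = B b z :=
  TensorProduct.lift.tmul b z

variable (k) in
/-- `b ⊗_H z` as a bilinear function of `b` and `z`. -/
def PTensor.mkLin : HPow k H J →ₗ[k] M →ₗ[k] PTensor k H J M :=
  LinearMap.mk₂ k (PTensor.mk k)
    (fun b b' z => congrArg (balanceRel k H J M).mkQ (TensorProduct.add_tmul b b' z))
    (fun c b z => congrArg (balanceRel k H J M).mkQ (TensorProduct.smul_tmul' c b z).symm)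
    (fun b z z' => congrArg (balanceRel k H J M).mkQ (TensorProduct.tmul_add b z z'))
    (fun c b z => congrArg (balanceRel k H J M).mkQ (TensorProduct.tmul_smul c b z))

@[simp] lemma PTensor.mkLin_apply (b : HPow k H J) (z : M) :
    PTensor.mkLin k b z = PTensor.mk k b z := rfl

/-- The map `F ⊗_H id : H^{⊗ I} ⊗_H M → H^{⊗ J} ⊗_H M` induced by an algebra homomorphism
`F : H^{⊗ I} → H^{⊗ J}` that is compatible with the iterated coproducts. -/
def PTensor.baseMap (F : HPow k H I →ₐ[k] HPow k H J)
    (hF : ∀ a, F (coprod k I a) = coprod k J a) : PTensor k H I M →ₗ[k] PTensor k H J M :=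
  PTensor.lift ((PTensor.mkLin k).comp F.toLinearMap) (by
    intro b a z
    simp [hF, PTensor.mk_balance])

@[simp] lemma PTensor.baseMap_mk (F : HPow k H I →ₐ[k] HPow k H J)
    (hF : ∀ a, F (coprod k I a) = coprod k J a) (b : HPow k H I) (z : M) :
    PTensor.baseMap F hF (PTensor.mk k b z) = PTensor.mk k (F b) z :=
  PTensor.lift_mk _ _ b z

lemma PTensor.baseMap_smul (F : HPow k H I →ₐ[k] HPow k H J)
    (hF : ∀ a, F (coprod k I a) = coprod k J a) (c : HPow k H I) (w : PTensor k H I M) :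
    PTensor.baseMap F hF (c • w) = F c • PTensor.baseMap F hF w := by
  induction w using PTensor.induction with
  | h0 => simp
  | hmk b z => simp [PTensor.smul_mk]
  | hadd x y hx hy => rw [smul_add, map_add, hx, hy, map_add, smul_add]

/-- The action `σ ⊗_H id` of a permutation on `H^{⊗ J} ⊗_H M`; it moves the `j`-th tensor factor
of `H^{⊗ J}` to the `σ j`-th place. -/
def PTensor.perm (σ : Equiv.Perm J) (w : PTensor k H J M) : PTensor k H J M :=
  PTensor.baseMap (M := M) (place (H := H) k σ σ.injective) (place_coprod σ) w

lemma PTensor.perm_zero (σ : Equiv.Perm J) : PTensor.perm σ (0 : PTensor k H J M) = 0 :=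
  LinearMap.map_zero _

lemma PTensor.perm_add (σ : Equiv.Perm J) (w w' : PTensor k H J M) :
    PTensor.perm σ (w + w') = PTensor.perm σ w + PTensor.perm σ w' :=
  LinearMap.map_add _ w w'

lemma PTensor.perm_smul (σ : Equiv.Perm J) (c : k) (w : PTensor k H J M) :
    PTensor.perm σ (c • w) = c • PTensor.perm σ w :=
  LinearMap.map_smul _ c w

lemma PTensor.perm_units_smul (σ : Equiv.Perm J) (c : ℤˣ) (w : PTensor k H J M) :
    PTensor.perm σ (c • w) = c • PTensor.perm σ w := by
  rw [Units.smul_def, Units.smul_def]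
  exact map_zsmul (PTensor.baseMap (M := M) (place (H := H) k σ σ.injective) (place_coprod σ))
    (c : ℤ) w

lemma PTensor.perm_hsmul (σ : Equiv.Perm J) (c : HPow k H J) (w : PTensor k H J M) :
    PTensor.perm σ (c • w) = place k σ σ.injective c • PTensor.perm σ w :=
  PTensor.baseMap_smul _ _ c w

/-- The map `H^{⊗ I} ⊗_H M → H^{⊗ J} ⊗_H M` that applies the iterated coproduct to each factor,
the `i`-th factor being spread over `τ⁻¹(i)`. -/
def PTensor.expand (τ : J → I) (w : PTensor k H I M) : PTensor k H J M :=
  PTensor.baseMap (M := M) (Pseudo.expand (H := H) k τ) (expand_coprod τ) w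

/-- The map `id ⊗_H ψ : H^{⊗ J} ⊗_H N → H^{⊗ J} ⊗_H N'` induced by an `H`-linear map `ψ`. -/
def PTensor.map [IsScalarTower k H N] [IsScalarTower k H N'] (ψ : N →ₗ[H] N') : PTensor k H J N →ₗ[k] PTensor k H J N' :=
  PTensor.lift ((PTensor.mkLin k).compl₂ (ψ.restrictScalars k)) (by
    intro b a z
    simp [PTensor.mk_balance])

@[simp] lemma PTensor.map_mk [IsScalarTower k H N] [IsScalarTower k H N'] (ψ : N →ₗ[H] N') (b : HPow k H J) (z : N) :
    PTensor.map ψ (PTensor.mk k b z) = PTensor.mk k b (ψ z) :=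
  PTensor.lift_mk _ _ b z

lemma PTensor.map_smul [IsScalarTower k H N] [IsScalarTower k H N'] (ψ : N →ₗ[H] N') (c : HPow k H J) (w : PTensor k H J N) :
    PTensor.map ψ (c • w) = c • PTensor.map ψ w := by
  induction w using PTensor.induction with
  | h0 => simp
  | hmk b z => simp [PTensor.smul_mk]
  | hadd x y hx hy => rw [smul_add, map_add, hx, hy, map_add, smul_add]

lemma PTensor.map_baseMap [IsScalarTower k H N] [IsScalarTower k H N'] (ψ : N →ₗ[H] N') (F : HPow k H I →ₐ[k] HPow k H J)
    (hF : ∀ a, F (coprod k I a) = coprod k J a) (w : PTensor k H I N) :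
    PTensor.map ψ (PTensor.baseMap F hF w) = PTensor.baseMap F hF (PTensor.map ψ w) := by
  induction w using PTensor.induction with
  | h0 => simp
  | hmk b z => simp
  | hadd x y hx hy => simp only [map_add, hx, hy]

lemma PTensor.baseMap_comp {L : Type*} [Fintype L] [DecidableEq L]
    (F : HPow k H I →ₐ[k] HPow k H J) (hF : ∀ a, F (coprod k I a) = coprod k J a)
    (G : HPow k H J →ₐ[k] HPow k H L) (hG : ∀ a, G (coprod k J a) = coprod k L a)
    (E : HPow k H I →ₐ[k] HPow k H L) (hE : ∀ a, E (coprod k I a) = coprod k L a)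
    (h : G.comp F = E) (w : PTensor k H I M) :
    PTensor.baseMap G hG (PTensor.baseMap F hF w) = PTensor.baseMap E hE w := by
  subst h
  induction w using PTensor.induction with
  | h0 => simp
  | hmk b z => simp
  | hadd x y hx hy => simp only [map_add, hx, hy]

lemma PTensor.perm_perm (σ τ : Equiv.Perm J) (w : PTensor k H J M) :
    PTensor.perm σ (PTensor.perm τ w) = PTensor.perm (σ * τ) w :=
  PTensor.baseMap_comp _ _ _ _ _ _ (place_comp_place σ τ) w

lemma PTensor.perm_one (w : PTensor k H J M) : PTensor.perm 1 w = w := by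
  induction w using PTensor.induction with
  | h0 => exact PTensor.perm_zero 1
  | hmk b z =>
    simp only [PTensor.perm, PTensor.baseMap_mk, place_one]
    rfl
  | hadd x y hx hy => rw [PTensor.perm_add, hx, hy]

end PseudoTensor

/-! ## Pseudo-multilinear maps and skew-symmetric cochains -/

section PMaps

variable {k H : Type*} [Field k] [Ring H] [HopfAlgebra k H] [Coalgebra.IsCocomm k H]
variable {I J J₀ : Type*} [Fintype I] [DecidableEq I] [Fintype J] [DecidableEq J]
  [Fintype J₀] [DecidableEq J₀]
variable {M M' N N' : Type*} [AddCommGroup M] [Module k M] [Module H M]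
  [AddCommGroup M'] [Module k M'] [Module H M'] [AddCommGroup N] [Module k N] [Module H N]
  [AddCommGroup N'] [Module k N'] [Module H N']

/-- `Hom_{H^{⊗ J}}(M^{⊗ J}, H^{⊗ J} ⊗_H N)`: the `k`-multilinear maps `f` of a family
`x : J → M` with `f (h₁ x₁, …, hₙ xₙ) = (h₁ ⊗ ⋯ ⊗ hₙ) f (x₁, …, xₙ)`. -/
def PMap (k H J M N : Type*) [Field k] [Ring H] [HopfAlgebra k H] [Coalgebra.IsCocomm k H]
    [Fintype J] [DecidableEq J] [AddCommGroup M] [Module k M] [Module H M]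
    [AddCommGroup N] [Module k N] [Module H N] :
    Submodule k (MultilinearMap k (fun _ : J => M) (PTensor k H J N)) where
  carrier := {f | ∀ (h : J → H) (x : J → M),
    f (fun j => h j • x j) = (PiTensorProduct.tprod k h : HPow k H J) • f x}
  add_mem' := by
    intro f g hf hg h x
    simp only [add_apply, hf h x, hg h x, smul_add]
  zero_mem' := by
    intro h x
    simp
  smul_mem' := by
    intro c f hf h x
    simp only [smul_apply, hf h x, smul_comm c]

/-- `C^n(M, N)`: the skew-symmetric maps in `Hom_{H^{⊗ n}}(M^{⊗ n}, H^{⊗ n} ⊗_H N)`, that is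
`f (x₁, …, xₙ) = (-1)^σ (σ ⊗_H id) f (x_{σ 1}, …, x_{σ n})` for all permutations `σ`. -/
def Cochain (k H : Type*) (n : ℕ) (M N : Type*) [Field k] [Ring H] [HopfAlgebra k H]
    [Coalgebra.IsCocomm k H] [AddCommGroup M] [Module k M] [Module H M]
    [AddCommGroup N] [Module k N] [Module H N] :
    Submodule k (MultilinearMap k (fun _ : Fin n => M) (PTensor k H (Fin n) N)) where
  carrier := {f | f ∈ PMap k H (Fin n) M N ∧ ∀ (σ : Equiv.Perm (Fin n)) (x : Fin n → M),
    f x = Equiv.Perm.sign σ • PTensor.perm σ (f (x ∘ σ))}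
  add_mem' := by
    rintro f g ⟨hf, hf'⟩ ⟨hg, hg'⟩
    refine ⟨add_mem hf hg, fun σ x => ?_⟩
    rw [add_apply, add_apply, PTensor.perm_add, smul_add, ← hf' σ x,
      ← hg' σ x]
  zero_mem' := ⟨zero_mem _, fun σ x => by simp [PTensor.perm_zero]⟩
  smul_mem' := by
    rintro c f ⟨hf, hf'⟩
    refine ⟨Submodule.smul_mem _ c hf, fun σ x => ?_⟩
    rw [smul_apply, smul_apply, PTensor.perm_smul, smul_comm, ← hf' σ x]

/-- Functoriality of cochains: `f ↦ (id ⊗_H ψ) ∘ f ∘ φ^{⊗ n}` for `H`-linear maps `φ`, `ψ`. -/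
def Cochain.map [IsScalarTower k H M] [IsScalarTower k H M'] [IsScalarTower k H N]
    [IsScalarTower k H N'] {n : ℕ} (φ : M' →ₗ[H] M) (ψ : N →ₗ[H] N') :
    Cochain k H n M N →ₗ[k] Cochain k H n M' N' where
  toFun f := ⟨(PTensor.map (k := k) (J := Fin n) ψ).compMultilinearMap
      (f.1.compLinearMap fun _ => φ.restrictScalars k), by
    refine ⟨fun h x => ?_, fun σ x => ?_⟩
    · simpa [PTensor.map_smul] using congrArg (PTensor.map ψ) (f.2.1 h fun j => φ (x j))
    · have := congrArg (PTensor.map (k := k) ψ) (f.2.2 σ fun j => φ (x j))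
      rw [Units.smul_def, map_zsmul, PTensor.perm, PTensor.map_baseMap] at this
      exact this⟩
  map_add' f g := by
    ext x
    simp
  map_smul' c f := by
    ext x
    simp

end PMaps


/-! ## Composition of pseudo-multilinear maps -/

section Grafts

variable {I J J₀ M : Type*}

/-- The shape of a composition `f (…, g (…), …)`: `f` has arguments indexed by `I`, `g` has
arguments indexed by `J₀` and is inserted at the place `i₀` of `f`, and the arguments of the result
are indexed by `J`. The argument `j` of `g` is the argument `e j` of the result, and for `i ≠ i₀`
the argument `i` of `f` is the argument `s i` of the result. The map `τ` sends an argument of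
the result to the argument of `f` in which it occurs. -/
structure Graft (I J₀ J : Type*) where
  i₀ : I
  e : J₀ → J
  s : I → J
  τ : J → I
  e_inj : Function.Injective e
  τ_eq_iff : ∀ j, τ j = i₀ ↔ ∃ l, e l = j
  τ_s : ∀ i, i ≠ i₀ → τ (s i) = i
  s_τ : ∀ j, τ j ≠ i₀ → s (τ j) = j

lemma Graft.τ_e (G : Graft I J₀ J) (l : J₀) : G.τ (G.e l) = G.i₀ :=
  (G.τ_eq_iff _).2 ⟨l, rfl⟩

lemma Graft.update_e [DecidableEq J] [DecidableEq J₀] (G : Graft I J₀ J) (x : J → M) (l : J₀) (u : M) :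
    Function.update x (G.e l) u ∘ G.e = Function.update (x ∘ G.e) l u :=
  Function.update_comp_eq_of_injective x G.e_inj l u

lemma Graft.update_e_s [DecidableEq J] (G : Graft I J₀ J) (x : J → M) (l : J₀) (u : M) (i : I)
    (hi : i ≠ G.i₀) : (Function.update x (G.e l) u ∘ G.s) i = (x ∘ G.s) i := by
  refine Function.update_of_ne (fun h => hi ?_) _ _
  rw [← G.τ_s i hi]
  exact (G.τ_eq_iff _).2 ⟨l, h.symm⟩

lemma Graft.update_of_ne [DecidableEq J] (G : Graft I J₀ J) (x : J → M) (j : J) (hj : G.τ j ≠ G.i₀) (u : M) :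
    Function.update x j u ∘ G.e = x ∘ G.e := by
  ext l
  exact Function.update_of_ne (fun h => hj ((G.τ_eq_iff _).2 ⟨l, h⟩)) _ _

lemma Graft.update_of_ne_s [DecidableEq I] [DecidableEq J] (G : Graft I J₀ J) (x : J → M) (j : J) (hj : G.τ j ≠ G.i₀) (u : M)
    (i : I) (hi : i ≠ G.i₀) :
    (Function.update x j u ∘ G.s) i = Function.update (x ∘ G.s) (G.τ j) u i := by
  by_cases h : i = G.τ j
  · subst h
    simp [G.s_τ j hj]
  · have : G.s i ≠ j := fun h' => h (by rw [← G.τ_s i hi, h'])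
    simp [h, this]

end Grafts

section Composition

variable {k H : Type*} [Field k] [Ring H] [HopfAlgebra k H] [Coalgebra.IsCocomm k H]
variable {I J J₀ : Type*} [Fintype I] [DecidableEq I] [Fintype J] [DecidableEq J]
  [Fintype J₀] [DecidableEq J₀]
variable {M N : Type*} [AddCommGroup M] [Module k M] [Module H M]
  [AddCommGroup N] [Module k N] [Module H N]

lemma PMap.update_smul {f : MultilinearMap k (fun _ : I => M) (PTensor k H I N)}
    (hf : f ∈ PMap k H I M N) (x : I → M) (i : I) (a : H) (z : M) :
    f (Function.update x i (a • z)) = factor k i a • f (Function.update x i z) := by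
  have := hf (Pi.mulSingle i a) (Function.update x i z)
  have h : (fun j => (Pi.mulSingle i a : I → H) j • Function.update x i z j) =
      Function.update x i (a • z) := by
    ext j
    by_cases hj : j = i
    · subst hj; simp
    · simp [hj]
  rw [h] at this
  exact this

lemma PMap.mem_of_single {f : MultilinearMap k (fun _ : I => M) (PTensor k H I N)}
    (hf : ∀ (x : I → M) (i : I) (a : H) (u : M),
      f (Function.update x i (a • u)) = factor k i a • f (Function.update x i u)) :
    f ∈ PMap k H I M N := by
  intro h x
  suffices key : ∀ S : Finset I, f (fun j => if j ∈ S then h j • x j else x j) =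
      (PiTensorProduct.tprod k (fun j => if j ∈ S then h j else 1) : HPow k H I) • f x by
    simpa using key Finset.univ
  intro S
  induction S using Finset.induction_on with
  | empty =>
    simp only [Finset.notMem_empty, if_false]
    exact (one_smul (HPow k H I) (f x)).symm
  | insert i S hi ih =>
    have h1 : (fun j => if j ∈ insert i S then h j • x j else x j) =
        Function.update (fun j => if j ∈ S then h j • x j else x j) i (h i • x i) := by
      ext j
      by_cases hj : j = i
      · subst hj; simp
      · simp [hj]
    have h2 : Function.update (fun j => if j ∈ S then h j • x j else x j) i (x i) =
        fun j => if j ∈ S then h j • x j else x j := by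
      ext j
      by_cases hj : j = i
      · subst hj; simp [hi]
      · simp [hj]
    have h3 : (factor k i (h i) : HPow k H I) *
        PiTensorProduct.tprod k (fun j => if j ∈ S then h j else 1) =
        PiTensorProduct.tprod k (fun j => if j ∈ insert i S then h j else 1) := by
      rw [factor, PiTensorProduct.singleAlgHom_apply, PiTensorProduct.tprod_mul_tprod]
      congr 1
      ext j
      by_cases hj : j = i
      · subst hj; simp [hi]
      · simp [hj]
    rw [h1, hf, h2, ih, smul_smul, h3]

/-- For `w = ∑ b ⊗_H z` in `H^{⊗ J₀} ⊗_H M`, the element `f (…, w, …)` of `H^{⊗ J} ⊗_H N` with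
`w` inserted at the place `i₀` of `f` and the other arguments of `f` taken from `x`. With
`f (…, z, …) = ∑ c ⊗_H y` it is `∑ b · Δ_τ(c) ⊗_H y`, where `Δ_τ : H^{⊗ I} → H^{⊗ J}` applies the
iterated coproduct to the factor `i₀` and `b` is placed in the factors `e l`. -/
def insertAt (G : Graft I J₀ J) (f : PMap k H I M N) (x : I → M) :
    PTensor k H J₀ M →ₗ[k] PTensor k H J N :=
  PTensor.lift
    (LinearMap.mk₂ k
      (fun b z => place k G.e G.e_inj b • PTensor.expand G.τ (f.1 (Function.update x G.i₀ z)))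
      (fun b b' z => by rw [map_add, add_smul])
      (fun c b z => by rw [map_smul, smul_assoc])
      (fun b z z' => by
        rw [MultilinearMap.map_update_add, PTensor.expand, map_add, smul_add]; rfl)
      (fun c b z => by
        rw [MultilinearMap.map_update_smul, PTensor.expand, map_smul, smul_comm]; rfl))
    (by
      intro b a z
      have h1 : place k G.e G.e_inj (coprod k J₀ a) = expand k G.τ (factor k G.i₀ a) := by
        rw [coprod, place_coprodOn, expand_factor]
        congr 1
        ext j
        simp [G.τ_eq_iff]
      rw [LinearMap.mk₂_apply, LinearMap.mk₂_apply, PMap.update_smul f.2, PTensor.expand,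
        PTensor.expand, PTensor.baseMap_smul, map_mul, mul_smul, h1])

lemma insertAt_mk (G : Graft I J₀ J) (f : PMap k H I M N) (x : I → M) (b : HPow k H J₀)
    (z : M) : insertAt G f x (PTensor.mk k b z) =
      place k G.e G.e_inj b • PTensor.expand G.τ (f.1 (Function.update x G.i₀ z)) :=
  PTensor.lift_mk _ _ b z

/-- `insertAt` does not depend on the entry `i₀` of `x`. -/
lemma insertAt_congr (G : Graft I J₀ J) (f : PMap k H I M N) {x y : I → M}
    (h : ∀ i, i ≠ G.i₀ → x i = y i) (w : PTensor k H J₀ M) :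
    insertAt G f x w = insertAt G f y w := by
  have : ∀ z, Function.update x G.i₀ z = Function.update y G.i₀ z := by
    intro z
    ext i
    by_cases hi : i = G.i₀
    · subst hi; simp
    · simp [hi, h i hi]
  induction w using PTensor.induction with
  | h0 => simp
  | hmk b z => rw [insertAt_mk, insertAt_mk, this]
  | hadd x y hx hy => rw [map_add, map_add, hx, hy]

lemma insertAt_update_add (G : Graft I J₀ J) (f : PMap k H I M N) (x : I → M) (i : I)
    (hi : i ≠ G.i₀) (u v : M) (w : PTensor k H J₀ M) :
    insertAt G f (Function.update x i (u + v)) w =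
      insertAt G f (Function.update x i u) w + insertAt G f (Function.update x i v) w := by
  induction w using PTensor.induction with
  | h0 => simp
  | hmk b z =>
    rw [insertAt_mk, insertAt_mk, insertAt_mk, Function.update_comm hi, Function.update_comm hi,
      Function.update_comm hi, MultilinearMap.map_update_add, PTensor.expand, map_add, smul_add]
    rfl
  | hadd x y hx hy => simp only [map_add, hx, hy]; abel

lemma insertAt_update_smul (G : Graft I J₀ J) (f : PMap k H I M N) (x : I → M) (i : I)
    (hi : i ≠ G.i₀) (c : k) (u : M) (w : PTensor k H J₀ M) :
    insertAt G f (Function.update x i (c • u)) w = c • insertAt G f (Function.update x i u) w := by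
  induction w using PTensor.induction with
  | h0 => simp
  | hmk b z =>
    rw [insertAt_mk, insertAt_mk, Function.update_comm hi, Function.update_comm hi,
      MultilinearMap.map_update_smul, PTensor.expand, map_smul, smul_comm]
    rfl
  | hadd x y hx hy => simp only [map_add, hx, hy, smul_add]

lemma insertAt_smul (G : Graft I J₀ J) (f : PMap k H I M N) (x : I → M) (c : HPow k H J₀)
    (w : PTensor k H J₀ M) :
    insertAt G f x (c • w) = place k G.e G.e_inj c • insertAt G f x w := by
  induction w using PTensor.induction with
  | h0 => simp
  | hmk b z => rw [PTensor.smul_mk, insertAt_mk, insertAt_mk, map_mul, mul_smul]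
  | hadd x y hx hy => rw [smul_add, map_add, hx, hy, map_add, smul_add]

lemma insertAt_update_hsmul (G : Graft I J₀ J) (f : PMap k H I M N) (x : I → M) (i : I)
    (hi : i ≠ G.i₀) (a : H) (u : M) (w : PTensor k H J₀ M) :
    insertAt G f (Function.update x i (a • u)) w =
      factor k (G.s i) a • insertAt G f (Function.update x i u) w := by
  induction w using PTensor.induction with
  | h0 => simp
  | hmk b z =>
    have h1 : (Finset.univ.filter fun j => G.τ j = i) = {G.s i} := by
      ext j
      simp only [Finset.mem_filter, Finset.mem_univ, true_and, Finset.mem_singleton]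
      constructor
      · rintro rfl
        exact (G.s_τ j hi).symm
      · rintro rfl
        exact G.τ_s i hi
    have h2 : Commute (factor k (G.s i) a) (place k G.e G.e_inj b) := by
      refine factor_commute_place G.e G.e_inj (fun l hl => hi ?_) a b
      rw [← G.τ_s i hi]
      exact (G.τ_eq_iff _).2 ⟨l, hl⟩
    rw [insertAt_mk, insertAt_mk, Function.update_comm hi, Function.update_comm hi,
      PMap.update_smul f.2, PTensor.expand, PTensor.baseMap_smul, expand_factor, h1, smul_smul,
      smul_smul, coprodOn_apply, coprodLin_singleton, h2.eq]
    rfl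
  | hadd x y hx hy => simp only [map_add, hx, hy, smul_add]

/-- The underlying function of a composition. -/
def graftFun (G : Graft I J₀ J) (f : PMap k H I M N) (g : PMap k H J₀ M M) (x : J → M) :
    PTensor k H J N := insertAt G f (x ∘ G.s) (g.1 (x ∘ G.e))

lemma graftFun_update_e (G : Graft I J₀ J) (f : PMap k H I M N) (g : PMap k H J₀ M M)
    (x : J → M) (l : J₀) (u : M) : graftFun G f g (Function.update x (G.e l) u) =
      insertAt G f (x ∘ G.s) (g.1 (Function.update (x ∘ G.e) l u)) := by
  rw [graftFun, G.update_e, insertAt_congr G f (fun i hi => G.update_e_s x l u i hi)]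

lemma graftFun_update_of_ne (G : Graft I J₀ J) (f : PMap k H I M N) (g : PMap k H J₀ M M)
    (x : J → M) (j : J) (u : M) (hj : G.τ j ≠ G.i₀) : graftFun G f g (Function.update x j u) =
      insertAt G f (Function.update (x ∘ G.s) (G.τ j) u) (g.1 (x ∘ G.e)) := by
  rw [graftFun, G.update_of_ne x j hj u, insertAt_congr G f (G.update_of_ne_s x j hj u)]

/-- The composition `x ↦ f (…, g (x ∘ e), …)` as a multilinear map. -/
def graftMul (G : Graft I J₀ J) (f : PMap k H I M N) (g : PMap k H J₀ M M) :
    MultilinearMap k (fun _ : J => M) (PTensor k H J N) :=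
  MultilinearMap.mk' (graftFun G f g)
    (by
    intro x j u v
    by_cases hj : G.τ j = G.i₀
    · obtain ⟨l, rfl⟩ := (G.τ_eq_iff j).1 hj
      rw [graftFun_update_e, graftFun_update_e, graftFun_update_e,
        MultilinearMap.map_update_add, map_add]
    · rw [graftFun_update_of_ne G f g _ _ _ hj, graftFun_update_of_ne G f g _ _ _ hj,
        graftFun_update_of_ne G f g _ _ _ hj, insertAt_update_add G f _ _ hj])
    (by
    intro x j c u
    by_cases hj : G.τ j = G.i₀
    · obtain ⟨l, rfl⟩ := (G.τ_eq_iff j).1 hj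
      rw [graftFun_update_e, graftFun_update_e, MultilinearMap.map_update_smul, map_smul]
    · rw [graftFun_update_of_ne G f g _ _ _ hj, graftFun_update_of_ne G f g _ _ _ hj,
        insertAt_update_smul G f _ _ hj])

/-- The composition `x ↦ f (…, g (x ∘ e), …)` of shape `G`. -/
def graftComp (G : Graft I J₀ J) (f : PMap k H I M N) (g : PMap k H J₀ M M) :
    PMap k H J M N :=
  ⟨graftMul G f g, by
    refine PMap.mem_of_single fun x j a u => ?_
    change graftFun G f g _ = _ • graftFun G f g _
    by_cases hj : G.τ j = G.i₀
    · obtain ⟨l, rfl⟩ := (G.τ_eq_iff j).1 hj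
      rw [graftFun_update_e, graftFun_update_e, PMap.update_smul g.2, insertAt_smul, place_factor]
    · rw [graftFun_update_of_ne G f g _ _ _ hj, graftFun_update_of_ne G f g _ _ _ hj,
        insertAt_update_hsmul G f _ _ hj, G.s_τ j hj]⟩

lemma graftComp_apply (G : Graft I J₀ J) (f : PMap k H I M N) (g : PMap k H J₀ M M)
    (x : J → M) :
    (graftComp G f g).1 x = insertAt G f (x ∘ G.s) (g.1 (x ∘ G.e)) := rfl

/-! Compatibility of the composition with permutations of the arguments. -/

lemma place_expand_eq {τ : J → I} (ρ : Equiv.Perm J) (β : Equiv.Perm I)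
    (h : ∀ j, τ (ρ j) = β (τ j)) (b : HPow k H I) :
    place k ρ ρ.injective (expand k τ b) = expand k τ (place k β β.injective b) := by
  have : (place k ρ ρ.injective).comp (expand k τ) =
      (expand k τ).comp (place (H := H) k β β.injective) := by
    refine hpow_ext fun i a => ?_
    change place k ρ ρ.injective (expand k τ (factor k i a)) =
      expand k τ (place k β β.injective (factor k i a))
    rw [place_factor, expand_factor, expand_factor,
      place_coprodOn]
    refine congrArg (fun S => coprodOn k S a) ?_
    ext j
    simp only [Finset.mem_image, Finset.mem_filter, Finset.mem_univ, true_and]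
    constructor
    · rintro ⟨l, rfl, rfl⟩
      exact h l
    · intro hj
      refine ⟨ρ.symm j, β.injective ?_, ρ.apply_symm_apply j⟩
      rw [← h, ρ.apply_symm_apply, hj]
  exact congr($this b)

lemma PTensor.perm_expand {τ : J → I} (ρ : Equiv.Perm J) (β : Equiv.Perm I)
    (h : ∀ j, τ (ρ j) = β (τ j)) (w : PTensor k H I N) :
    PTensor.perm ρ (PTensor.expand τ w) = PTensor.expand τ (PTensor.perm β w) := by
  induction w using PTensor.induction with
  | h0 => simp [PTensor.perm, PTensor.expand]
  | hmk b z => simp [PTensor.perm, PTensor.expand, place_expand_eq ρ β h]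
  | hadd x y hx hy =>
    simp only [PTensor.perm, PTensor.expand, map_add] at hx hy ⊢
    rw [hx, hy]

lemma PTensor.perm_insertAt (G : Graft I J₀ J) (f : PMap k H I M N) (x y : I → M)
    (ρ : Equiv.Perm J) (α : Equiv.Perm J₀) (β : Equiv.Perm I) (ε : ℤˣ)
    (hα : ∀ l, ρ (G.e l) = G.e (α l)) (hβ : ∀ j, G.τ (ρ j) = β (G.τ j))
    (hf : ∀ z, f.1 (Function.update y G.i₀ z) =
      ε • PTensor.perm β (f.1 (Function.update x G.i₀ z))) (w : PTensor k H J₀ M) :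
    insertAt G f y (PTensor.perm α w) = ε • PTensor.perm ρ (insertAt G f x w) := by
  induction w using PTensor.induction with
  | h0 => rw [PTensor.perm_zero, map_zero, map_zero, PTensor.perm_zero, smul_zero]
  | hmk b z =>
    rw [PTensor.perm, PTensor.baseMap_mk, insertAt_mk, insertAt_mk, PTensor.perm_hsmul,
      PTensor.perm_expand ρ β hβ, place_place_eq G.e_inj ρ α hα, hf, smul_comm]
    congr 1
    rw [PTensor.expand, Units.smul_def, Units.smul_def]
    exact map_zsmul (PTensor.baseMap (M := N) (Pseudo.expand (H := H) k G.τ) (expand_coprod G.τ))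
      (ε : ℤ) _
  | hadd u v hu hv =>
    rw [PTensor.perm_add, map_add, hu, hv, map_add, PTensor.perm_add, smul_add]

end Composition


/-! ## Shuffles -/

section Shuffles

/-- The `(p, N - p)`-shuffles in `S_N`: the permutations `σ` of `{0, …, N - 1}` that are increasing
on `{0, …, p - 1}` and on `{p, …, N - 1}`. -/
def shuffles (p N : ℕ) : Finset (Equiv.Perm (Fin N)) :=
  open scoped Classical in
  Finset.univ.filter fun σ =>
    (∀ i j : Fin N, i < j → (j : ℕ) < p → σ i < σ j) ∧
    (∀ i j : Fin N, p ≤ (i : ℕ) → i < j → σ i < σ j)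

/-- The decomposition of `{0, …, m + n}` into its first `n + 1` and its last `m` elements. -/
def blockEquiv (m n : ℕ) : Fin (n + 1) ⊕ Fin m ≃ Fin (m + n + 1) :=
  finSumFinEquiv.trans (finCongr (by omega))

lemma blockEquiv_inl (m n : ℕ) (l : Fin (n + 1)) :
    ((blockEquiv m n (Sum.inl l) : Fin (m + n + 1)) : ℕ) = l := by
  simp [blockEquiv]

lemma blockEquiv_inr (m n : ℕ) (i : Fin m) :
    ((blockEquiv m n (Sum.inr i) : Fin (m + n + 1)) : ℕ) = n + 1 + i := by
  simp [blockEquiv, add_comm]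

/-- The permutation of `{0, …, m + n}` given by a permutation of the first `n + 1` elements and a
permutation of the last `m` elements. -/
def blockPerm (m n : ℕ) :
    Equiv.Perm (Fin (n + 1)) × Equiv.Perm (Fin m) →* Equiv.Perm (Fin (m + n + 1)) :=
  (blockEquiv m n).permCongrHom.toMonoidHom.comp (Equiv.Perm.sumCongrHom _ _)

lemma blockPerm_inl {m n : ℕ} (α : Equiv.Perm (Fin (n + 1))) (β : Equiv.Perm (Fin m))
    (l : Fin (n + 1)) : blockPerm m n (α, β) (blockEquiv m n (Sum.inl l)) =
      blockEquiv m n (Sum.inl (α l)) := by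
  simp [blockPerm, Equiv.permCongrHom, Equiv.Perm.sumCongrHom]

lemma blockPerm_inr {m n : ℕ} (α : Equiv.Perm (Fin (n + 1))) (β : Equiv.Perm (Fin m))
    (i : Fin m) : blockPerm m n (α, β) (blockEquiv m n (Sum.inr i)) =
      blockEquiv m n (Sum.inr (β i)) := by
  simp [blockPerm, Equiv.permCongrHom, Equiv.Perm.sumCongrHom]

lemma sign_blockPerm {m n : ℕ} (α : Equiv.Perm (Fin (n + 1))) (β : Equiv.Perm (Fin m)) :
    Equiv.Perm.sign (blockPerm m n (α, β)) = Equiv.Perm.sign α * Equiv.Perm.sign β := by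
  have : blockPerm m n (α, β) = (blockEquiv m n).permCongr (Equiv.Perm.sumCongr α β) := rfl
  rw [this, Equiv.Perm.sign_permCongr, Equiv.Perm.sign_sumCongr]

lemma mem_shuffles_iff {m n : ℕ} (σ : Equiv.Perm (Fin (m + n + 1))) :
    σ ∈ shuffles (n + 1) (m + n + 1) ↔
      StrictMono (fun l => σ (blockEquiv m n (Sum.inl l))) ∧
      StrictMono (fun i => σ (blockEquiv m n (Sum.inr i))) := by
  simp only [shuffles, Finset.mem_filter, Finset.mem_univ, true_and]
  refine and_congr ⟨fun h l l' hl => h _ _ ?_ ?_, fun h i j hij hj => ?_⟩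
    ⟨fun h l l' hl => h _ _ ?_ ?_, fun h i j hi hij => ?_⟩
  · rw [Fin.lt_def, blockEquiv_inl, blockEquiv_inl]; exact hl
  · rw [blockEquiv_inl]; exact l'.2
  · have hi' : blockEquiv m n (Sum.inl ⟨i, by omega⟩) = i := by
      ext; rw [blockEquiv_inl]
    have hj' : blockEquiv m n (Sum.inl ⟨j, hj⟩) = j := by
      ext; rw [blockEquiv_inl]
    have := @h ⟨i, by omega⟩ ⟨j, hj⟩ hij
    simpa only [hi', hj'] using this
  · rw [blockEquiv_inr]; omega
  · rw [Fin.lt_def, blockEquiv_inr, blockEquiv_inr]; simpa using hl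
  · have hi' : blockEquiv m n (Sum.inr ⟨i - (n + 1), by omega⟩) = i := by
      ext; rw [blockEquiv_inr]; simp only; omega
    have hj' : blockEquiv m n (Sum.inr ⟨j - (n + 1), by omega⟩) = j := by
      ext; rw [blockEquiv_inr]; simp only; omega
    have := @h ⟨i - (n + 1), by omega⟩ ⟨j - (n + 1), by omega⟩
      (by rw [Fin.lt_def]; simp only; omega)
    simpa only [hi', hj'] using this

lemma exists_shuffle {m n : ℕ} (τ : Equiv.Perm (Fin (m + n + 1))) :
    ∃ ρ, τ * blockPerm m n ρ ∈ shuffles (n + 1) (m + n + 1) := by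
  refine ⟨(Tuple.sort fun l => τ (blockEquiv m n (Sum.inl l)),
    Tuple.sort fun i => τ (blockEquiv m n (Sum.inr i))), (mem_shuffles_iff _).2 ⟨?_, ?_⟩⟩
  · refine Monotone.strictMono_of_injective ?_ ?_
    · intro a b hab
      have := Tuple.monotone_sort (fun l => τ (blockEquiv m n (Sum.inl l))) hab
      simp only [Equiv.Perm.mul_apply, blockPerm_inl]
      exact this
    · intro a b h
      simpa using h
  · refine Monotone.strictMono_of_injective ?_ ?_
    · intro a b hab
      have := Tuple.monotone_sort (fun i => τ (blockEquiv m n (Sum.inr i))) hab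
      simp only [Equiv.Perm.mul_apply, blockPerm_inr]
      exact this
    · intro a b h
      simpa using h

lemma perm_eq_one_of_strictMono {N : ℕ} {P : Type*} [LinearOrder P] {φ : Fin N → P}
    (α : Equiv.Perm (Fin N)) (h : StrictMono φ) (h' : StrictMono fun l => φ (α l)) : α = 1 := by
  have hα : StrictMono α := fun a b hab => h.lt_iff_lt.1 (h' hab)
  have := Subsingleton.elim (hα.orderIsoOfSurjective α α.surjective) (OrderIso.refl (Fin N))
  ext l
  have h2 := congrArg (fun g : Fin N ≃o Fin N => (g l : ℕ)) this
  simpa using h2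

lemma shuffle_unique {m n : ℕ} {σ : Equiv.Perm (Fin (m + n + 1))}
    (ρ : Equiv.Perm (Fin (n + 1)) × Equiv.Perm (Fin m))
    (h : σ ∈ shuffles (n + 1) (m + n + 1))
    (h' : σ * blockPerm m n ρ ∈ shuffles (n + 1) (m + n + 1)) : ρ = 1 := by
  obtain ⟨α, β⟩ := ρ
  rw [mem_shuffles_iff] at h h'
  simp only [Equiv.Perm.mul_apply, blockPerm_inl, blockPerm_inr] at h'
  exact Prod.ext (perm_eq_one_of_strictMono α h.1 h'.1) (perm_eq_one_of_strictMono β h.2 h'.2)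

/-- Left translation leaves the sum over all shuffles of a right block-invariant function
unchanged. -/
lemma sum_shuffles_translate {m n : ℕ} {V : Type*} [AddCommMonoid V]
    (T : Equiv.Perm (Fin (m + n + 1)) → V) (hT : ∀ σ ρ, T (σ * blockPerm m n ρ) = T σ)
    (s : Equiv.Perm (Fin (m + n + 1))) :
    ∑ σ ∈ shuffles (n + 1) (m + n + 1), T (s * σ) =
      ∑ σ ∈ shuffles (n + 1) (m + n + 1), T σ := by
  choose r hr using fun τ : Equiv.Perm (Fin (m + n + 1)) => exists_shuffle τ
  have hinj : ∀ a ∈ shuffles (n + 1) (m + n + 1), ∀ b ∈ shuffles (n + 1) (m + n + 1),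
      s * a * blockPerm m n (r (s * a)) = s * b * blockPerm m n (r (s * b)) → a = b := by
    intro a ha b hb hab
    have h1 : a * blockPerm m n (r (s * a) * (r (s * b))⁻¹) = b := by
      rw [map_mul, map_inv, ← mul_assoc, mul_inv_eq_iff_eq_mul]
      simpa [mul_assoc] using hab
    have h2 := shuffle_unique _ ha (h1 ▸ hb)
    rw [h2, map_one, mul_one] at h1
    exact h1
  refine Finset.sum_bij (fun σ _ => s * σ * blockPerm m n (r (s * σ))) (fun σ _ => hr _)
    (fun a ha b hb h => hinj a ha b hb h) ?_ (fun σ _ => (hT _ _).symm)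
  intro b hb
  obtain ⟨a, ha, h⟩ := Finset.surj_on_of_inj_on_of_card_le
    (fun σ _ => s * σ * blockPerm m n (r (s * σ))) (fun σ _ => hr _)
    (fun a b ha hb h => hinj a ha b hb h) le_rfl b hb
  exact ⟨a, ha, h.symm⟩

end Shuffles

/-! ## The circle product and the Nijenhuis–Richardson bracket -/

section NR

variable {k H : Type*} [Field k] [Ring H] [HopfAlgebra k H] [Coalgebra.IsCocomm k H]
variable {M N : Type*} [AddCommGroup M] [Module k M] [Module H M]
  [AddCommGroup N] [Module k N] [Module H N]

/-- The action `(σ f) (x) = (-1)^σ (σ ⊗_H id) f (x_{σ 1}, …, x_{σ n})` of a permutation. -/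
def signedPerm {J : Type*} [Fintype J] [DecidableEq J] (σ : Equiv.Perm J)
    (f : PMap k H J M N) : PMap k H J M N :=
  ⟨Equiv.Perm.sign σ • (PTensor.baseMap (M := N) (place (H := H) k σ σ.injective)
    (place_coprod σ)).compMultilinearMap (f.1.domDomCongr σ), by
    rw [Units.smul_def]
    refine zsmul_mem (fun h x => ?_) _
    have h1 := congrArg (PTensor.perm σ) (f.2 (h ∘ σ) (x ∘ σ))
    rw [PTensor.perm_hsmul] at h1
    have h2 : place k σ σ.injective (PiTensorProduct.tprod k (h ∘ σ)) =
        (PiTensorProduct.tprod k h : HPow k H J) := by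
      rw [place_tprod]
      congr 1
      ext j
      simp
    rw [h2] at h1
    exact h1⟩

lemma signedPerm_apply {J : Type*} [Fintype J] [DecidableEq J] (σ : Equiv.Perm J)
    (f : PMap k H J M N) (x : J → M) :
    (signedPerm σ f).1 x = Equiv.Perm.sign σ • PTensor.perm σ (f.1 (x ∘ σ)) := rfl

lemma signedPerm_mul {J : Type*} [Fintype J] [DecidableEq J] (σ τ : Equiv.Perm J)
    (f : PMap k H J M N) : signedPerm (σ * τ) f = signedPerm σ (signedPerm τ f) := by
  ext x
  rw [signedPerm_apply, signedPerm_apply, signedPerm_apply, PTensor.perm_units_smul,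
    PTensor.perm_perm, smul_smul, Equiv.Perm.sign_mul]
  rfl

/-- `signedPerm σ` as a linear map. -/
def signedPermLin {J : Type*} [Fintype J] [DecidableEq J] (σ : Equiv.Perm J) :
    PMap k H J M N →ₗ[k] PMap k H J M N where
  toFun := signedPerm σ
  map_add' f g := by
    ext x
    simp only [signedPerm_apply, Submodule.coe_add, add_apply, PTensor.perm_add, smul_add]
  map_smul' c f := by
    ext x
    simp only [signedPerm_apply, Submodule.coe_smul, smul_apply, PTensor.perm_smul,
      RingHom.id_apply]
    rw [smul_comm]

lemma signedPerm_sum {J : Type*} [Fintype J] [DecidableEq J] (s : Equiv.Perm J)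
    {ι : Type*} (S : Finset ι) (F : ι → PMap k H J M N) :
    signedPerm s (∑ i ∈ S, F i) = ∑ i ∈ S, signedPerm s (F i) :=
  map_sum (signedPermLin s) F S

/-- The shape of the composition `f (g (x₁, …, x_{n+1}), x_{n+2}, …, x_{m+n+1})` of an
`(m + 1)`-ary `f` with an `(n + 1)`-ary `g`. -/
def Graft.first (m n : ℕ) : Graft (Fin (m + 1)) (Fin (n + 1)) (Fin (m + n + 1)) where
  i₀ := 0
  e l := ⟨l, by omega⟩
  s i := ⟨n + i, by omega⟩
  τ j := ⟨j - n, by omega⟩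
  e_inj a b h := by
    simpa [Fin.ext_iff] using h
  τ_eq_iff j := by
    constructor
    · intro h
      have : (j : ℕ) - n = 0 := by simpa [Fin.ext_iff] using h
      exact ⟨⟨j, by omega⟩, rfl⟩
    · rintro ⟨l, rfl⟩
      ext
      simp
      omega
  τ_s i _ := by
    ext
    simp
  s_τ j h := by
    have : (j : ℕ) - n ≠ 0 := by simpa [Fin.ext_iff] using h
    ext
    simp
    omega

lemma Graft.first_e {m n : ℕ} (l : Fin (n + 1)) :
    (Graft.first m n).e l = blockEquiv m n (Sum.inl l) := by
  ext
  rw [blockEquiv_inl]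
  rfl

lemma Graft.first_s {m n : ℕ} (i : Fin m) :
    (Graft.first m n).s i.succ = blockEquiv m n (Sum.inr i) := by
  ext
  rw [blockEquiv_inr]
  simp only [Graft.first, Fin.val_succ]
  omega

lemma Graft.first_τ_inl {m n : ℕ} (l : Fin (n + 1)) :
    (Graft.first m n).τ (blockEquiv m n (Sum.inl l)) = 0 := by
  rw [← Graft.first_e]
  exact Graft.τ_e _ _

lemma Graft.first_τ_inr {m n : ℕ} (i : Fin m) :
    (Graft.first m n).τ (blockEquiv m n (Sum.inr i)) = i.succ := by
  rw [← Graft.first_s]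
  exact (Graft.first m n).τ_s _ (Fin.succ_ne_zero i)

/-- The permutation of `{0, …, m}` that fixes `0` and acts as `β` on the other elements. -/
def succPerm {m : ℕ} (β : Equiv.Perm (Fin m)) : Equiv.Perm (Fin (m + 1)) :=
  Equiv.Perm.decomposeFin.symm (0, β)

lemma succPerm_zero {m : ℕ} (β : Equiv.Perm (Fin m)) : succPerm β 0 = 0 := by
  simp [succPerm]

lemma succPerm_succ {m : ℕ} (β : Equiv.Perm (Fin m)) (i : Fin m) :
    succPerm β i.succ = (β i).succ := by
  simp [succPerm]

lemma sign_succPerm {m : ℕ} (β : Equiv.Perm (Fin m)) :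
    Equiv.Perm.sign (succPerm β) = Equiv.Perm.sign β := by
  simp [succPerm]

/-- The multilinear map underlying a cochain. -/
def Cochain.toPMap {n : ℕ} (f : Cochain k H n M N) : PMap k H (Fin n) M N := ⟨f.1, f.2.1⟩

/-- `f (g (x₁, …, x_{n+1}), x_{n+2}, …, x_{m+n+1})`. -/
def circFirst {m n : ℕ} (f : Cochain k H (m + 1) M N) (g : Cochain k H (n + 1) M M) :
    PMap k H (Fin (m + n + 1)) M N :=
  graftComp (Graft.first m n) (Cochain.toPMap f) (Cochain.toPMap g)

lemma signedPerm_circFirst {m n : ℕ} (f : Cochain k H (m + 1) M N)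
    (g : Cochain k H (n + 1) M M) (ρ : Equiv.Perm (Fin (n + 1)) × Equiv.Perm (Fin m)) :
    signedPerm (blockPerm m n ρ) (circFirst f g) = circFirst f g := by
  obtain ⟨α, β⟩ := ρ
  ext x
  have hinv : blockPerm m n (α⁻¹, β⁻¹) = (blockPerm m n (α, β))⁻¹ := by
    rw [← map_inv]
    rfl
  have key : (circFirst f g).1 (x ∘ blockPerm m n (α, β)) =
      Equiv.Perm.sign (blockPerm m n (α⁻¹, β⁻¹)) •
        PTensor.perm (blockPerm m n (α⁻¹, β⁻¹)) ((circFirst f g).1 x) := by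
    have hg : g.1 ((x ∘ blockPerm m n (α, β)) ∘ (Graft.first m n).e) =
        Equiv.Perm.sign α⁻¹ • PTensor.perm α⁻¹ (g.1 (x ∘ (Graft.first m n).e)) := by
      rw [g.2.2 α⁻¹]
      congr 3
      ext l
      simp only [Function.comp_apply]
      rw [Graft.first_e, Graft.first_e, blockPerm_inl, ← Equiv.Perm.mul_apply, mul_inv_cancel, Equiv.Perm.one_apply]
    have hf : ∀ z, (Cochain.toPMap f).1 (Function.update ((x ∘ blockPerm m n (α, β)) ∘
          (Graft.first m n).s) (Graft.first m n).i₀ z) =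
        Equiv.Perm.sign β⁻¹ • PTensor.perm (succPerm β⁻¹)
          ((Cochain.toPMap f).1 (Function.update (x ∘ (Graft.first m n).s) (Graft.first m n).i₀ z)) := by
      intro z
      rw [← sign_succPerm]
      have := f.2.2 (succPerm β⁻¹) (Function.update ((x ∘ blockPerm m n (α, β)) ∘
          (Graft.first m n).s) (Graft.first m n).i₀ z)
      refine this.trans ?_
      congr 3
      ext i
      change Function.update (β := fun _ => M) _ (0 : Fin (m + 1)) z (succPerm β⁻¹ i) =
        Function.update (β := fun _ => M) _ (0 : Fin (m + 1)) z i
      refine Fin.cases ?_ (fun i => ?_) i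
      · simp [succPerm_zero]
      · rw [succPerm_succ, Function.update_of_ne (Fin.succ_ne_zero _),
          Function.update_of_ne (Fin.succ_ne_zero _)]
        simp only [Function.comp_apply]
        rw [Graft.first_s, Graft.first_s, blockPerm_inr, ← Equiv.Perm.mul_apply, mul_inv_cancel, Equiv.Perm.one_apply]
    have hα : ∀ l, blockPerm m n (α⁻¹, β⁻¹) ((Graft.first m n).e l) =
        (Graft.first m n).e (α⁻¹ l) := by
      intro l
      rw [Graft.first_e, Graft.first_e, blockPerm_inl]
    have hβ : ∀ j, (Graft.first m n).τ (blockPerm m n (α⁻¹, β⁻¹) j) =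
        succPerm β⁻¹ ((Graft.first m n).τ j) := by
      intro j
      obtain ⟨l | i, rfl⟩ := (blockEquiv m n).surjective j
      · rw [blockPerm_inl, Graft.first_τ_inl, Graft.first_τ_inl, succPerm_zero]
      · rw [blockPerm_inr, Graft.first_τ_inr, Graft.first_τ_inr, succPerm_succ]
    have h1 := PTensor.perm_insertAt (Graft.first m n) (Cochain.toPMap f) _ _ _ _ _ _ hα hβ hf
      (g.1 (x ∘ (Graft.first m n).e))
    change insertAt _ _ _ (g.1 _) = _ • PTensor.perm _ (insertAt _ _ _ (g.1 _))
    rw [hg, sign_blockPerm, mul_smul, ← h1, Units.smul_def, Units.smul_def, map_zsmul]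
  rw [signedPerm_apply, key, hinv, PTensor.perm_units_smul, PTensor.perm_perm, mul_inv_cancel,
    PTensor.perm_one, smul_smul, Equiv.Perm.sign_inv, Int.units_mul_self, one_smul]

/-- The circle product of `f ∈ C^{m+1}(M, N)` and `g ∈ C^{n+1}(M, M)`,
`∑_σ (-1)^σ (σ ⊗_H id) f (g (x_{σ 1}, …, x_{σ (n+1)}), x_{σ (n+2)}, …, x_{σ (m+n+1)})`
over the `(n + 1, m)`-shuffles `σ`. -/
def circ {m n : ℕ} (f : Cochain k H (m + 1) M N) (g : Cochain k H (n + 1) M M) :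
    Cochain k H (m + n + 1) M N :=
  ⟨(∑ σ ∈ shuffles (n + 1) (m + n + 1), signedPerm σ (circFirst f g)).1,
    Subtype.property _, by
    intro s x
    set F := ∑ σ ∈ shuffles (n + 1) (m + n + 1), signedPerm σ (circFirst f g) with hF
    have h1 : signedPerm s F = F := by
      have h2 := sum_shuffles_translate (fun σ => signedPerm σ (circFirst f g))
        (fun σ ρ => by rw [signedPerm_mul, signedPerm_circFirst]) s
      simp only [signedPerm_mul] at h2
      rw [hF, signedPerm_sum]
      exact h2
    rw [← signedPerm_apply, h1]⟩

end NR


/-! ## Graded Lie algebras, V-data, derived brackets and curved `L∞`-algebras -/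

section Abstract

variable {k L V : Type*} [Field k] [AddCommGroup L] [Module k L] [AddCommGroup V] [Module k V]

/-- `(⨁ᵢ 𝒥ⁱ, [·, ·])` is a `ℤ`-graded Lie algebra. The Jacobi identity is stated as the graded
Leibniz rule for `[x, ·]`. -/
structure IsGradedLieAlgebra (𝒥 : ℤ → Submodule k L) (br : L →ₗ[k] L →ₗ[k] L) : Prop where
  isInternal : DirectSum.IsInternal 𝒥
  mem : ∀ i j, ∀ x ∈ 𝒥 i, ∀ y ∈ 𝒥 j, br x y ∈ 𝒥 (i + j)
  skew : ∀ i j, ∀ x ∈ 𝒥 i, ∀ y ∈ 𝒥 j, br x y = -((i * j).negOnePow • br y x)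
  jacobi : ∀ i j l, ∀ x ∈ 𝒥 i, ∀ y ∈ 𝒥 j, ∀ z ∈ 𝒥 l,
    br x (br y z) = br (br x y) z + (i * j).negOnePow • br y (br x z)

/-- A graded Lie subalgebra: a subspace spanned by its homogeneous elements and closed under the
bracket. -/
structure IsGradedLieSubalgebra (𝒥 : ℤ → Submodule k L) (br : L →ₗ[k] L →ₗ[k] L)
    (S : Submodule k L) : Prop where
  graded : S = ⨆ i, S ⊓ 𝒥 i
  closed : ∀ x ∈ S, ∀ y ∈ S, br x y ∈ S

/-- `(𝒥, 𝒦, P, Δ)` is a curved V-datum. -/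
structure IsCurvedVData (𝒥 : ℤ → Submodule k L) (br : L →ₗ[k] L →ₗ[k] L)
    (𝒦 : Submodule k L) (P : L →ₗ[k] L) (Δ : L) : Prop where
  gradedLie : IsGradedLieAlgebra 𝒥 br
  subalgebra : IsGradedLieSubalgebra 𝒥 br 𝒦
  abelian : ∀ x ∈ 𝒦, ∀ y ∈ 𝒦, br x y = 0
  proj : ∀ x, P (P x) = P x
  range_eq : LinearMap.range P = 𝒦
  ker : IsGradedLieSubalgebra 𝒥 br (LinearMap.ker P)
  mem_one : Δ ∈ 𝒥 1
  bracket_self : br Δ Δ = 0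

/-- The nested bracket `[⋯[[Δ, x₁], x₂], ⋯, xₙ]`, equal to `Δ` for `n = 0`. -/
def nestedBracket (br : L →ₗ[k] L →ₗ[k] L) (Δ : L) :
    ∀ n : ℕ, MultilinearMap k (fun _ : Fin n => L) L
  | 0 => MultilinearMap.constOfIsEmpty k _ Δ
  | n + 1 => (br.compMultilinearMap (nestedBracket br Δ n)).uncurryRight

@[simp] lemma nestedBracket_zero (br : L →ₗ[k] L →ₗ[k] L) (Δ : L) (x : Fin 0 → L) :
    nestedBracket br Δ 0 x = Δ := rfl

@[simp] lemma nestedBracket_succ (br : L →ₗ[k] L →ₗ[k] L) (Δ : L) (n : ℕ)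
    (x : Fin (n + 1) → L) : nestedBracket br Δ (n + 1) x =
      br (nestedBracket br Δ n (Fin.init x)) (x (Fin.last n)) := rfl

/-- The derived brackets `lₙ (x₁, …, xₙ) = p [⋯[[Δ, ι x₁], ι x₂], ⋯, ι xₙ]` on `V`, where
`ι : V → L` is the inclusion of a subspace and `p : L → V` is a projection onto it. -/
def derivedBracket (br : L →ₗ[k] L →ₗ[k] L) (Δ : L) (ι : V →ₗ[k] L) (p : L →ₗ[k] V) (n : ℕ) :
    MultilinearMap k (fun _ : Fin n => V) V :=
  p.compMultilinearMap ((nestedBracket br Δ n).compLinearMap fun _ => ι)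

/-- The Koszul sign `ε(σ; x₁, …, xₙ)` of a permutation of elements of degrees `d 1, …, d n`,
`x_{σ 1} ⋯ x_{σ n} = ε(σ) x₁ ⋯ xₙ`: the product of `(-1)^{d (σ i) d (σ j)}` over all inversions
`i < j`, `σ i > σ j`. -/
def koszulSign {n : ℕ} (σ : Equiv.Perm (Fin n)) (d : Fin n → ℤ) : ℤˣ :=
  ∏ i : Fin n, ∏ j : Fin n,
    if i < j ∧ σ j < σ i then (d (σ i) * d (σ j)).negOnePow else 1

/-- `(⨁ᵢ 𝒱ᵢ, {lₙ}_{n ≥ 0})` is a curved `L∞`-algebra: the operations `lₙ` have degree `1`, are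
graded symmetric, and satisfy the higher Jacobi identities
`∑_{i = 0}^{n} ∑_{σ ∈ Sh(i, n - i)} ε(σ)
  l_{n - i + 1} (l_i (x_{σ 1}, …, x_{σ i}), x_{σ (i + 1)}, …, x_{σ n}) = 0`. -/
structure IsCurvedLInfty (𝒱 : ℤ → Submodule k V)
    (l : ∀ n : ℕ, MultilinearMap k (fun _ : Fin n => V) V) : Prop where
  isInternal : DirectSum.IsInternal 𝒱
  mem : ∀ (n : ℕ) (d : Fin n → ℤ) (x : Fin n → V), (∀ i, x i ∈ 𝒱 (d i)) →
    l n x ∈ 𝒱 (∑ i, d i + 1)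
  symm : ∀ (n : ℕ) (d : Fin n → ℤ) (x : Fin n → V), (∀ i, x i ∈ 𝒱 (d i)) →
    ∀ σ : Equiv.Perm (Fin n), l n (x ∘ σ) = koszulSign σ d • l n x
  jacobi : ∀ (n : ℕ) (d : Fin n → ℤ) (x : Fin n → V), (∀ i, x i ∈ 𝒱 (d i)) →
    ∑ i : Fin (n + 1), ∑ σ ∈ shuffles i n, koszulSign σ d •
      l (n - i + 1) (Fin.cons
        (l i fun a : Fin i => x (σ ⟨a, by omega⟩))
        (fun b : Fin (n - i) => x (σ ⟨i + b, by omega⟩))) = 0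

/-- `x` is a Maurer–Cartan element: it has degree `0` and satisfies `∑ₙ (1 / n!) lₙ (x, …, x) = 0`,
the sum having only finitely many nonzero terms. -/
def IsMaurerCartan (𝒱 : ℤ → Submodule k V)
    (l : ∀ n : ℕ, MultilinearMap k (fun _ : Fin n => V) V) (x : V) : Prop :=
  x ∈ 𝒱 0 ∧ {n : ℕ | l n (fun _ => x) ≠ 0}.Finite ∧
    ∑ᶠ n : ℕ, ((n.factorial : k)⁻¹) • l n (fun _ => x) = 0

end Abstract


section Bracket

variable {k H : Type*} [Field k] [Ring H] [HopfAlgebra k H] [Coalgebra.IsCocomm k H]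
variable {I J J₀ : Type*} [Fintype I] [DecidableEq I] [Fintype J] [DecidableEq J]
  [Fintype J₀] [DecidableEq J₀]
variable {M N : Type*} [AddCommGroup M] [Module k M] [Module H M]
  [AddCommGroup N] [Module k N] [Module H N]

lemma insertAt_add_left (G : Graft I J₀ J) (f f' : PMap k H I M N) (x : I → M)
    (w : PTensor k H J₀ M) : insertAt G (f + f') x w = insertAt G f x w + insertAt G f' x w := by
  induction w using PTensor.induction with
  | h0 => simp
  | hmk b z =>
    rw [insertAt_mk, insertAt_mk, insertAt_mk, Submodule.coe_add, add_apply,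
      PTensor.expand, map_add, smul_add]
    rfl
  | hadd x y hx hy => simp only [map_add, hx, hy]; abel

lemma insertAt_smul_left (G : Graft I J₀ J) (c : k) (f : PMap k H I M N) (x : I → M)
    (w : PTensor k H J₀ M) : insertAt G (c • f) x w = c • insertAt G f x w := by
  induction w using PTensor.induction with
  | h0 => simp
  | hmk b z =>
    rw [insertAt_mk, insertAt_mk, Submodule.coe_smul, smul_apply,
      PTensor.expand, map_smul, smul_comm]
    rfl
  | hadd x y hx hy => simp only [map_add, hx, hy, smul_add]

lemma toPMap_circ {m n : ℕ} (f : Cochain k H (m + 1) M N) (g : Cochain k H (n + 1) M M) :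
    Cochain.toPMap (circ f g) =
      ∑ σ ∈ shuffles (n + 1) (m + n + 1), signedPermLin σ (circFirst f g) := rfl

lemma Cochain.toPMap_injective {n : ℕ} {f g : Cochain k H n M N}
    (h : Cochain.toPMap f = Cochain.toPMap g) : f = g :=
  Subtype.ext (congrArg (fun F : PMap k H (Fin n) M N => F.1) h)

lemma Cochain.toPMap_add {n : ℕ} (f g : Cochain k H n M N) :
    Cochain.toPMap (f + g) = Cochain.toPMap f + Cochain.toPMap g := rfl

lemma Cochain.toPMap_smul {n : ℕ} (c : k) (f : Cochain k H n M N) :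
    Cochain.toPMap (c • f) = c • Cochain.toPMap f := rfl

lemma circFirst_apply {m n : ℕ} (f : Cochain k H (m + 1) M N) (g : Cochain k H (n + 1) M M)
    (x : Fin (m + n + 1) → M) : (circFirst f g).1 x = insertAt (Graft.first m n)
      (Cochain.toPMap f) (x ∘ (Graft.first m n).s) (g.1 (x ∘ (Graft.first m n).e)) := rfl

lemma circ_add_left {m n : ℕ} (f f' : Cochain k H (m + 1) M N) (g : Cochain k H (n + 1) M M) :
    circ (f + f') g = circ f g + circ f' g := by
  have h : circFirst (f + f') g = circFirst f g + circFirst f' g := by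
    ext x
    rw [Submodule.coe_add, add_apply, circFirst_apply, circFirst_apply, circFirst_apply,
      Cochain.toPMap_add, insertAt_add_left]
  apply Cochain.toPMap_injective
  rw [Cochain.toPMap_add, toPMap_circ, toPMap_circ, toPMap_circ, h, ← Finset.sum_add_distrib]
  exact Finset.sum_congr rfl fun σ _ => map_add _ _ _

lemma circ_smul_left {m n : ℕ} (c : k) (f : Cochain k H (m + 1) M N)
    (g : Cochain k H (n + 1) M M) : circ (c • f) g = c • circ f g := by
  have h : circFirst (c • f) g = c • circFirst f g := by
    ext x
    rw [Submodule.coe_smul, smul_apply, circFirst_apply, circFirst_apply, Cochain.toPMap_smul,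
      insertAt_smul_left]
  apply Cochain.toPMap_injective
  rw [Cochain.toPMap_smul, toPMap_circ, toPMap_circ, h, Finset.smul_sum]
  exact Finset.sum_congr rfl fun σ _ => map_smul _ _ _

lemma circ_add_right {m n : ℕ} (f : Cochain k H (m + 1) M N) (g g' : Cochain k H (n + 1) M M) :
    circ f (g + g') = circ f g + circ f g' := by
  have h : circFirst f (g + g') = circFirst f g + circFirst f g' := by
    ext x
    rw [Submodule.coe_add, add_apply, circFirst_apply, circFirst_apply, circFirst_apply, ← map_add]
    rfl
  apply Cochain.toPMap_injective
  rw [Cochain.toPMap_add, toPMap_circ, toPMap_circ, toPMap_circ, h, ← Finset.sum_add_distrib]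
  exact Finset.sum_congr rfl fun σ _ => map_add _ _ _

lemma circ_smul_right {m n : ℕ} (c : k) (f : Cochain k H (m + 1) M N)
    (g : Cochain k H (n + 1) M M) : circ f (c • g) = c • circ f g := by
  have h : circFirst f (c • g) = c • circFirst f g := by
    ext x
    rw [Submodule.coe_smul, smul_apply, circFirst_apply, circFirst_apply, ← map_smul]
    rfl
  apply Cochain.toPMap_injective
  rw [Cochain.toPMap_smul, toPMap_circ, toPMap_circ, h, Finset.smul_sum]
  exact Finset.sum_congr rfl fun σ _ => map_smul _ _ _

/-- The circle product as a bilinear map. -/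
def circBilin (k H M : Type*) [Field k] [Ring H] [HopfAlgebra k H] [Coalgebra.IsCocomm k H]
    [AddCommGroup M] [Module k M] [Module H M] (m n : ℕ) :
    Cochain k H (m + 1) M M →ₗ[k] Cochain k H (n + 1) M M →ₗ[k] Cochain k H (m + n + 1) M M :=
  LinearMap.mk₂ k circ circ_add_left circ_smul_left circ_add_right circ_smul_right

/-- `⨁_{n ≥ 0} C^{n+1}(M, N)`. -/
def Cochains (k H M N : Type*) [Field k] [Ring H] [HopfAlgebra k H] [Coalgebra.IsCocomm k H]
    [AddCommGroup M] [Module k M] [Module H M] [AddCommGroup N] [Module k N] [Module H N] :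
    Type _ :=
  ⨁ n : ℕ, Cochain k H (n + 1) M N

instance Cochains.instAddCommGroup : AddCommGroup (Cochains k H M N) :=
  inferInstanceAs (AddCommGroup (⨁ n : ℕ, Cochain k H (n + 1) M N))

instance Cochains.instModule : Module k (Cochains k H M N) :=
  inferInstanceAs (Module k (⨁ n : ℕ, Cochain k H (n + 1) M N))

/-- The inclusion of `C^{n+1}(M, N)` into `⨁_{n ≥ 0} C^{n+1}(M, N)`. -/
def Cochains.of (n : ℕ) : Cochain k H (n + 1) M N →ₗ[k] Cochains k H M N :=
  DirectSum.lof k ℕ (fun n => Cochain k H (n + 1) M N) n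

/-- Linear maps out of `⨁_{n ≥ 0} C^{n+1}(M, N)`. -/
def Cochains.lift {V : Type*} [AddCommGroup V] [Module k V]
    (F : ∀ n, Cochain k H (n + 1) M N →ₗ[k] V) : Cochains k H M N →ₗ[k] V :=
  DirectSum.toModule k ℕ V F

lemma Cochains.lift_of {V : Type*} [AddCommGroup V] [Module k V]
    (F : ∀ n, Cochain k H (n + 1) M N →ₗ[k] V) (n : ℕ) (f : Cochain k H (n + 1) M N) :
    Cochains.lift F (Cochains.of n f) = F n f := by
  have h : (DirectSum.toModule k ℕ V F).comp
      (DirectSum.lof k ℕ (fun n => Cochain k H (n + 1) M N) n) = F n :=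
    LinearMap.ext fun f => DirectSum.toModule_lof (R := k) (ι := ℕ)
      (M := fun n => Cochain k H (n + 1) M N) (φ := F) n f
  exact congr($h f)

/-- The grading of `⨁_{n ≥ 0} C^{n+1}(M, N)` with `C^{n+1}(M, N)` in degree `n`. -/
def Cochains.grading (k H M N : Type*) [Field k] [Ring H] [HopfAlgebra k H]
    [Coalgebra.IsCocomm k H] [AddCommGroup M] [Module k M] [Module H M]
    [AddCommGroup N] [Module k N] [Module H N] : ℤ → Submodule k (Cochains k H M N)
  | Int.ofNat n => LinearMap.range (Cochains.of n)
  | Int.negSucc _ => ⊥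

/-- The Nijenhuis–Richardson bracket on `⨁_{n ≥ 0} C^{n+1}(M, M)`, given on
`f ∈ C^{m+1}(M, M)` and `g ∈ C^{n+1}(M, M)` by `[f, g] = f ⊚ g - (-1)^{m n} g ⊚ f`. -/
def nrBracket (k H M : Type*) [Field k] [Ring H] [HopfAlgebra k H] [Coalgebra.IsCocomm k H]
    [AddCommGroup M] [Module k M] [Module H M] :
    Cochains k H M M →ₗ[k] Cochains k H M M →ₗ[k] Cochains k H M M :=
  Cochains.lift fun m => LinearMap.flip <| Cochains.lift fun n => LinearMap.flip <|
      (circBilin k H M m n).compr₂ (Cochains.of (m + n)) -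
        (-1 : k) ^ (m * n) • ((circBilin k H M n m).flip.compr₂ (Cochains.of (n + m)))

lemma nrBracket_of {m n : ℕ} (f : Cochain k H (m + 1) M M) (g : Cochain k H (n + 1) M M) :
    nrBracket k H M (Cochains.of m f) (Cochains.of n g) =
      Cochains.of (m + n) (circ f g) - (-1 : k) ^ (m * n) • Cochains.of (n + m) (circ g f) := by
  rw [nrBracket, Cochains.lift_of, LinearMap.flip_apply, Cochains.lift_of]
  rfl

end Bracket

/-! ## Quasi-twilled Lie pseudoalgebras -/

section QuasiTwilled

variable {k H : Type*} [Field k] [Ring H] [HopfAlgebra k H] [Coalgebra.IsCocomm k H]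
variable {A B L N : Type*} [AddCommGroup A] [Module k A] [Module H A]
  [AddCommGroup B] [Module k B] [Module H B] [AddCommGroup L] [Module k L] [Module H L]
  [AddCommGroup N] [Module k N] [Module H N]

/-- The shape of the composition `f (g (x₀, x₁), x₂)`. -/
def Graft.left : Graft (Fin 2) (Fin 2) (Fin 3) where
  i₀ := 0
  e := ![0, 1]
  s := ![0, 2]
  τ := ![0, 0, 1]
  e_inj := by decide
  τ_eq_iff := by decide
  τ_s := by decide
  s_τ := by decide

/-- The shape of the composition `f (x₀, g (x₁, x₂))`. -/
def Graft.right : Graft (Fin 2) (Fin 2) (Fin 3) where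
  i₀ := 1
  e := ![1, 2]
  s := ![0, 0]
  τ := ![0, 1, 1]
  e_inj := by decide
  τ_eq_iff := by decide
  τ_s := by decide
  s_τ := by decide

/-- `Ω`, an `H^{⊗ 2}`-linear skew-symmetric map `L ⊗ L → H^{⊗ 2} ⊗_H L`, is a Lie pseudobracket:
it satisfies the Jacobi identity
`[x * [y * z]] = [[x * y] * z] + ((12) ⊗_H id) [y * [x * z]]` in `H^{⊗ 3} ⊗_H L`. -/
def IsLiePseudobracket (Ω : Cochain k H 2 L L) : Prop :=
  ∀ x y z : L,
    (graftComp Graft.right (Cochain.toPMap Ω) (Cochain.toPMap Ω)).1 ![x, y, z] =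
      (graftComp Graft.left (Cochain.toPMap Ω) (Cochain.toPMap Ω)).1 ![x, y, z] +
      PTensor.perm (Equiv.swap 0 1)
        ((graftComp Graft.right (Cochain.toPMap Ω) (Cochain.toPMap Ω)).1 ![y, x, z])

variable [IsScalarTower k H A] [IsScalarTower k H B] [IsScalarTower k H N]

/-- `(A × B, A, B)` is a quasi-twilled Lie pseudoalgebra with pseudobracket `Ω`: `Ω` is a Lie
pseudobracket on the direct sum and `B` is a Lie pseudosubalgebra. -/
structure IsQuasiTwilled (Ω : Cochain k H 2 (A × B) (A × B)) : Prop where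
  lie : IsLiePseudobracket Ω
  sub : ∀ u v : B, Ω.1 ![((0, u) : A × B), (0, v)] ∈
    LinearMap.range (PTensor.map (k := k) (J := Fin 2) (LinearMap.inr H A B))

/-- The `H^{⊗ 2}`-linear maps `A ⊗ B → H^{⊗ 2} ⊗_H N`. -/
def Mixed (k H A B N : Type*) [Field k] [Ring H] [HopfAlgebra k H] [Coalgebra.IsCocomm k H]
    [AddCommGroup A] [Module k A] [Module H A] [AddCommGroup B] [Module k B] [Module H B]
    [AddCommGroup N] [Module k N] [Module H N] :
    Submodule k (A →ₗ[k] B →ₗ[k] PTensor k H (Fin 2) N) where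
  carrier := {α | ∀ (a b : H) (x : A) (u : B),
    α (a • x) (b • u) = (PiTensorProduct.tprod k ![a, b] : HPow k H (Fin 2)) • α x u}
  add_mem' := by
    intro α β hα hβ a b x u
    simp only [LinearMap.add_apply, hα a b x u, hβ a b x u, smul_add]
  zero_mem' := by
    intro a b x u
    simp
  smul_mem' := by
    intro c α hα a b x u
    simp only [LinearMap.smul_apply, hα a b x u, smul_comm c]

lemma update_pair_zero {X : Type*} (a b c : X) :
    Function.update ![a, b] 0 c = ![c, b] := by
  ext i
  fin_cases i <;> simp

lemma update_pair_one {X : Type*} (a b c : X) :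
    Function.update ![a, b] 1 c = ![a, c] := by
  ext i
  fin_cases i <;> simp

/-- The component `A ⊗ B → H^{⊗ 2} ⊗_H N` of a map `(A × B)^{⊗ 2} → H^{⊗ 2} ⊗_H N`. -/
def Cochain.mixed (f : Cochain k H 2 (A × B) N) : Mixed k H A B N :=
  ⟨LinearMap.mk₂ k (fun x u => f.1 ![((x, 0) : A × B), (0, u)])
    (fun x x' u => by
      have := f.1.map_update_add ![((x, 0) : A × B), (0, u)] 0 (x, 0) (x', 0)
      rwa [update_pair_zero, update_pair_zero, update_pair_zero, Prod.mk_add_mk, add_zero] at this)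
    (fun c x u => by
      have := f.1.map_update_smul ![((x, 0) : A × B), (0, u)] 0 c (x, 0)
      rwa [update_pair_zero, update_pair_zero, Prod.smul_mk, smul_zero] at this)
    (fun x u u' => by
      have := f.1.map_update_add ![((x, 0) : A × B), (0, u)] 1 (0, u) (0, u')
      rwa [update_pair_one, update_pair_one, update_pair_one, Prod.mk_add_mk, add_zero] at this)
    (fun c x u => by
      have := f.1.map_update_smul ![((x, 0) : A × B), (0, u)] 1 c (0, u)
      rwa [update_pair_one, update_pair_one, Prod.smul_mk, smul_zero] at this), by
    intro a b x u
    have h := f.2.1 ![a, b] ![((x, 0) : A × B), (0, u)]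
    have e : (fun j => (![a, b] : Fin 2 → H) j • (![((x, 0) : A × B), (0, u)] : Fin 2 → A × B) j) =
        ![((a • x, 0) : A × B), (0, b • u)] := by
      ext j <;> fin_cases j <;> simp
    rw [e] at h
    exact h⟩

end QuasiTwilled


section Components

variable {k H : Type*} [Field k] [Ring H] [HopfAlgebra k H] [Coalgebra.IsCocomm k H]
variable {A B N : Type*} [AddCommGroup A] [Module k A] [Module H A]
  [AddCommGroup B] [Module k B] [Module H B] [AddCommGroup N] [Module k N] [Module H N]

/-- The function `((x₁, u₁), (x₂, u₂)) ↦ α (x₁, u₂) - ((12) ⊗_H id) α (x₂, u₁)`. -/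
def Mixed.liftFun (α : Mixed k H A B N) (x : Fin 2 → A × B) : PTensor k H (Fin 2) N :=
  α.1 (x 0).1 (x 1).2 - PTensor.perm (Equiv.swap 0 1) (α.1 (x 1).1 (x 0).2)

lemma PTensor.perm_neg {J : Type*} [Fintype J] [DecidableEq J] (σ : Equiv.Perm J)
    (w : PTensor k H J N) : PTensor.perm σ (-w) = -PTensor.perm σ w :=
  map_neg (PTensor.baseMap (M := N) (place (H := H) k σ σ.injective) (place_coprod σ)) w

lemma PTensor.perm_sub {J : Type*} [Fintype J] [DecidableEq J] (σ : Equiv.Perm J)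
    (w w' : PTensor k H J N) :
    PTensor.perm σ (w - w') = PTensor.perm σ w - PTensor.perm σ w' := by
  rw [sub_eq_add_neg, PTensor.perm_add, PTensor.perm_neg, ← sub_eq_add_neg]

/-- The extension of `α : A ⊗ B → H^{⊗ 2} ⊗_H N` to a skew-symmetric map on `A × B`,
`((x₁, u₁), (x₂, u₂)) ↦ α (x₁, u₂) - ((12) ⊗_H id) α (x₂, u₁)`. -/
def Mixed.lift (α : Mixed k H A B N) : Cochain k H 2 (A × B) N :=
  ⟨MultilinearMap.mk' (Mixed.liftFun α)
    (by
      intro x i u v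
      fin_cases i
      · simp [Mixed.liftFun, PTensor.perm_add]
        abel
      · simp [Mixed.liftFun, PTensor.perm_add]
        abel)
    (by
      intro x i c u
      fin_cases i
      · simp [Mixed.liftFun, PTensor.perm_smul, smul_sub]
      · simp [Mixed.liftFun, PTensor.perm_smul, smul_sub]), by
    refine ⟨fun h x => ?_, fun σ x => ?_⟩
    · have hα : ∀ (a b : H) (x : A) (u : B), α.1 (a • x) (b • u) =
        (PiTensorProduct.tprod k ![a, b] : HPow k H (Fin 2)) • α.1 x u := α.2
      change Mixed.liftFun α (fun j => h j • x j) =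
        (PiTensorProduct.tprod k h : HPow k H (Fin 2)) • Mixed.liftFun α x
      have e1 : (![h 0, h 1] : Fin 2 → H) = h := by
        ext i
        fin_cases i <;> rfl
      have e2 : (![h 1, h 0] : Fin 2 → H) ∘ (Equiv.swap (0 : Fin 2) 1).symm = h := by
        ext i
        fin_cases i <;> rfl
      simp only [Mixed.liftFun, Prod.smul_fst, Prod.smul_snd]
      rw [hα, hα, PTensor.perm_hsmul, place_tprod, e1, e2, smul_sub]
    · change Mixed.liftFun α x = Equiv.Perm.sign σ • PTensor.perm σ (Mixed.liftFun α _)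
      have hσ : σ = 1 ∨ σ = Equiv.swap 0 1 := by
        revert σ
        decide
      rcases hσ with rfl | rfl
      · rw [PTensor.perm_one, Equiv.Perm.sign_one, one_smul]
        rfl
      · rw [Equiv.Perm.sign_swap (by decide), Units.smul_def, Units.val_neg, Units.val_one,
          neg_one_smul]
        simp only [Mixed.liftFun, Function.comp_apply, Equiv.swap_apply_left,
          Equiv.swap_apply_right]
        rw [PTensor.perm_sub, PTensor.perm_perm, Equiv.swap_mul_self, PTensor.perm_one, neg_sub]⟩

lemma Mixed.lift_apply (α : Mixed k H A B N) (x₁ x₂ : A) (u₁ u₂ : B) :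
    (Mixed.lift α).1 ![(x₁, u₁), (x₂, u₂)] =
      α.1 x₁ u₂ - PTensor.perm (Equiv.swap 0 1) (α.1 x₂ u₁) := rfl

variable [IsScalarTower k H A] [IsScalarTower k H B]

/-! The components `π`, `η`, `ρ`, `μ`, `θ` of a skew-symmetric map `Ω` on `A × B`. -/

/-- `π : A ⊗ A → H^{⊗ 2} ⊗_H A`. -/
def compπ (Ω : Cochain k H 2 (A × B) (A × B)) : Cochain k H 2 A A :=
  Cochain.map (LinearMap.inl H A B) (LinearMap.fst H A B) Ω

/-- `θ : A ⊗ A → H^{⊗ 2} ⊗_H B`. -/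
def compθ (Ω : Cochain k H 2 (A × B) (A × B)) : Cochain k H 2 A B :=
  Cochain.map (LinearMap.inl H A B) (LinearMap.snd H A B) Ω

/-- `μ : B ⊗ B → H^{⊗ 2} ⊗_H B`. -/
def compμ (Ω : Cochain k H 2 (A × B) (A × B)) : Cochain k H 2 B B :=
  Cochain.map (LinearMap.inr H A B) (LinearMap.snd H A B) Ω

/-- `η : A ⊗ B → H^{⊗ 2} ⊗_H A`. -/
def compη (Ω : Cochain k H 2 (A × B) (A × B)) : Mixed k H A B A :=
  Cochain.mixed (Cochain.map LinearMap.id (LinearMap.fst H A B) Ω)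

/-- `ρ : A ⊗ B → H^{⊗ 2} ⊗_H B`. -/
def compρ (Ω : Cochain k H 2 (A × B) (A × B)) : Mixed k H A B B :=
  Cochain.mixed (Cochain.map LinearMap.id (LinearMap.snd H A B) Ω)

/-! The components as elements of degree `1` of `⨁_{n ≥ 0} C^{n+1}(A × B, A × B)`. -/

/-- `π` as a map on `A × B`: `((x₁, u₁), (x₂, u₂)) ↦ (π (x₁, x₂), 0)`. -/
def hatπ (Ω : Cochain k H 2 (A × B) (A × B)) : Cochains k H (A × B) (A × B) :=
  Cochains.of 1 (Cochain.map (LinearMap.fst H A B) (LinearMap.inl H A B) (compπ Ω))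

/-- `θ` as a map on `A × B`: `((x₁, u₁), (x₂, u₂)) ↦ (0, θ (x₁, x₂))`. -/
def hatθ (Ω : Cochain k H 2 (A × B) (A × B)) : Cochains k H (A × B) (A × B) :=
  Cochains.of 1 (Cochain.map (LinearMap.fst H A B) (LinearMap.inr H A B) (compθ Ω))

/-- `μ` as a map on `A × B`: `((x₁, u₁), (x₂, u₂)) ↦ (0, μ (u₁, u₂))`. -/
def hatμ (Ω : Cochain k H 2 (A × B) (A × B)) : Cochains k H (A × B) (A × B) :=
  Cochains.of 1 (Cochain.map (LinearMap.snd H A B) (LinearMap.inr H A B) (compμ Ω))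

/-- `η` as a map on `A × B`:
`((x₁, u₁), (x₂, u₂)) ↦ (η (x₁, u₂) - ((12) ⊗_H id) η (x₂, u₁), 0)`. -/
def hatη (Ω : Cochain k H 2 (A × B) (A × B)) : Cochains k H (A × B) (A × B) :=
  Cochains.of 1 (Cochain.map LinearMap.id (LinearMap.inl H A B) (Mixed.lift (compη Ω)))

/-- `ρ` as a map on `A × B`:
`((x₁, u₁), (x₂, u₂)) ↦ (0, ρ (x₁, u₂) - ((12) ⊗_H id) ρ (x₂, u₁))`. -/
def hatρ (Ω : Cochain k H 2 (A × B) (A × B)) : Cochains k H (A × B) (A × B) :=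
  Cochains.of 1 (Cochain.map LinearMap.id (LinearMap.inr H A B) (Mixed.lift (compρ Ω)))

/-- `Δ = π + ρ + μ + η + θ`. -/
def deltaElt (Ω : Cochain k H 2 (A × B) (A × B)) : Cochains k H (A × B) (A × B) :=
  hatπ Ω + hatρ Ω + hatμ Ω + hatη Ω + hatθ Ω

variable (k H A B)

/-- The inclusion of `⨁_{n ≥ 0} C^{n+1}(B, A)` into `⨁_{n ≥ 0} C^{n+1}(A × B, A × B)`: a cochain
`f` becomes `((x₁, u₁), …, (xₙ, uₙ)) ↦ (f (u₁, …, uₙ), 0)`. -/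
def inclK : Cochains k H B A →ₗ[k] Cochains k H (A × B) (A × B) :=
  Cochains.lift fun n =>
    (Cochains.of n).comp (Cochain.map (LinearMap.snd H A B) (LinearMap.inl H A B))

/-- The component `B ⊗ ⋯ ⊗ B → H^{⊗ n} ⊗_H A` of cochains on `A × B`. -/
def projK : Cochains k H (A × B) (A × B) →ₗ[k] Cochains k H B A :=
  Cochains.lift fun n =>
    (Cochains.of n).comp (Cochain.map (LinearMap.inr H A B) (LinearMap.fst H A B))

variable {k H A B}

/-- The operations `lₙ` on `⨁_{n ≥ 0} C^{n+1}(B, A)`: the derived brackets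
`lₙ (f₁, …, fₙ) = P [⋯[[Δ, f₁], f₂], ⋯, fₙ]`. -/
def lOp (Ω : Cochain k H 2 (A × B) (A × B)) (n : ℕ) :
    MultilinearMap k (fun _ : Fin n => Cochains k H B A) (Cochains k H B A) :=
  derivedBracket (nrBracket k H (A × B)) (deltaElt Ω) (inclK k H A B) (projK k H A B) n

/-- An `H`-linear map `T : B → A` as an element of `C^1(B, A) ⊆ ⨁_{n ≥ 0} C^{n+1}(B, A)`, namely
`u ↦ 1 ⊗_H T u`. -/
def ofLinear (T : B →ₗ[H] A) : Cochains k H B A :=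
  Cochains.of 0 ⟨MultilinearMap.mk' (fun x => PTensor.mk k 1 (T (x 0)))
    (by
      intro x i u v
      fin_cases i
      simp [← PTensor.mkLin_apply])
    (by
      intro x i c u
      fin_cases i
      simp [← PTensor.mkLin_apply]), by
    refine ⟨fun h x => ?_, fun σ x => ?_⟩
    · change PTensor.mk k 1 (T (h 0 • x 0)) =
        (PiTensorProduct.tprod k h : HPow k H (Fin 1)) • PTensor.mk k 1 (T (x 0))
      have e : coprod k (Fin 1) (h 0) = PiTensorProduct.tprod k h := by
        have : (Finset.univ : Finset (Fin 1)) = {0} := rfl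
        rw [coprod, coprodOn_apply, this, coprodLin_singleton]
        change PiTensorProduct.singleAlgHom (R := k) (A := fun _ : Fin 1 => H) 0 (h 0) = _
        rw [PiTensorProduct.singleAlgHom_apply]
        congr 1
        ext i
        fin_cases i
        simp
      rw [map_smul, ← PTensor.mk_balance, PTensor.smul_mk, e, one_mul, mul_one]
    · have : σ = 1 := Subsingleton.elim (α := Equiv.Perm (Fin 1)) σ 1
      subst this
      rw [PTensor.perm_one, Equiv.Perm.sign_one, one_smul]
      rfl⟩

/-- `T : B → A` is a deformation map of type II:
`π (T u, T v) + η (T u, v) - (12) η (T v, u)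
  = T (ρ (T u, v) - (12) ρ (T v, u) + μ (u, v) + θ (T u, T v))`, where the `H`-linear map `T` is
applied to elements of `H^{⊗ 2} ⊗_H B` as `id ⊗_H T`. -/
def IsTypeII (Ω : Cochain k H 2 (A × B) (A × B)) (T : B →ₗ[H] A) : Prop :=
  ∀ u v : B,
    (compπ Ω).1 ![T u, T v] + (compη Ω).1 (T u) v -
        PTensor.perm (Equiv.swap 0 1) ((compη Ω).1 (T v) u) =
      PTensor.map T ((compρ Ω).1 (T u) v - PTensor.perm (Equiv.swap 0 1) ((compρ Ω).1 (T v) u) +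
        (compμ Ω).1 ![u, v] + (compθ Ω).1 ![T u, T v])

end Components

end Pseudo

end

open Pseudo

open scoped TensorProduct DirectSum

noncomputable section

namespace Pseudo

set_option linter.unusedSectionVars false
set_option linter.unusedSimpArgs false

/-! ### Iterated coproducts and permutations of tensor factors as one operation -/

section Expand

variable {k H : Type*} [Field k] [Ring H] [HopfAlgebra k H] [Coalgebra.IsCocomm k H]
variable {I J K J₀ J₁ : Type*} [Fintype I] [DecidableEq I] [Fintype J] [DecidableEq J]
  [Fintype K] [DecidableEq K] [Fintype J₀] [DecidableEq J₀] [Fintype J₁] [DecidableEq J₁]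
variable {M N N' : Type*} [AddCommGroup M] [Module k M] [Module H M]
  [AddCommGroup N] [Module k N] [Module H N] [AddCommGroup N'] [Module k N'] [Module H N']

/-! Pseudo-multilinear maps behave like an operad: inserting one map into an argument of another is
compatible with renaming arguments, nested insertions are associative (`graftComp_assoc`), and
insertions at different places commute (`graftComp_comm`). Cocommutativity lets the coproduct be
spread over an unordered set of factors. Up to the factor `(n+1)! m!`, the shuffle sum defining
`circ` is the full skew-symmetrization of the insertion at the first place (`factorial_smul_circ`).
In `(f ⊚ g) ⊚ h` the map `h` lands either inside `g` or in an argument of `f` beside `g`. The first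
kind makes up `f ⊚ (g ⊚ h)`; the second is graded symmetric in `g` and `h` (`of_parallelSum`). Hence
`⊚` is right pre-Lie (`associator_symm`), and its graded commutator satisfies the Jacobi identity
(`nrBracket_jacobi`).

The rest of the V-datum follows from naturality of `⊚` in module maps (`circ_map`). The subspace `𝔎`
is abelian because its cochains take values in `𝔤` and read only `𝔥`-components. The kernel of `P`
is closed because its members send tuples from `𝔥` to `𝔥`. The equation `[Ω, Ω] = 0` is the Jacobi
identity written over the three `(2,1)`-shuffles.

For every curved V-datum (`IsCurvedVData.isCurvedLInfty`), the iterated Leibniz rule turns `[Δ, Δ] =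
0` into a signed sum over subsets `S` of `[Δ_S, Δ_{Sᶜ}]`, where `Δ_S` is the nested bracket of `Δ`
with the elements indexed by `S`. Since `ker P` is a subalgebra and `𝔎` is abelian, `P[a, b] = P[Pa,
b] + P[a, Pb]`. The two resulting halves agree under `S ↦ Sᶜ`, and one half is the higher Jacobi
identity, subsets corresponding to shuffles.

The explicit operations come from a weight count. Under `φ (a, u) = (2a, u)` a component of a
cochain has weight 1 or 0, according to whether its value lies in `𝔤` or `𝔥`, minus the number of
its arguments from `𝔤`. In characteristic 0 the powers of 2 separate the weights; weights add under
the bracket; `𝔎` is exactly the part of weight 1, and `P` kills every other weight. As `π`, `ρ` have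
weight `-1`, `μ`, `η` weight `0` and `θ` weight `-2`, and each bracket with an element of `𝔎` adds
1, each component contributes to one operation only.

Finally `T` gives an endomorphism `τ` of `𝔤 × 𝔥` with `τ² = 0`. Iterating `F ↦ [F, T]` produces
factors that cancel the `1/n!`, and the Maurer–Cartan sum becomes the `𝔤`-part of `e^{-τ} Ω (e^τ ·,
e^τ ·)` on `𝔥`, which is the type II equation. -/

lemma expand_expand (τ : J → I) (τ' : K → J) (b : HPow k H I) :
    expand k τ' (expand k τ b) = expand k (τ ∘ τ') b := by
  have : (expand k τ').comp (expand (H := H) k τ) = expand k (τ ∘ τ') := by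
    refine hpow_ext fun i a => ?_
    rw [AlgHom.comp_apply, expand_factor, expand_factor, expand_coprodOn]
    simp
  exact congr($this b)

lemma place_place (e : J₀ → J) (he : Function.Injective e) (e' : J → K)
    (he' : Function.Injective e') (b : HPow k H J₀) :
    place k e' he' (place k e he b) = place k (e' ∘ e) (he'.comp he) b := by
  have : (place k e' he').comp (place (H := H) k e he) = place k (e' ∘ e) (he'.comp he) :=
    hpow_ext fun i a => by simp [place_factor]
  exact congr($this b)

/-- Expanding after placing, when the fibres of `τ` over the range of `e` are the fibres of `τ₀`. -/
lemma expand_place {e : J₀ → J} (he : Function.Injective e) {e' : J₁ → K}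
    (he' : Function.Injective e') {τ : K → J} {τ₀ : J₁ → J₀} (h : ∀ l, τ (e' l) = e (τ₀ l))
    (hr : ∀ x j, τ x = e j → ∃ l, e' l = x) (b : HPow k H J₀) :
    expand k τ (place k e he b) = place k e' he' (expand k τ₀ b) := by
  have : (expand k τ).comp (place (H := H) k e he) = (place k e' he').comp (expand k τ₀) := by
    refine hpow_ext fun j a => ?_
    rw [AlgHom.comp_apply, AlgHom.comp_apply, place_factor, expand_factor, expand_factor,
      place_coprodOn]
    refine congrArg (fun S => coprodOn k S a) ?_
    ext x
    simp only [Finset.mem_image, Finset.mem_filter, Finset.mem_univ, true_and]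
    constructor
    · intro hx
      obtain ⟨l, rfl⟩ := hr x j hx
      exact ⟨l, he ((h l).symm.trans hx), rfl⟩
    · rintro ⟨l, rfl, rfl⟩
      exact h l
  exact congr($this b)

lemma expand_id (b : HPow k H J) : expand k (id : J → J) b = b := by
  have : expand k (id : J → J) = AlgHom.id k (HPow k H J) := by
    refine hpow_ext fun j a => ?_
    have h : (Finset.univ.filter fun i : J => id i = j) = {j} := by
      ext
      simp
    rw [expand_factor, h, coprodOn_apply, coprodLin_singleton]
    rfl
  exact congr($this b)

/-- The fibres of a bijection are singletons, so no coproduct is taken. Permutations of the tensor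
factors thereby become instances of `expand`, and their composites are governed by `expand_expand`.
-/
lemma expand_symm_eq_place (ρ : J ≃ K) (b : HPow k H J) :
    expand k ρ.symm b = place k ρ ρ.injective b := by
  have h := expand_place (k := k) (H := H) (e := (id : J → J)) Function.injective_id
    (e' := ρ) ρ.injective (τ := ρ.symm) (τ₀ := id) (fun l => by simp)
    (fun x j hx => ⟨j, by rw [← show ρ.symm x = j from hx, Equiv.apply_symm_apply]⟩) b
  rw [expand_id] at h
  rw [← h]
  congr 1
  have : place (H := H) k (id : J → J) Function.injective_id = AlgHom.id k _ :=
    hpow_ext fun j a => by rw [place_factor]; rfl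
  exact congr($this b).symm

namespace PTensor

lemma expand_mk (τ : J → I) (b : HPow k H I) (z : M) :
    PTensor.expand τ (PTensor.mk k b z) = PTensor.mk k (Pseudo.expand k τ b) z :=
  PTensor.baseMap_mk _ _ b z

lemma expand_hsmul (τ : J → I) (c : HPow k H I) (w : PTensor k H I M) :
    PTensor.expand τ (c • w) = Pseudo.expand k τ c • PTensor.expand τ w :=
  PTensor.baseMap_smul _ _ c w

lemma expand_add (τ : J → I) (w w' : PTensor k H I M) :
    PTensor.expand τ (w + w') = PTensor.expand τ w + PTensor.expand τ w' :=
  LinearMap.map_add _ w w'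

lemma expand_sum {ι : Type*} (S : Finset ι) (τ : J → I) (w : ι → PTensor k H I M) :
    PTensor.expand τ (∑ i ∈ S, w i) = ∑ i ∈ S, PTensor.expand τ (w i) :=
  map_sum (PTensor.baseMap (M := M) (Pseudo.expand (H := H) k τ) (expand_coprod τ)) w S

/-- Needed in `graftComp_comm`, where the values of two inner maps have to be expanded
simultaneously. -/
lemma exists_sum (w : PTensor k H J M) :
    ∃ (n : ℕ) (b : Fin n → HPow k H J) (z : Fin n → M), w = ∑ i, PTensor.mk k (b i) (z i) := by
  induction w using PTensor.induction with
  | h0 => exact ⟨0, Fin.elim0, Fin.elim0, by simp⟩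
  | hmk b z => exact ⟨1, fun _ => b, fun _ => z, by simp⟩
  | hadd u v hu hv =>
    obtain ⟨n, b, z, rfl⟩ := hu
    obtain ⟨n', b', z', rfl⟩ := hv
    exact ⟨n + n', Fin.append b b', Fin.append z z', by simp [Fin.sum_univ_add]⟩

lemma expand_zero (τ : J → I) : PTensor.expand τ (0 : PTensor k H I M) = 0 :=
  LinearMap.map_zero _

lemma expand_expand (τ : J → I) (τ' : K → J) (w : PTensor k H I M) :
    PTensor.expand τ' (PTensor.expand τ w) = PTensor.expand (τ ∘ τ') w := by
  induction w using PTensor.induction with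
  | h0 => simp only [expand_zero]
  | hmk b z => rw [expand_mk, expand_mk, expand_mk, Pseudo.expand_expand]
  | hadd x y hx hy => simp only [expand_add, hx, hy]

lemma perm_eq_expand (σ : Equiv.Perm J) (w : PTensor k H J M) :
    PTensor.perm σ w = PTensor.expand σ.symm w := by
  induction w using PTensor.induction with
  | h0 => rw [expand_zero, perm_zero]
  | hmk b z =>
    rw [expand_mk, expand_symm_eq_place, PTensor.perm, PTensor.baseMap_mk]
  | hadd x y hx hy => rw [expand_add, perm_add, hx, hy]

lemma map_expand [IsScalarTower k H N] [IsScalarTower k H N'] (ψ : N →ₗ[H] N') (τ : J → I)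
    (w : PTensor k H I N) :
    PTensor.map ψ (PTensor.expand τ w) = PTensor.expand τ (PTensor.map ψ w) :=
  PTensor.map_baseMap ψ _ _ w

end PTensor

/-- Transport of pseudo-multilinear maps along a bijection of the index sets of the arguments. -/
def PMap.reindex (ρ : J ≃ K) (f : PMap k H J M N) : PMap k H K M N :=
  ⟨(PTensor.baseMap (M := N) (Pseudo.expand (H := H) k ρ.symm)
    (expand_coprod ρ.symm)).compMultilinearMap (f.1.domDomCongr ρ), by
    intro h x
    have h1 := congrArg (PTensor.expand ρ.symm) (f.2 (h ∘ ρ) (x ∘ ρ))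
    rw [PTensor.expand_hsmul] at h1
    refine h1.trans ?_
    congr 1
    -- The effect on pure tensors is multiplicative in `h`, so it is enough to compare two monoid
    -- homomorphisms on families supported at a single index.
    let F : (J → H) →* HPow k H K :=
      ((Pseudo.expand k ρ.symm : HPow k H J →ₐ[k] HPow k H K) : HPow k H J →* HPow k H K).comp
        (PiTensorProduct.tprodMonoidHom k (A := fun _ : J => H))
    let F' : (J → H) →* HPow k H K :=
      (PiTensorProduct.tprodMonoidHom k (A := fun _ : K => H)).comp
        { toFun := fun h => h ∘ ρ.symm
          map_one' := rfl
          map_mul' := fun _ _ => rfl }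
    have key : F = F' := by
      refine MonoidHom.pi_ext fun j a => ?_
      change Pseudo.expand k ρ.symm (factor k j a) =
        PiTensorProduct.tprod k (Pi.mulSingle j a ∘ ρ.symm)
      rw [expand_symm_eq_place, place_factor, factor, PiTensorProduct.singleAlgHom_apply]
      congr 1
      ext i
      by_cases hi : i = ρ j
      · subst hi; simp
      · have : ρ.symm i ≠ j := fun h => hi (by rw [← h, ρ.apply_symm_apply])
        simp [hi, this]
    have := congr($key (h ∘ ρ))
    refine this.trans ?_
    change PiTensorProduct.tprod k ((h ∘ ρ) ∘ ρ.symm) = _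
    congr 1
    ext i
    simp⟩

lemma PMap.reindex_apply (ρ : J ≃ K) (f : PMap k H J M N) (x : K → M) :
    (PMap.reindex ρ f).1 x = PTensor.expand ρ.symm (f.1 (x ∘ ρ)) := rfl

/-- Separates the sign from the transport, so that identities between compositions can be checked on
shapes alone. -/
lemma signedPerm_eq_reindex (σ : Equiv.Perm J) (f : PMap k H J M N) :
    signedPerm σ f = Equiv.Perm.sign σ • PMap.reindex σ f := by
  ext x
  rw [signedPerm_apply, PTensor.perm_eq_expand]
  rfl

lemma reindex_eq_signedPerm (σ : Equiv.Perm J) (f : PMap k H J M N) :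
    PMap.reindex σ f = Equiv.Perm.sign σ • signedPerm σ f := by
  rw [signedPerm_eq_reindex, smul_smul, Int.units_mul_self, one_smul]

end Expand

/-! ### Renaming the arguments in the shape of a composition -/

section GraftAlgebra

variable {I I' J J' J₀ J₀' : Type*}

/-- Renaming the arguments of the result. -/
def Graft.permute (G : Graft I J₀ J) (ρ : J ≃ J') : Graft I J₀ J' where
  i₀ := G.i₀
  e := ρ ∘ G.e
  s := ρ ∘ G.s
  τ := G.τ ∘ ρ.symm
  e_inj := ρ.injective.comp G.e_inj
  τ_eq_iff j := by
    rw [Function.comp_apply, G.τ_eq_iff]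
    simp [Equiv.eq_symm_apply]
  τ_s i hi := by simpa using G.τ_s i hi
  s_τ j hj := by simp [G.s_τ _ hj]

/-- Renaming the arguments of the outer map. -/
def Graft.precomp (G : Graft I' J₀ J) (β : I ≃ I') : Graft I J₀ J where
  i₀ := β.symm G.i₀
  e := G.e
  s := G.s ∘ β
  τ := β.symm ∘ G.τ
  e_inj := G.e_inj
  τ_eq_iff j := by simpa using G.τ_eq_iff j
  τ_s i hi := by
    have : β i ≠ G.i₀ := fun h => hi (by simp [← h])
    simp [G.τ_s _ this]
  s_τ j hj := by
    have : G.τ j ≠ G.i₀ := fun h => hj (by simp [h])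
    simp [G.s_τ _ this]

/-- Renaming the arguments of the inner map. -/
def Graft.inner (G : Graft I J₀' J) (α : J₀ ≃ J₀') : Graft I J₀ J where
  i₀ := G.i₀
  e := G.e ∘ α
  s := G.s
  τ := G.τ
  e_inj := G.e_inj.comp α.injective
  τ_eq_iff j := by
    rw [G.τ_eq_iff]
    exact ⟨fun ⟨l, h⟩ => ⟨α.symm l, by simpa using h⟩, fun ⟨l, h⟩ => ⟨_, h⟩⟩
  τ_s := G.τ_s
  s_τ := G.s_τ

end GraftAlgebra

/-! ### Operad identities: equivariance, associativity, commuting insertions -/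

section Operad

variable {k H : Type*} [Field k] [Ring H] [HopfAlgebra k H] [Coalgebra.IsCocomm k H]
variable {I I' J J' J₀ J₀' K K₀ L : Type*} [Fintype I] [DecidableEq I] [Fintype I'] [DecidableEq I']
  [Fintype J] [DecidableEq J] [Fintype J'] [DecidableEq J'] [Fintype J₀] [DecidableEq J₀]
  [Fintype J₀'] [DecidableEq J₀'] [Fintype K] [DecidableEq K] [Fintype K₀] [DecidableEq K₀]
  [Fintype L] [DecidableEq L]
variable {M N N' : Type*} [AddCommGroup M] [Module k M] [Module H M]
  [AddCommGroup N] [Module k N] [Module H N] [AddCommGroup N'] [Module k N'] [Module H N']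

lemma place_congr {e e' : J₀ → J} (h : e = e') (he : Function.Injective e)
    (he' : Function.Injective e') (b : HPow k H J₀) : place k e he b = place k e' he' b := by
  subst h
  rfl

/-- A composition does not depend on the part `s` of its shape. -/
lemma graftComp_congr {G G' : Graft I J₀ J} (hi : G.i₀ = G'.i₀) (he : ∀ l, G.e l = G'.e l)
    (hτ : ∀ j, G.τ j = G'.τ j) (f : PMap k H I M N) (g : PMap k H J₀ M M) :
    graftComp G f g = graftComp G' f g := by
  ext x
  rw [graftComp_apply, graftComp_apply]
  -- Away from the place of insertion `s` and `τ` are mutually inverse, so `τ` determines `s`.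
  have hs : ∀ i, i ≠ G'.i₀ → (x ∘ G.s) i = (x ∘ G'.s) i := by
    intro i h
    have h1 : G.τ (G.s i) = i := G.τ_s i (hi ▸ h)
    have h2 := G'.s_τ (G.s i) (by rwa [← hτ, h1])
    rw [← hτ, h1] at h2
    exact congrArg x h2.symm
  have hτ' : G.τ = G'.τ := funext hτ
  have he' : G.e = G'.e := funext he
  rw [he']
  generalize g.1 (x ∘ G'.e) = w
  induction w using PTensor.induction with
  | h0 => simp
  | hmk b z =>
    have hu : Function.update (x ∘ G.s) G.i₀ z = Function.update (x ∘ G'.s) G'.i₀ z := by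
      rw [hi]
      ext i
      by_cases h : i = G'.i₀
      · subst h; simp
      · rw [Function.update_of_ne h, Function.update_of_ne h, hs i h]
    rw [insertAt_mk, insertAt_mk, place_congr he' G.e_inj G'.e_inj, hτ', hu]
  | hadd u v hu hv => rw [map_add, map_add, hu, hv]

/-- Together with the two lemmas that follow, this reduces an identity between renamed compositions
to an equality of shapes, which `graftComp_congr` tests on `i₀`, `e` and `τ`. -/
lemma reindex_graftComp (ρ : J ≃ J') (G : Graft I J₀ J) (f : PMap k H I M N)
    (g : PMap k H J₀ M M) :
    PMap.reindex ρ (graftComp G f g) = graftComp (G.permute ρ) f g := by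
  ext x
  rw [PMap.reindex_apply, graftComp_apply, graftComp_apply]
  change PTensor.expand ρ.symm (insertAt G f (x ∘ (G.permute ρ).s) (g.1 (x ∘ (G.permute ρ).e))) = _
  generalize g.1 (x ∘ (G.permute ρ).e) = w
  induction w using PTensor.induction with
  | h0 => rw [map_zero, map_zero, PTensor.expand_zero]
  | hmk b z =>
    rw [insertAt_mk, insertAt_mk, PTensor.expand_hsmul, PTensor.expand_expand,
      expand_symm_eq_place, place_place]
    rfl
  | hadd u v hu hv => rw [map_add, map_add, PTensor.expand_add, hu, hv]

lemma graftComp_reindex_left (β : I ≃ I') (G : Graft I' J₀ J) (f : PMap k H I M N)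
    (g : PMap k H J₀ M M) :
    graftComp G (PMap.reindex β f) g = graftComp (G.precomp β) f g := by
  ext x
  rw [graftComp_apply, graftComp_apply]
  change insertAt G _ _ (g.1 (x ∘ G.e)) = insertAt _ _ _ (g.1 (x ∘ G.e))
  generalize g.1 (x ∘ G.e) = w
  induction w using PTensor.induction with
  | h0 => rw [map_zero, map_zero]
  | hmk b z =>
    rw [insertAt_mk, insertAt_mk, PMap.reindex_apply, PTensor.expand_expand]
    have : (Function.update (x ∘ G.s) G.i₀ z ∘ β) =
        Function.update (x ∘ (G.precomp β).s) (G.precomp β).i₀ z := by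
      change _ = Function.update ((x ∘ G.s) ∘ β) (β.symm G.i₀) z
      rw [Function.update_comp_equiv]
    rw [this]
    rfl
  | hadd u v hu hv => rw [map_add, map_add, hu, hv]

lemma graftComp_reindex_right (α : J₀ ≃ J₀') (G : Graft I J₀' J) (f : PMap k H I M N)
    (g : PMap k H J₀ M M) :
    graftComp G f (PMap.reindex α g) = graftComp (G.inner α) f g := by
  ext x
  rw [graftComp_apply, graftComp_apply, PMap.reindex_apply]
  change insertAt G f (x ∘ G.s) (PTensor.expand α.symm (g.1 (x ∘ (G.inner α).e))) =
    insertAt (G.inner α) f (x ∘ G.s) (g.1 (x ∘ (G.inner α).e))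
  generalize g.1 (x ∘ (G.inner α).e) = w
  induction w using PTensor.induction with
  | h0 => rw [PTensor.expand_zero, map_zero, map_zero]
  | hmk b z =>
    rw [PTensor.expand_mk, insertAt_mk, insertAt_mk, expand_symm_eq_place, place_place]
    rfl
  | hadd u v hu hv => rw [PTensor.expand_add, map_add, map_add, hu, hv]

/-- Associativity of nested compositions, `(f ∘ g) ∘ h = f ∘ (g ∘ h)` with `h` inserted in `g`. -/
lemma graftComp_assoc (G₂ : Graft I J₀ J) (G₁ : Graft J K₀ K) (G₂' : Graft J₀ K₀ L)
    (G₁' : Graft I L K) (hi : G₂.e G₂'.i₀ = G₁.i₀) (hi' : G₁'.i₀ = G₂.i₀)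
    (he : ∀ l, G₁'.e (G₂'.e l) = G₁.e l) (hτ : ∀ x, G₂.τ (G₁.τ x) = G₁'.τ x)
    (heτ : ∀ l, G₁.τ (G₁'.e l) = G₂.e (G₂'.τ l))
    (f : PMap k H I M N) (g : PMap k H J₀ M M) (h : PMap k H K₀ M M) :
    graftComp G₁ (graftComp G₂ f g) h = graftComp G₁' f (graftComp G₂' g h) := by
  have hτi : G₂.τ G₁.i₀ = G₂.i₀ := by rw [← hi, G₂.τ_e]
  -- The positions of the arguments outside the insertions are recovered from the maps `τ`; this is
  -- why no hypothesis mentions `s`.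
  have hs1 : ∀ j, j ≠ G₂'.i₀ → G₁.s (G₂.e j) = G₁'.e (G₂'.s j) := by
    intro j hj
    have h1 : G₁.τ (G₁'.e (G₂'.s j)) = G₂.e j := by rw [heτ, G₂'.τ_s j hj]
    have h2 := G₁.s_τ (G₁'.e (G₂'.s j)) (by
      rw [h1, ← hi]
      exact fun h => hj (G₂.e_inj h))
    rwa [h1] at h2
  have hs2 : ∀ i, i ≠ G₂.i₀ → G₁.s (G₂.s i) = G₁'.s i := by
    intro i h
    have h0 : G₂.s i ≠ G₁.i₀ := fun h' => h (by rw [← G₂.τ_s i h, h', hτi])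
    have h1 : G₁'.τ (G₁.s (G₂.s i)) = i := by rw [← hτ, G₁.τ_s _ h0, G₂.τ_s i h]
    have h2 := G₁'.s_τ (G₁.s (G₂.s i)) (by rwa [h1, hi'])
    rw [h1] at h2
    exact h2.symm
  ext x
  rw [graftComp_apply, graftComp_apply, graftComp_apply]
  have e1 : h.1 ((x ∘ G₁'.e) ∘ G₂'.e) = h.1 (x ∘ G₁.e) := by
    congr 1
    ext l
    exact congrArg x (he l)
  rw [e1]
  generalize h.1 (x ∘ G₁.e) = w
  induction w using PTensor.induction with
  | h0 => simp only [map_zero]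
  | hadd u v hu hv => simp only [map_add, hu, hv]
  | hmk b z =>
    rw [insertAt_mk, insertAt_mk, graftComp_apply]
    have e2 : g.1 (Function.update (x ∘ G₁.s) G₁.i₀ z ∘ G₂.e) =
        g.1 (Function.update ((x ∘ G₁'.e) ∘ G₂'.s) G₂'.i₀ z) := by
      congr 1
      ext j
      by_cases hj : j = G₂'.i₀
      · subst hj; simp [hi]
      · have : G₂.e j ≠ G₁.i₀ := by
          rw [← hi]
          exact fun h => hj (G₂.e_inj h)
        simpa [hj, this] using congrArg x (hs1 j hj)
    rw [e2]
    generalize g.1 (Function.update ((x ∘ G₁'.e) ∘ G₂'.s) G₂'.i₀ z) = w'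
    induction w' using PTensor.induction with
    | h0 => simp only [map_zero, PTensor.expand_zero, smul_zero]
    | hadd u v hu hv => simp only [map_add, PTensor.expand_add, smul_add, hu, hv]
    | hmk c u =>
      have e3 : Function.update ((Function.update (x ∘ G₁.s) G₁.i₀ z) ∘ G₂.s) G₂.i₀ u =
          Function.update (x ∘ G₁'.s) G₁'.i₀ u := by
        rw [hi']
        ext i
        by_cases h : i = G₂.i₀
        · subst h; simp
        · have h0 : G₂.s i ≠ G₁.i₀ := fun h' => h (by rw [← G₂.τ_s i h, h', hτi])
          simpa [h, h0] using congrArg x (hs2 i h)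
      have e4 : G₂.τ ∘ G₁.τ = G₁'.τ := funext hτ
      -- On the left the coproduct hits a coefficient `c` already placed by `G₂.e`. It can be taken
      -- before placing, because the fibres of `G₁.τ` over the range of `G₂.e` lie in the range of
      -- `G₁'.e`.
      rw [insertAt_mk, PTensor.expand_mk, PTensor.smul_mk, insertAt_mk, e3,
        PTensor.expand_hsmul, PTensor.expand_expand, smul_smul, e4, map_mul, place_place,
        expand_place G₂.e_inj G₁'.e_inj heτ ?_ c, place_congr (show G₁'.e ∘ G₂'.e = G₁.e from funext he) _ G₁.e_inj]
      intro y j hy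
      refine (G₁'.τ_eq_iff y).1 ?_
      rw [← hτ, hy, G₂.τ_e, hi']

/-- `H` need not be commutative, but elements supported on disjoint sets of factors commute. This is
the commutation needed for inserting two maps in either order. -/
lemma place_commute {J₁ : Type*} [Fintype J₁] [DecidableEq J₁] (e : J₀ → J)
    (he : Function.Injective e) (e' : J₁ → J) (he' : Function.Injective e')
    (h : ∀ l l', e l ≠ e' l') (b : HPow k H J₀) (c : HPow k H J₁) :
    Commute (place k e he b) (place k e' he' c) := by
  suffices H1 : ∀ b, place k e he b ∈ Subalgebra.centralizer k {place k e' he' c} by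
    have := H1 b
    rw [Subalgebra.mem_centralizer_iff] at this
    exact (this _ rfl).symm
  intro b
  induction b using PiTensorProduct.induction_on with
  | smul_tprod r a =>
    rw [map_smul]
    refine Subalgebra.smul_mem _ ?_ r
    have : place k e he (PiTensorProduct.tprod k a) = MonoidHom.noncommPiCoprod
        (fun i => ((factor k (e i) : H →ₐ[k] HPow k H J) : H →* HPow k H J))
        (fun _ _ hij a b => factor_commute (he.ne hij) a b) a :=
      PiTensorProduct.lift.tprod _
    rw [this, Subalgebra.mem_centralizer_iff]
    rintro _ rfl
    exact MonoidHom.commute_noncommPiCoprod _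
      (fun i x => (factor_commute_place e' he' (fun l => (h i l).symm) x c).symm) a
  | add x y hx hy =>
    rw [map_add]
    exact add_mem hx hy

/-- Insertions at two different places of `f` commute. -/
lemma graftComp_comm (G₂ : Graft I J₀ J) (G₁ : Graft J K₀ K) (G₂' : Graft I K₀ J')
    (G₁' : Graft J' J₀ K) (hi : G₂.τ G₁.i₀ = G₂'.i₀) (hi' : G₂'.τ G₁'.i₀ = G₂.i₀)
    (hne : G₂.i₀ ≠ G₂'.i₀) (hτ : ∀ x, G₂.τ (G₁.τ x) = G₂'.τ (G₁'.τ x))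
    (he : ∀ l, G₁.s (G₂.e l) = G₁'.e l) (he' : ∀ l, G₁'.s (G₂'.e l) = G₁.e l)
    (f : PMap k H I M N) (g : PMap k H J₀ M M) (h : PMap k H K₀ M M) :
    graftComp G₁ (graftComp G₂ f g) h = graftComp G₁' (graftComp G₂' f h) g := by
  have hn : ∀ l, G₂.e l ≠ G₁.i₀ := fun l h => hne (by rw [← hi, ← h, G₂.τ_e])
  have hn' : ∀ l, G₂'.e l ≠ G₁'.i₀ := fun l h => hne (by rw [← hi', ← h, G₂'.τ_e])
  have hs : ∀ i, i ≠ G₂.i₀ → i ≠ G₂'.i₀ → G₁.s (G₂.s i) = G₁'.s (G₂'.s i) ∧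
      G₂.s i ≠ G₁.i₀ ∧ G₂'.s i ≠ G₁'.i₀ := by
    intro i h1 h2
    have h3 : G₂.s i ≠ G₁.i₀ := fun h => h2 (by rw [← hi, ← h, G₂.τ_s i h1])
    have h4 : G₂'.s i ≠ G₁'.i₀ := fun h => h1 (by rw [← hi', ← h, G₂'.τ_s i h2])
    refine ⟨?_, h3, h4⟩
    set y := G₁.s (G₂.s i) with hy
    have h5 : G₂'.τ (G₁'.τ y) = i := by rw [← hτ, hy, G₁.τ_s _ h3, G₂.τ_s i h1]
    have h6 : G₁'.τ y ≠ G₁'.i₀ := fun h => h1 (by rw [← h5, h, hi'])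
    have h7 := G₂'.s_τ (G₁'.τ y) (by rwa [h5])
    have h8 := G₁'.s_τ y h6
    rw [← h7, h5] at h8
    exact h8.symm
  have hi₂ : G₂.s G₂'.i₀ = G₁.i₀ := by
    have := G₂.s_τ G₁.i₀ (by rw [hi]; exact hne.symm)
    rwa [hi] at this
  have hi₂' : G₂'.s G₂.i₀ = G₁'.i₀ := by
    have := G₂'.s_τ G₁'.i₀ (by rw [hi']; exact hne)
    rwa [hi'] at this
  ext x
  rw [graftComp_apply, graftComp_apply]
  have hg : ∀ z, g.1 (Function.update (x ∘ G₁.s) G₁.i₀ z ∘ G₂.e) = g.1 (x ∘ G₁'.e) := by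
    intro z
    congr 1
    ext l
    simpa [hn l] using congrArg x (he l)
  have hh : ∀ z, h.1 (Function.update (x ∘ G₁'.s) G₁'.i₀ z ∘ G₂'.e) = h.1 (x ∘ G₁.e) := by
    intro z
    congr 1
    ext l
    simpa [hn' l] using congrArg x (he' l)
  obtain ⟨n, b, z, hw⟩ := PTensor.exists_sum (h.1 (x ∘ G₁.e))
  obtain ⟨n', c, u, hv⟩ := PTensor.exists_sum (g.1 (x ∘ G₁'.e))
  -- With both inner values expanded, `hL` and `hR` bring the two sides to the same double sum. The
  -- coefficients `b i` and `c j` first appear in opposite orders, and `hR` interchanges them.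
  have hL : ∀ i, insertAt G₁ (graftComp G₂ f g) (x ∘ G₁.s) (PTensor.mk k (b i) (z i)) =
      ∑ j, (place k G₁.e G₁.e_inj (b i) * place k G₁'.e G₁'.e_inj (c j)) •
        PTensor.expand (G₂.τ ∘ G₁.τ) (f.1 (Function.update
          (Function.update ((x ∘ G₁.s) ∘ G₂.s) G₂'.i₀ (z i)) G₂.i₀ (u j))) := by
    intro i
    rw [insertAt_mk, graftComp_apply, hg, hv, map_sum, PTensor.expand_sum, Finset.smul_sum]
    refine Finset.sum_congr rfl fun j _ => ?_
    -- Over the range of `G₂.e` the map `G₁.τ` has one-point fibres, whence `τ₀ := id`: the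
    -- arguments of `g` are not touched by the insertion of `h`.
    rw [insertAt_mk, PTensor.expand_hsmul, PTensor.expand_expand, smul_smul,
      expand_place G₂.e_inj G₁'.e_inj (τ₀ := id) ?_ ?_, expand_id]
    · congr 3
      ext a
      by_cases h1 : a = G₂'.i₀
      · subst h1; simp [hi₂, hne.symm]
      · have : ∀ y : J → M, a ≠ G₂.i₀ → Function.update y G₁.i₀ (z i) (G₂.s a) = y (G₂.s a) :=
          fun y h => Function.update_of_ne (hs a h h1).2.1 _ _
        by_cases h2 : a = G₂.i₀
        · subst h2; simp
        · simp [h1, h2, this _ h2]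
    · intro l
      rw [← he, G₁.τ_s _ (hn l)]
      rfl
    · intro y j hy
      refine ⟨j, ?_⟩
      rw [← he, ← hy, G₁.s_τ _ (by rw [hy]; exact hn j)]
  have hR : ∀ j, insertAt G₁' (graftComp G₂' f h) (x ∘ G₁'.s) (PTensor.mk k (c j) (u j)) =
      ∑ i, (place k G₁.e G₁.e_inj (b i) * place k G₁'.e G₁'.e_inj (c j)) •
        PTensor.expand (G₂.τ ∘ G₁.τ) (f.1 (Function.update
          (Function.update ((x ∘ G₁.s) ∘ G₂.s) G₂'.i₀ (z i)) G₂.i₀ (u j))) := by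
    intro j
    rw [insertAt_mk, graftComp_apply, hh, hw, map_sum, PTensor.expand_sum, Finset.smul_sum]
    refine Finset.sum_congr rfl fun i _ => ?_
    rw [insertAt_mk, PTensor.expand_hsmul, PTensor.expand_expand, smul_smul,
      expand_place G₂'.e_inj G₁.e_inj (τ₀ := id) ?_ ?_, expand_id]
    · have : G₂'.τ ∘ G₁'.τ = G₂.τ ∘ G₁.τ := funext fun y => (hτ y).symm
      rw [this, (place_commute G₁.e G₁.e_inj G₁'.e G₁'.e_inj ?_ (b i) (c j)).eq]
      · congr 3
        ext a
        by_cases h1 : a = G₂'.i₀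
        · subst h1; simp [hne.symm]
        · by_cases h2 : a = G₂.i₀
          · subst h2; simp [hi₂', hne]
          · have h3 := hs a h2 h1
            simpa [h1, h2, h3.2.2] using congrArg x h3.1.symm
      · intro l l' hl
        have h1 := G₁.τ_e l
        rw [hl, ← he, G₁.τ_s _ (hn l')] at h1
        exact hn l' h1
    · intro l
      rw [← he', G₁'.τ_s _ (hn' l)]
      rfl
    · intro y i hy
      refine ⟨i, ?_⟩
      rw [← he', ← hy, G₁'.s_τ _ (by rw [hy]; exact hn' i)]
  conv_lhs => rw [hw, map_sum]
  conv_rhs => rw [hv, map_sum]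
  rw [Finset.sum_congr rfl fun i _ => hL i, Finset.sum_congr rfl fun j _ => hR j]
  exact Finset.sum_comm

end Operad

/-! ### Skew-symmetrization and its relation to the circle product -/

section PreLie

variable {k H : Type*} [Field k] [Ring H] [HopfAlgebra k H] [Coalgebra.IsCocomm k H]
variable {I J J₀ : Type*} [Fintype I] [DecidableEq I] [Fintype J] [DecidableEq J]
  [Fintype J₀] [DecidableEq J₀]
variable {M N : Type*} [AddCommGroup M] [Module k M] [Module H M]
  [AddCommGroup N] [Module k N] [Module H N]

/-- The composition of shape `G` as a bilinear map. -/
def graftCompLin (G : Graft I J₀ J) :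
    PMap k H I M N →ₗ[k] PMap k H J₀ M M →ₗ[k] PMap k H J M N :=
  LinearMap.mk₂ k (graftComp G)
    (fun f f' g => by
      ext x
      exact insertAt_add_left G f f' _ _)
    (fun c f g => by
      ext x
      exact insertAt_smul_left G c f _ _)
    (fun f g g' => by
      ext x
      exact map_add (insertAt G f (x ∘ G.s)) _ _)
    (fun c f g => by
      ext x
      exact map_smul (insertAt G f (x ∘ G.s)) _ _)

lemma graftComp_units_smul_left (G : Graft I J₀ J) (u : ℤˣ) (f : PMap k H I M N)
    (g : PMap k H J₀ M M) : graftComp G (u • f) g = u • graftComp G f g := by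
  rw [Units.smul_def, Units.smul_def]
  exact map_zsmul ((graftCompLin G).flip g) (u : ℤ) f

lemma graftComp_units_smul_right (G : Graft I J₀ J) (u : ℤˣ) (f : PMap k H I M N)
    (g : PMap k H J₀ M M) : graftComp G f (u • g) = u • graftComp G f g := by
  rw [Units.smul_def, Units.smul_def]
  exact map_zsmul (graftCompLin G f) (u : ℤ) g

lemma signedPerm_one (f : PMap k H J M N) : signedPerm 1 f = f := by
  ext x
  rw [signedPerm_apply, PTensor.perm_one, Equiv.Perm.sign_one, one_smul]
  rfl

lemma signedPerm_toPMap {n : ℕ} (f : Cochain k H n M N) (σ : Equiv.Perm (Fin n)) :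
    signedPerm σ (Cochain.toPMap f) = Cochain.toPMap f := by
  ext x
  rw [signedPerm_apply]
  exact (f.2.2 σ x).symm

/-- Skew-symmetrization, the sum of `signedPerm σ F` over all permutations `σ`. -/
def altSum {n : ℕ} : PMap k H (Fin n) M N →ₗ[k] Cochain k H n M N where
  toFun F := ⟨(∑ σ : Equiv.Perm (Fin n), signedPerm σ F).1, Subtype.property _, fun s x => by
    have h : signedPerm s (∑ σ : Equiv.Perm (Fin n), signedPerm σ F) =
        ∑ σ : Equiv.Perm (Fin n), signedPerm σ F := by
      rw [signedPerm_sum]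
      simp only [← signedPerm_mul]
      exact Fintype.sum_equiv (Equiv.mulLeft s) _ _ fun σ => rfl
    rw [← signedPerm_apply, h]⟩
  map_add' F F' := by
    apply Subtype.ext
    change ((∑ σ : Equiv.Perm (Fin n), signedPermLin σ (F + F') : PMap k H (Fin n) M N)).1 =
      ((∑ σ : Equiv.Perm (Fin n), signedPermLin σ F) + ∑ σ, signedPermLin σ F' :
        PMap k H (Fin n) M N).1
    simp only [map_add, Finset.sum_add_distrib]
  map_smul' c F := by
    apply Subtype.ext
    change ((∑ σ : Equiv.Perm (Fin n), signedPermLin σ (c • F) : PMap k H (Fin n) M N)).1 =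
      (c • (∑ σ : Equiv.Perm (Fin n), signedPermLin σ F) : PMap k H (Fin n) M N).1
    simp only [map_smul, Finset.smul_sum]

lemma toPMap_altSum {n : ℕ} (F : PMap k H (Fin n) M N) :
    Cochain.toPMap (altSum F) = ∑ σ : Equiv.Perm (Fin n), signedPerm σ F := rfl

/-- No sign appears because `signedPerm` already carries it; right translation merely permutes the
summands. -/
lemma altSum_signedPerm {n : ℕ} (σ : Equiv.Perm (Fin n)) (F : PMap k H (Fin n) M N) :
    altSum (signedPerm σ F) = altSum F := by
  apply Cochain.toPMap_injective
  rw [toPMap_altSum, toPMap_altSum]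
  simp only [← signedPerm_mul]
  exact Fintype.sum_equiv (Equiv.mulRight σ) _ _ fun τ => rfl

lemma altSum_units_smul {n : ℕ} (u : ℤˣ) (F : PMap k H (Fin n) M N) :
    altSum (u • F) = u • altSum F := by
  rw [Units.smul_def, Units.smul_def]
  exact map_zsmul altSum (u : ℤ) F

/-- The sign of a bijection `Fin a ≃ Fin b`. -/
def finSign {a b : ℕ} (ρ : Fin a ≃ Fin b) (h : a = b) : ℤˣ :=
  Equiv.Perm.sign (ρ.trans (finCongr h.symm))

/-- Arities such as `m + n + p` and `m + (n + p)` give different types of cochains. Passing to the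
direct sum puts both sides into one type, and all such comparisons below are made there. -/
lemma of_altSum_reindex {a b : ℕ} (h : a = b) (ρ : Fin (a + 1) ≃ Fin (b + 1))
    (F : PMap k H (Fin (a + 1)) M N) :
    Cochains.of b (altSum (PMap.reindex ρ F)) =
      finSign ρ (by rw [h]) • Cochains.of a (altSum F) := by
  subst h
  have h1 : ρ.trans (finCongr (rfl : a + 1 = a + 1).symm) = ρ := by
    ext
    rfl
  have h2 := reindex_eq_signedPerm (k := k) ρ F
  rw [finSign, h1, h2, altSum_units_smul, altSum_signedPerm, Units.smul_def, Units.smul_def,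
    map_zsmul]

/-- Every permutation is uniquely a shuffle followed on the right by a block permutation. -/
lemma sum_perm_eq_sum_shuffles {m n : ℕ} {V : Type*} [AddCommMonoid V]
    (T : Equiv.Perm (Fin (m + n + 1)) → V) (hT : ∀ σ ρ, T (σ * blockPerm m n ρ) = T σ) :
    ∑ σ, T σ = ((n + 1).factorial * m.factorial) •
      ∑ σ ∈ shuffles (n + 1) (m + n + 1), T σ := by
  have h1 : ∑ σ, T σ = ∑ p ∈ shuffles (n + 1) (m + n + 1) ×ˢ
      (Finset.univ : Finset (Equiv.Perm (Fin (n + 1)) × Equiv.Perm (Fin m))),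
        T (p.1 * blockPerm m n p.2) := by
    symm
    refine Finset.sum_bij (fun p _ => p.1 * blockPerm m n p.2) (fun _ _ => Finset.mem_univ _)
      ?_ ?_ (fun _ _ => rfl)
    · rintro ⟨σ, ρ⟩ h ⟨σ', ρ'⟩ h' e
      simp only [Finset.mem_product, Finset.mem_univ, and_true] at h h' e
      have e1 : σ * blockPerm m n (ρ * ρ'⁻¹) = σ' := by
        rw [map_mul, map_inv, ← mul_assoc, e, mul_inv_cancel_right]
      have e2 := shuffle_unique _ h (e1 ▸ h')
      have e3 : ρ = ρ' := mul_inv_eq_one.1 e2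
      rw [e2, map_one, mul_one] at e1
      rw [e1, e3]
    · intro τ _
      obtain ⟨ρ, hρ⟩ := exists_shuffle τ
      exact ⟨(τ * blockPerm m n ρ, ρ⁻¹), by simpa using hρ, by simp [mul_assoc]⟩
  rw [h1, Finset.sum_product, Finset.smul_sum]
  refine Finset.sum_congr rfl fun σ _ => ?_
  simp [hT, Fintype.card_perm]

/-- The summand is invariant under permutations within the two blocks, and every coset of the block
subgroup contains exactly one shuffle. Full skew-symmetrization makes iterated circle products
computable without shuffle combinatorics, at the price of factorials to be cancelled later. -/
lemma factorial_smul_circ {m n : ℕ} (f : Cochain k H (m + 1) M N) (g : Cochain k H (n + 1) M M) :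
    ((n + 1).factorial * m.factorial) • circ f g = altSum (circFirst f g) := by
  apply Cochain.toPMap_injective
  rw [toPMap_altSum, sum_perm_eq_sum_shuffles (fun σ => signedPerm σ (circFirst f g))
    (fun σ ρ => by rw [signedPerm_mul, signedPerm_circFirst])]
  rfl

/-- The composition of `F` with `g` inserted at the first place. -/
abbrev compFirst {m n : ℕ} (F : PMap k H (Fin (m + 1)) M N) (g : PMap k H (Fin (n + 1)) M M) :
    PMap k H (Fin (m + n + 1)) M N :=
  graftComp (Graft.first m n) F g

lemma circFirst_eq {m n : ℕ} (f : Cochain k H (m + 1) M N) (g : Cochain k H (n + 1) M M) :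
    circFirst f g = compFirst (Cochain.toPMap f) (Cochain.toPMap g) := rfl

/-- A permutation of the outer map that fixes the place of insertion acts on the result through the
last `m` arguments, with the same sign. -/
lemma compFirst_signedPerm_left {m n : ℕ} (β : Equiv.Perm (Fin m))
    (F : PMap k H (Fin (m + 1)) M N) (g : PMap k H (Fin (n + 1)) M M) :
    compFirst (signedPerm (succPerm β) F) g = signedPerm (blockPerm m n (1, β)) (compFirst F g) := by
  rw [signedPerm_eq_reindex, signedPerm_eq_reindex, compFirst, graftComp_units_smul_left, sign_succPerm,
    sign_blockPerm, Equiv.Perm.sign_one, one_mul, graftComp_reindex_left, reindex_graftComp]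
  congr 1
  refine graftComp_congr ?_ ?_ ?_ F g
  · change (succPerm β).symm 0 = 0
    rw [Equiv.symm_apply_eq, succPerm_zero]
  · intro l
    change (Graft.first m n).e l = blockPerm m n (1, β) ((Graft.first m n).e l)
    rw [Graft.first_e, blockPerm_inl]
    rfl
  · intro j
    obtain ⟨j, rfl⟩ := (blockPerm m n (1, β)).surjective j
    change (succPerm β).symm _ = (Graft.first m n).τ ((blockPerm m n (1, β)).symm _)
    rw [Equiv.symm_apply_eq, Equiv.symm_apply_apply]
    obtain ⟨l | i, rfl⟩ := (blockEquiv m n).surjective j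
    · rw [blockPerm_inl, Graft.first_τ_inl, Graft.first_τ_inl, succPerm_zero]
    · rw [blockPerm_inr, Graft.first_τ_inr, Graft.first_τ_inr, succPerm_succ]

lemma compFirst_signedPerm_right {m n : ℕ} (α : Equiv.Perm (Fin (n + 1)))
    (F : PMap k H (Fin (m + 1)) M N) (g : PMap k H (Fin (n + 1)) M M) :
    compFirst F (signedPerm α g) = signedPerm (blockPerm m n (α, 1)) (compFirst F g) := by
  rw [signedPerm_eq_reindex, signedPerm_eq_reindex, compFirst, graftComp_units_smul_right,
    sign_blockPerm, Equiv.Perm.sign_one, mul_one, graftComp_reindex_right, reindex_graftComp]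
  congr 1
  refine graftComp_congr ?_ ?_ ?_ F g
  · rfl
  · intro l
    change (Graft.first m n).e (α l) = blockPerm m n (α, 1) ((Graft.first m n).e l)
    rw [Graft.first_e, Graft.first_e, blockPerm_inl]
  · intro j
    obtain ⟨j, rfl⟩ := (blockPerm m n (α, 1)).surjective j
    change (Graft.first m n).τ _ = (Graft.first m n).τ ((blockPerm m n (α, 1)).symm _)
    rw [Equiv.symm_apply_apply]
    obtain ⟨l | i, rfl⟩ := (blockEquiv m n).surjective j
    · rw [blockPerm_inl, Graft.first_τ_inl, Graft.first_τ_inl]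
    · rw [blockPerm_inr]
      rfl

lemma exists_succPerm {m : ℕ} (σ : Equiv.Perm (Fin (m + 1))) (h : σ 0 = 0) :
    ∃ β, σ = succPerm β := by
  obtain ⟨⟨p, β⟩, rfl⟩ := Equiv.Perm.decomposeFin.symm.surjective σ
  rw [Equiv.Perm.decomposeFin_symm_apply_zero] at h
  subst h
  exact ⟨β, rfl⟩

lemma altSum_compFirst_signedPerm {m n : ℕ} (σ : Equiv.Perm (Fin (m + 1))) (h : σ 0 = 0)
    (F : PMap k H (Fin (m + 1)) M N) (g : PMap k H (Fin (n + 1)) M M) :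
    altSum (compFirst (signedPerm σ F) g) = altSum (compFirst F g) := by
  obtain ⟨β, rfl⟩ := exists_succPerm σ h
  rw [compFirst_signedPerm_left, altSum_signedPerm]

/-- For each `i` there are `m!` permutations with `σ⁻¹ 0 = i`. -/
lemma sum_perm_inv_zero {m : ℕ} {V : Type*} [AddCommMonoid V] (φ : Fin (m + 1) → V) :
    ∑ σ : Equiv.Perm (Fin (m + 1)), φ (σ⁻¹ 0) = m.factorial • ∑ i, φ i := by
  rw [Fintype.sum_equiv (Equiv.inv _) (fun σ : Equiv.Perm (Fin (m + 1)) => φ (σ⁻¹ 0))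
    (fun σ => φ (σ 0)) (fun σ => rfl),
    Fintype.sum_equiv Equiv.Perm.decomposeFin (fun σ : Equiv.Perm (Fin (m + 1)) => φ (σ 0))
    (fun p => φ p.1) (fun σ => by
      obtain ⟨⟨p, β⟩, rfl⟩ := Equiv.Perm.decomposeFin.symm.surjective σ
      simp), Fintype.sum_prod_type, Finset.smul_sum]
  simp [Fintype.card_perm]

/-- `f ⊚ (g ⊚ h)` in terms of the iterated composition. -/
lemma factorial_smul_circ_circ_right {m n p : ℕ} (f : Cochain k H (m + 1) M N)
    (g : Cochain k H (n + 1) M M) (h : Cochain k H (p + 1) M M) :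
    (m.factorial * n.factorial * (p + 1).factorial * (n + p + 1).factorial) •
      circ f (circ g h) = (n + p + 1).factorial • altSum (compFirst (Cochain.toPMap f)
        (compFirst (Cochain.toPMap g) (Cochain.toPMap h))) := by
  have h1 : ((p + 1).factorial * n.factorial) • altSum (circFirst f (circ g h)) =
      (n + p + 1).factorial • altSum (compFirst (Cochain.toPMap f)
        (compFirst (Cochain.toPMap g) (Cochain.toPMap h))) := by
    -- Expanded over all permutations, the inner product contributes `(n + p + 1)!` terms. Each
    -- permutation acts on the result through the first block, so the outer skew-symmetrization
    -- makes these terms equal.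
    have : ((p + 1).factorial * n.factorial) • circFirst f (circ g h) =
        ∑ σ : Equiv.Perm (Fin (n + p + 1)), compFirst (Cochain.toPMap f)
          (signedPerm σ (compFirst (Cochain.toPMap g) (Cochain.toPMap h))) := by
      have e := congrArg (fun G => graftCompLin (Graft.first m (n + p)) (Cochain.toPMap f)
        (Cochain.toPMap G)) (factorial_smul_circ g h)
      have e' : ∀ c : ℕ, Cochain.toPMap (c • circ g h) = c • Cochain.toPMap (circ g h) :=
        fun c => rfl
      simp only [e', toPMap_altSum, map_sum, map_nsmul] at e
      exact e
    rw [← map_nsmul, this, map_sum]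
    simp only [compFirst_signedPerm_right, altSum_signedPerm]
    simp [Fintype.card_perm]
  rw [← h1, ← factorial_smul_circ, smul_smul]
  congr 1
  ring

/-- Argument `σ⁻¹ 0` of `F` is the one that receives `g`. How `σ` distributes the other arguments is
absorbed by the skew-symmetrization, sign included. -/
lemma altSum_compFirst_congr {m n : ℕ} {σ σ' : Equiv.Perm (Fin (m + 1))} (h : σ⁻¹ 0 = σ'⁻¹ 0)
    (F : PMap k H (Fin (m + 1)) M N) (g : PMap k H (Fin (n + 1)) M M) :
    altSum (compFirst (signedPerm σ F) g) = altSum (compFirst (signedPerm σ' F) g) := by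
  have h1 : signedPerm σ F = signedPerm (σ * σ'⁻¹) (signedPerm σ' F) := by
    rw [← signedPerm_mul, inv_mul_cancel_right]
  have h2 : (σ * σ'⁻¹) 0 = 0 := by
    rw [Equiv.Perm.mul_apply, ← h, ← Equiv.Perm.mul_apply, mul_inv_cancel, Equiv.Perm.one_apply]
  rw [h1, altSum_compFirst_signedPerm _ h2]

/-- The circle product `f ⊚ g` is expanded over all permutations, and the terms are sorted by the
argument of `f (g (⋯), ⋯)` that receives `h`; each argument occurs `(m + n)!` times. The `n + 1`
arguments of `g` all yield the nested composition, and the `m` arguments of `f` beside `g` yield the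
common value `Y`. -/
lemma sum_altSum_compFirst {m n p : ℕ} (f : Cochain k H (m + 1) M N)
    (g : Cochain k H (n + 1) M M) (h : PMap k H (Fin (p + 1)) M M)
    (Y : Cochain k H (m + n + p + 1) M N)
    (hY : ∀ i : Fin m, altSum (compFirst (signedPerm
      (Equiv.swap 0 (blockEquiv m n (Sum.inr i))) (circFirst f g)) h) = Y) :
    ((n + 1).factorial * m.factorial) • altSum (compFirst (Cochain.toPMap (circ f g)) h) =
      (m + n).factorial • ((n + 1) • altSum (compFirst (circFirst f g) h) + m • Y) := by
  set Φ : Equiv.Perm (Fin (m + n + 1)) → Cochain k H (m + n + p + 1) M N :=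
    fun σ => altSum (compFirst (signedPerm σ (circFirst f g)) h) with hΦ
  have e1 : ((n + 1).factorial * m.factorial) • altSum (compFirst (Cochain.toPMap (circ f g)) h) =
      ∑ σ, Φ σ := by
    have e := congrArg (fun G => altSum ((graftCompLin (Graft.first (m + n) p)).flip h
        (Cochain.toPMap G))) (factorial_smul_circ f g)
    have e' : ∀ c : ℕ, Cochain.toPMap (c • circ f g) = c • Cochain.toPMap (circ f g) :=
      fun c => rfl
    simp only [e', toPMap_altSum, map_sum, map_nsmul] at e
    exact e
  have e2 : ∀ σ, Φ σ = Φ (Equiv.swap 0 (σ⁻¹ 0)) := by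
    intro σ
    exact altSum_compFirst_congr (by simp [Equiv.swap_inv]) _ _
  have e3 : ∀ l : Fin (n + 1), Φ (Equiv.swap 0 (blockEquiv m n (Sum.inl l))) =
      altSum (compFirst (circFirst f g) h) := by
    intro l
    have h0 : (0 : Fin (m + n + 1)) = blockEquiv m n (Sum.inl 0) := by
      ext
      rw [blockEquiv_inl]
      rfl
    -- This transposition stays within the arguments of `g`, so `circFirst f g` is invariant under
    -- it.
    have : Equiv.swap 0 (blockEquiv m n (Sum.inl l)) = blockPerm m n (Equiv.swap 0 l, 1) := by
      ext j
      obtain ⟨j | j, rfl⟩ := (blockEquiv m n).surjective j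
      · rw [blockPerm_inl, h0, (blockEquiv m n).injective.swap_apply,
          Sum.inl_injective.swap_apply]
      · rw [blockPerm_inr, h0, (blockEquiv m n).injective.swap_apply,
          Equiv.swap_apply_of_ne_of_ne (by simp) (by simp)]
        rfl
    simp only [hΦ]
    rw [this, signedPerm_circFirst]
  rw [e1, Finset.sum_congr rfl fun σ _ => e2 σ,
    sum_perm_inv_zero fun i => Φ (Equiv.swap 0 i), ← (blockEquiv m n).sum_comp,
    Fintype.sum_sum_type]
  rw [Finset.sum_congr rfl fun l _ => e3 l, Finset.sum_congr rfl fun i _ => hY i]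
  simp

end PreLie

/-! ### Nested and parallel double compositions, with the sign of exchanging two blocks -/

section PreLie

variable {k H : Type*} [Field k] [Ring H] [HopfAlgebra k H] [Coalgebra.IsCocomm k H]
variable {M N : Type*} [AddCommGroup M] [Module k M] [Module H M]
  [AddCommGroup N] [Module k N] [Module H N]

/-- Numerical values of the permutations turn equalities of shapes into case distinctions in linear
arithmetic. -/
lemma coe_cycleRange {N : ℕ} (i j : Fin N) :
    ((Fin.cycleRange i j : Fin N) : ℕ) =
      if (j : ℕ) < i then (j : ℕ) + 1 else if (j : ℕ) = i then 0 else j := by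
  rcases lt_trichotomy j i with h | h | h
  · rw [Fin.coe_cycleRange_of_lt h, if_pos (Fin.lt_def.1 h)]
  · subst h
    rw [Fin.coe_cycleRange_of_le le_rfl]
    simp
  · rw [Fin.cycleRange_of_gt h, if_neg (by omega), if_neg (by omega)]

lemma coe_cycleRange_pow {N : ℕ} (i j : Fin N) (r : ℕ) (hr : r ≤ i + 1) :
    (((Fin.cycleRange i ^ r) j : Fin N) : ℕ) =
      if (j : ℕ) ≤ i then if (j : ℕ) + r ≤ i then (j : ℕ) + r else j + r - (i + 1) else j := by
  induction r with
  | zero =>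
    rw [pow_zero, Equiv.Perm.one_apply]
    split_ifs <;> omega
  | succ r ih =>
    rw [pow_succ', Equiv.Perm.mul_apply, coe_cycleRange, ih (by omega)]
    split_ifs <;> omega

/-- The exchange of the first two blocks of lengths `n + 1` and `p + 1`. -/
def blockSwap (m n p : ℕ) : Fin (m + 1 + p + n + 1) ≃ Fin (m + 1 + n + p + 1) :=
  (Fin.cycleRange (⟨n + p + 1, by omega⟩ : Fin (m + 1 + p + n + 1)) ^ (p + 1)).trans
    (finCongr (by omega))

lemma coe_blockSwap (m n p : ℕ) (j : Fin (m + 1 + p + n + 1)) :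
    (blockSwap m n p j : ℕ) = if (j : ℕ) ≤ n then (j : ℕ) + p + 1 else
      if (j : ℕ) ≤ n + p + 1 then (j : ℕ) - (n + 1) else j := by
  rw [blockSwap, Equiv.trans_apply, finCongr_apply, Fin.val_cast,
    coe_cycleRange_pow _ _ _ (by simp only; omega)]
  simp only
  split_ifs <;> omega

lemma finSign_blockSwap (m n p : ℕ) (h : m + 1 + p + n + 1 = m + 1 + n + p + 1) :
    finSign (blockSwap m n p) h = (-1) ^ ((n + p + 1) * (p + 1)) := by
  have : (blockSwap m n p).trans (finCongr h.symm) =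
      Fin.cycleRange (⟨n + p + 1, by omega⟩ : Fin (m + 1 + p + n + 1)) ^ (p + 1) := by
    ext
    rfl
  rw [finSign, this, map_pow, Fin.sign_cycleRange, ← pow_mul]

lemma finSign_finCongr {a b : ℕ} (h : a = b) : finSign (finCongr h) h = 1 := by
  subst h
  exact Equiv.Perm.sign_refl

/-- Associativity of nested insertion; the transport only changes the bracketing of the arity, so it
contributes no sign. -/
lemma circFirst_circFirst {m n p : ℕ} (f : PMap k H (Fin (m + 1)) M N)
    (g : PMap k H (Fin (n + 1)) M M) (h : PMap k H (Fin (p + 1)) M M) :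
    compFirst (compFirst f g) h = PMap.reindex (finCongr (by omega))
      (compFirst f (compFirst g h)) := by
  rw [reindex_graftComp]
  refine graftComp_assoc _ _ _ _ ?_ ?_ ?_ ?_ ?_ f g h
  · rfl
  · rfl
  · intro l
    rfl
  · intro x
    ext
    simp [Graft.first, Graft.permute]
    omega
  · intro l
    ext
    simp [Graft.first, Graft.permute]

lemma of_altSum_circFirst_circFirst {m n p : ℕ} (f : PMap k H (Fin (m + 1)) M N)
    (g : PMap k H (Fin (n + 1)) M M) (h : PMap k H (Fin (p + 1)) M M) :
    Cochains.of (m + n + p) (altSum (compFirst (compFirst f g) h)) =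
      Cochains.of (m + (n + p)) (altSum (compFirst f (compFirst g h))) := by
  rw [circFirst_circFirst, of_altSum_reindex (by omega), finSign_finCongr, one_smul]

/-- The skew-symmetrization of `f (g (⋯), h (⋯), ⋯)`. -/
def parallelSum {m n p : ℕ} (f : Cochain k H (m + 1 + 1) M N) (g : Cochain k H (n + 1) M M)
    (h : Cochain k H (p + 1) M M) : Cochain k H (m + 1 + n + p + 1) M N :=
  altSum (compFirst (signedPerm (Fin.cycleRange ⟨n + 1, by omega⟩) (circFirst f g))
    (Cochain.toPMap h))

lemma graftComp_neg_left {I J J₀ : Type*} [Fintype I] [DecidableEq I] [Fintype J] [DecidableEq J]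
    [Fintype J₀] [DecidableEq J₀] (G : Graft I J₀ J) (f : PMap k H I M N) (g : PMap k H J₀ M M) :
    graftComp G (-f) g = -graftComp G f g :=
  congr($(map_neg (graftCompLin G) f) g)

lemma coe_cycleRange_symm {N : ℕ} (i j : Fin N) :
    (((Fin.cycleRange i).symm j : Fin N) : ℕ) =
      if (j : ℕ) = 0 then (i : ℕ) else if (j : ℕ) ≤ i then (j : ℕ) - 1 else j := by
  obtain ⟨j, rfl⟩ := (Fin.cycleRange i).surjective j
  have h := coe_cycleRange i j
  rw [Equiv.symm_apply_apply]
  generalize ((Fin.cycleRange i j : Fin N) : ℕ) = v at h ⊢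
  split_ifs at h ⊢ <;> omega

lemma coe_swap_zero_one {N : ℕ} (j : Fin (N + 1 + 1)) :
    ((Equiv.swap 0 1 j : Fin (N + 1 + 1)) : ℕ) =
      if (j : ℕ) = 0 then (1 : ℕ) else if (j : ℕ) = 1 then (0 : ℕ) else (j : ℕ) := by
  rcases eq_or_ne j 0 with rfl | h0
  · simp
  rcases eq_or_ne j 1 with rfl | h1
  · simp
  rw [Equiv.swap_apply_of_ne_of_ne h0 h1, if_neg, if_neg]
  · exact fun h => h1 (Fin.ext h)
  · exact fun h => h0 (Fin.ext h)

/-- The shape of `f (g (⋯), ⋯)` with the second place of `f` moved to the front. -/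
abbrev Graft.cycled (m n : ℕ) : Graft (Fin (m + 1 + 1)) (Fin (n + 1)) (Fin (m + 1 + n + 1)) :=
  (Graft.first (m + 1) n).permute (Fin.cycleRange ⟨n + 1, by omega⟩)

lemma Graft.coe_cycled_e (m n : ℕ) (l : Fin (n + 1)) :
    ((Graft.cycled m n).e l : ℕ) = l + 1 := by
  simp only [Graft.cycled, Graft.permute, Graft.first, Function.comp_apply, coe_cycleRange]
  split_ifs <;> omega

lemma Graft.coe_cycled_τ (m n : ℕ) (j : Fin (m + 1 + n + 1)) :
    ((Graft.cycled m n).τ j : ℕ) =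
      if (j : ℕ) = 0 then 1 else if (j : ℕ) ≤ n + 1 then 0 else j - n := by
  simp only [Graft.cycled, Graft.permute, Graft.first, Function.comp_apply, coe_cycleRange_symm]
  split_ifs <;> omega

/-- Both sides are `f` with `g` at its first and `h` at its second place. On the right `h` is
inserted before `g`: `Equiv.swap 0 1` directs `h` to the second place of `f`, and `blockSwap`
restores the order of the argument blocks. -/
lemma graftComp_cycled {m n p : ℕ} (f : PMap k H (Fin (m + 1 + 1)) M N)
    (g : PMap k H (Fin (n + 1)) M M) (h : PMap k H (Fin (p + 1)) M M) :
    compFirst (graftComp (Graft.cycled m n) f g) h =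
      graftComp ((Graft.first (m + 1 + p) n).permute (blockSwap m n p))
        (graftComp ((Graft.cycled m p).precomp (Equiv.swap 0 1)) f h) g := by
  refine graftComp_comm _ _ _ _ ?_ ?_ ?_ ?_ ?_ ?_ f g h
  · change _ = Equiv.swap 0 1 0
    ext
    rw [Graft.coe_cycled_τ, coe_swap_zero_one]
    rfl
  · change Equiv.swap 0 1 ((Graft.cycled m p).τ 0) = 0
    ext
    rw [coe_swap_zero_one, Graft.coe_cycled_τ]
    simp
  · change (0 : Fin (m + 1 + 1)) ≠ Equiv.swap 0 1 0
    simp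
  · intro x
    obtain ⟨x, rfl⟩ := (blockSwap m n p).surjective x
    change _ = Equiv.swap 0 1 ((Graft.cycled m p).τ ((Graft.first (m + 1 + p) n).τ
      ((blockSwap m n p).symm (blockSwap m n p x))))
    rw [Equiv.symm_apply_apply]
    ext
    have h1 : ((Graft.first (m + 1 + p) n).τ x : ℕ) = x - n := rfl
    have h2 : ((Graft.first (m + 1 + n) p).τ (blockSwap m n p x) : ℕ) =
      (blockSwap m n p x : ℕ) - p := rfl
    have h3 := coe_blockSwap m n p x
    have h4 := Graft.coe_cycled_τ m p ((Graft.first (m + 1 + p) n).τ x)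
    rw [coe_swap_zero_one, Graft.coe_cycled_τ, h2]
    rw [h1] at h4
    generalize ((Graft.cycled m p).τ ((Graft.first (m + 1 + p) n).τ x) : ℕ) = v at h4 ⊢
    generalize (blockSwap m n p x : ℕ) = w at h3 ⊢
    split_ifs at h3 h4 ⊢ <;> omega
  · intro l
    ext
    change p + ((Graft.cycled m n).e l : ℕ) = (blockSwap m n p ⟨l, _⟩ : ℕ)
    rw [Graft.coe_cycled_e, coe_blockSwap]
    simp only
    split_ifs <;> omega
  · intro l
    ext
    change (blockSwap m n p ⟨n + ((Graft.cycled m p).e l : ℕ), _⟩ : ℕ) = l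
    rw [coe_blockSwap]
    simp only [Graft.coe_cycled_e]
    split_ifs <;> omega

/-- Four signs are combined: `(-1)^(n+1)` and `(-1)^(p+1)` from bringing the second place of `f` to
the front on either side, `-1` from exchanging two arguments of the skew-symmetric `f`, and
`(-1)^((n+1)(p+1))` from exchanging the blocks of arguments of `g` and `h`. Their product is
`(-1)^(n p)`. -/
lemma of_parallelSum {m n p : ℕ} (f : Cochain k H (m + 1 + 1) M N) (g : Cochain k H (n + 1) M M)
    (h : Cochain k H (p + 1) M M) :
    Cochains.of (m + 1 + n + p) (parallelSum f g h) =
      (-1 : ℤˣ) ^ (n * p) • Cochains.of (m + 1 + p + n) (parallelSum f h g) := by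
  have hf : PMap.reindex (Equiv.swap 0 1) (Cochain.toPMap f) = - Cochain.toPMap f := by
    rw [reindex_eq_signedPerm, signedPerm_toPMap, Equiv.Perm.sign_swap (by simp)]
    simp
  have hc : ∀ (n : ℕ) (g : Cochain k H (n + 1) M M),
      signedPerm (Fin.cycleRange ⟨n + 1, by omega⟩) (circFirst f g) = (-1 : ℤˣ) ^ (n + 1) •
        graftComp (Graft.cycled m n) (Cochain.toPMap f) (Cochain.toPMap g) := by
    intro n g
    rw [signedPerm_eq_reindex, Fin.sign_cycleRange, circFirst_eq, compFirst, reindex_graftComp]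
  have hu : ∀ (N' : ℕ) (u : ℤˣ) (F : Cochain k H (N' + 1) M N),
      Cochains.of N' (u • F) = u • Cochains.of N' F := by
    intro N' u F
    rw [Units.smul_def, Units.smul_def, map_zsmul]
  rw [parallelSum, parallelSum, hc, hc, compFirst, compFirst, graftComp_units_smul_left,
    graftComp_units_smul_left, altSum_units_smul, altSum_units_smul, ← compFirst,
    graftComp_cycled, ← graftComp_reindex_left, hf, graftComp_neg_left, graftComp_neg_left,
    ← reindex_graftComp, map_neg, hu, hu, map_neg, of_altSum_reindex (by omega),
    finSign_blockSwap, smul_smul, smul_neg, smul_smul]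
  rw [← neg_one_smul ℤ, ← Units.coe_neg_one, ← Units.smul_def, smul_smul]
  congr 1
  rw [← pow_add, ← pow_add, ← pow_succ']
  refine neg_one_pow_congr ?_
  simp only [Nat.even_add, Nat.even_mul, Nat.even_add_one]
  tauto

end PreLie

/-! ### The pre-Lie identity and the graded Jacobi identity -/

section PreLie

variable {k H : Type*} [Field k] [CharZero k] [Ring H] [HopfAlgebra k H] [Coalgebra.IsCocomm k H]
variable {M N : Type*} [AddCommGroup M] [Module k M] [Module H M]
  [AddCommGroup N] [Module k N] [Module H N]

/-- Characteristic 0 enters the pre-Lie identity through this cancellation of factorials. -/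
lemma nsmul_cancel {V : Type*} [AddCommGroup V] [Module k V] {c : ℕ} (hc : c ≠ 0) {x y : V}
    (h : c • x = c • y) : x = y := by
  have hc' : (c : k) ≠ 0 := Nat.cast_ne_zero.2 hc
  rw [← Nat.cast_smul_eq_nsmul k, ← Nat.cast_smul_eq_nsmul k] at h
  exact smul_right_injective V hc' h

/-- The nested composition occurs `n + 1` times in `(f ⊚ g) ⊚ h`, once for each argument of `g`.
Since `(n+1)! = (n+1) n!`, it cancels exactly against `f ⊚ (g ⊚ h)`, and only the insertions of `h`
beside `g` remain. -/
lemma associator_smul {m n p : ℕ} (f : Cochain k H (m + 1) M N) (g : Cochain k H (n + 1) M M)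
    (h : Cochain k H (p + 1) M M) (Y : Cochain k H (m + n + p + 1) M N)
    (hY : ∀ i : Fin m, altSum (compFirst (signedPerm
      (Equiv.swap 0 (blockEquiv m n (Sum.inr i))) (circFirst f g)) (Cochain.toPMap h)) = Y) :
    ((n + 1).factorial * m.factorial * (p + 1).factorial) •
      (Cochains.of (m + n + p) (circ (circ f g) h) -
        Cochains.of (m + (n + p)) (circ f (circ g h))) = m • Cochains.of (m + n + p) Y := by
  have h1 : ((n + 1).factorial * m.factorial * (p + 1).factorial) • circ (circ f g) h =
      (n + 1) • altSum (compFirst (circFirst f g) (Cochain.toPMap h)) + m • Y := by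
    refine nsmul_cancel (k := k) (m + n).factorial_ne_zero ?_
    rw [← sum_altSum_compFirst f g (Cochain.toPMap h) Y hY, ← circFirst_eq,
      ← factorial_smul_circ, smul_smul, smul_smul]
    congr 1
    ring
  have h2 : (m.factorial * n.factorial * (p + 1).factorial) • circ f (circ g h) =
      altSum (compFirst (Cochain.toPMap f)
        (compFirst (Cochain.toPMap g) (Cochain.toPMap h))) := by
    refine nsmul_cancel (k := k) (n + p + 1).factorial_ne_zero ?_
    rw [← factorial_smul_circ_circ_right, smul_smul]
    congr 1
    ring
  have h3 : (n + 1).factorial * m.factorial * (p + 1).factorial =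
      (n + 1) * (m.factorial * n.factorial * (p + 1).factorial) := by
    rw [Nat.factorial_succ]
    ring
  rw [smul_sub, ← map_nsmul (Cochains.of (m + n + p)), h1, h3, mul_smul,
    ← map_nsmul (Cochains.of (m + (n + p))) _ (circ f (circ g h)), h2, map_add,
    map_nsmul (Cochains.of (m + n + p)), map_nsmul (Cochains.of (m + n + p)),
    circFirst_eq, of_altSum_circFirst_circFirst]
  abel

/-- Skew-symmetry of `f` makes the `m + 1` places beside `g` interchangeable, so all of them give
`parallelSum`. -/
lemma associator_smul_succ {m n p : ℕ} (f : Cochain k H (m + 1 + 1) M N)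
    (g : Cochain k H (n + 1) M M) (h : Cochain k H (p + 1) M M) :
    ((n + 1).factorial * (m + 1).factorial * (p + 1).factorial) •
      (Cochains.of (m + 1 + n + p) (circ (circ f g) h) -
        Cochains.of (m + 1 + (n + p)) (circ f (circ g h))) =
      (m + 1) • Cochains.of (m + 1 + n + p) (parallelSum f g h) := by
  refine associator_smul f g h _ fun i => ?_
  -- `b` exchanges the chosen place with the first one after the block of `g`, which is the place
  -- that the cycle in `parallelSum` brings to the front.
  set b := blockPerm (m + 1) n (1, Equiv.swap 0 i) with hb
  have hb1 : b * b = 1 := by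
    rw [hb, ← map_mul, Prod.mk_mul_mk, one_mul, Equiv.swap_mul_self]
    exact map_one _
  have h1 : circFirst f g = signedPerm b (circFirst f g) := (signedPerm_circFirst f g _).symm
  rw [parallelSum]
  conv_lhs => rw [h1, ← signedPerm_mul]
  refine altSum_compFirst_congr ?_ _ _
  rw [Equiv.Perm.inv_eq_iff_eq, Equiv.Perm.mul_apply]
  have h2 : (Fin.cycleRange (⟨n + 1, by omega⟩ : Fin (m + 1 + n + 1)))⁻¹ 0 =
      blockEquiv (m + 1) n (Sum.inr 0) := by
    change (Fin.cycleRange (⟨n + 1, by omega⟩ : Fin (m + 1 + n + 1))).symm 0 = _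
    rw [Fin.cycleRange_symm_zero]
    ext
    rw [blockEquiv_inr]
    simp
  rw [h2, hb, blockPerm_inr, Equiv.swap_apply_left, Equiv.swap_apply_right]

/-- The circle product is right pre-Lie: its associator is graded symmetric in the last two
arguments. -/
lemma associator_symm {m n p : ℕ} (f : Cochain k H (m + 1) M N) (g : Cochain k H (n + 1) M M)
    (h : Cochain k H (p + 1) M M) :
    Cochains.of (m + n + p) (circ (circ f g) h) - Cochains.of (m + (n + p)) (circ f (circ g h)) =
      (-1 : ℤˣ) ^ (n * p) • (Cochains.of (m + p + n) (circ (circ f h) g) -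
        Cochains.of (m + (p + n)) (circ f (circ h g))) := by
  have hc : (n + 1).factorial * m.factorial * (p + 1).factorial =
      (p + 1).factorial * m.factorial * (n + 1).factorial := by ring
  refine nsmul_cancel (k := k) (c := (n + 1).factorial * m.factorial * (p + 1).factorial)
    (by positivity) ?_
  rw [smul_comm, hc]
  cases m with
  | zero =>
    -- A unary `f` has no place beside `g`, so both associators vanish.
    rw [associator_smul f h g 0 (fun i => i.elim0), ← hc,
      associator_smul f g h 0 (fun i => i.elim0)]
    simp
  | succ m =>
    rw [associator_smul_succ f h g, ← hc, associator_smul_succ f g h, of_parallelSum, smul_comm]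

variable (k H M) in
/-- The circle product on `⨁_{n ≥ 0} C^{n+1}(M, M)`. -/
def circTotal : Cochains k H M M →ₗ[k] Cochains k H M M →ₗ[k] Cochains k H M M :=
  Cochains.lift fun m => LinearMap.flip <| Cochains.lift fun n => LinearMap.flip <|
      (circBilin k H M m n).compr₂ (Cochains.of (m + n))

lemma circTotal_of {m n : ℕ} (f : Cochain k H (m + 1) M M) (g : Cochain k H (n + 1) M M) :
    circTotal k H M (Cochains.of m f) (Cochains.of n g) = Cochains.of (m + n) (circ f g) := by
  rw [circTotal, Cochains.lift_of, LinearMap.flip_apply, Cochains.lift_of]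
  rfl

lemma nrBracket_eq_circTotal {m n : ℕ} (f : Cochain k H (m + 1) M M)
    (g : Cochain k H (n + 1) M M) :
    nrBracket k H M (Cochains.of m f) (Cochains.of n g) =
      circTotal k H M (Cochains.of m f) (Cochains.of n g) -
        (-1 : k) ^ (m * n) • circTotal k H M (Cochains.of n g) (Cochains.of m f) := by
  rw [nrBracket_of, circTotal_of, circTotal_of]

lemma units_smul_eq {V : Type*} [AddCommGroup V] [Module k V] (n : ℕ) (v : V) :
    (-1 : ℤˣ) ^ n • v = (-1 : k) ^ n • v := by
  rcases Nat.even_or_odd n with h | h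
  · rw [h.neg_one_pow, h.neg_one_pow, one_smul, one_smul]
  · rw [h.neg_one_pow, h.neg_one_pow, neg_one_smul, Units.neg_smul, one_smul]

/-- The graded Jacobi identity. -/
lemma nrBracket_jacobi {m n p : ℕ} (f : Cochain k H (m + 1) M M) (g : Cochain k H (n + 1) M M)
    (h : Cochain k H (p + 1) M M) :
    nrBracket k H M (Cochains.of m f) (nrBracket k H M (Cochains.of n g) (Cochains.of p h)) =
      nrBracket k H M (nrBracket k H M (Cochains.of m f) (Cochains.of n g)) (Cochains.of p h) +
        (-1 : k) ^ (m * n) • nrBracket k H M (Cochains.of n g)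
          (nrBracket k H M (Cochains.of m f) (Cochains.of p h)) := by
  have key : ∀ {a b c : ℕ} (x : Cochain k H (a + 1) M M) (y : Cochain k H (b + 1) M M)
      (z : Cochain k H (c + 1) M M),
      circTotal k H M (circTotal k H M (Cochains.of a x) (Cochains.of b y)) (Cochains.of c z) -
        circTotal k H M (Cochains.of a x) (circTotal k H M (Cochains.of b y) (Cochains.of c z)) =
      (-1 : k) ^ (b * c) •
        (circTotal k H M (circTotal k H M (Cochains.of a x) (Cochains.of c z)) (Cochains.of b y) -
        circTotal k H M (Cochains.of a x)
          (circTotal k H M (Cochains.of c z) (Cochains.of b y))) := by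
    intro a b c x y z
    simp only [circTotal_of]
    rw [associator_symm, units_smul_eq (k := k)]
  have hl : ∀ {a b c : ℕ} (x : Cochain k H (a + 1) M M) (y : Cochain k H (b + 1) M M)
      (z : Cochain k H (c + 1) M M),
      nrBracket k H M (Cochains.of a x) (circTotal k H M (Cochains.of b y) (Cochains.of c z)) =
        circTotal k H M (Cochains.of a x) (circTotal k H M (Cochains.of b y) (Cochains.of c z)) -
        (-1 : k) ^ (a * (b + c)) • circTotal k H M
          (circTotal k H M (Cochains.of b y) (Cochains.of c z)) (Cochains.of a x) := by
    intro a b c x y z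
    rw [circTotal_of, nrBracket_eq_circTotal]
  have hr : ∀ {a b c : ℕ} (x : Cochain k H (a + 1) M M) (y : Cochain k H (b + 1) M M)
      (z : Cochain k H (c + 1) M M),
      nrBracket k H M (circTotal k H M (Cochains.of a x) (Cochains.of b y)) (Cochains.of c z) =
        circTotal k H M (circTotal k H M (Cochains.of a x) (Cochains.of b y)) (Cochains.of c z) -
        (-1 : k) ^ ((a + b) * c) • circTotal k H M (Cochains.of c z)
          (circTotal k H M (Cochains.of a x) (Cochains.of b y)) := by
    intro a b c x y z
    rw [circTotal_of, nrBracket_eq_circTotal]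
  -- One pre-Lie identity for each choice of the leftmost factor. They eliminate three of the six
  -- products bracketed to the left; the rest is a linear identity between independent terms for
  -- each of the eight patterns of signs.
  have k1 := key f g h
  have k2 := key g f h
  have k3 := key h f g
  rw [nrBracket_eq_circTotal g h, nrBracket_eq_circTotal f g, nrBracket_eq_circTotal f h]
  simp only [map_sub, map_smul, LinearMap.sub_apply, LinearMap.smul_apply, hl, hr]
  generalize Cochains.of m f = x at *
  generalize Cochains.of n g = y at *
  generalize Cochains.of p h = z at *
  rw [sub_eq_iff_eq_add] at k1 k2 k3
  simp only [k1, k2, k3, mul_add, add_mul, pow_add]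
  rcases neg_one_pow_eq_or k (m * n) with h1 | h1 <;>
  rcases neg_one_pow_eq_or k (m * p) with h2 | h2 <;>
  rcases neg_one_pow_eq_or k (n * p) with h3 | h3 <;>
  · simp only [mul_comm n m, mul_comm p m, mul_comm p n, h1, h2, h3, one_smul, neg_smul, mul_one,
      mul_neg, neg_neg, one_mul, sub_neg_eq_add, neg_mul]
    abel

end PreLie

/-! ### The iterated Leibniz rule with signs -/

section Nested

variable {k L V : Type*} [Field k] [AddCommGroup L] [Module k L] [AddCommGroup V] [Module k V]
variable {𝒥 : ℤ → Submodule k L} {br : L →ₗ[k] L →ₗ[k] L}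
variable {ι : Type*} [DecidableEq ι]

lemma map_units_smul {W : Type*} [AddCommGroup W] [Module k W] (f : V →ₗ[k] W) (u : ℤˣ) (x : V) :
    f (u • x) = u • f x := by
  rw [Units.smul_def, Units.smul_def]
  exact map_zsmul f _ x

lemma map_units_smul_left (u : ℤˣ) (x y : L) : br (u • x) y = u • br x y :=
  map_units_smul (br.flip y) u x

/-- The Leibniz rule for the right adjoint action. -/
lemma IsGradedLieAlgebra.leibniz_right (hL : IsGradedLieAlgebra 𝒥 br) {i j l : ℤ} {a b c : L}
    (ha : a ∈ 𝒥 i) (hb : b ∈ 𝒥 j) (hc : c ∈ 𝒥 l) :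
    br (br a b) c = br a (br b c) + (j * l).negOnePow • br (br a c) b := by
  have h1 := hL.jacobi i j l a ha b hb c hc
  have h2 := hL.skew j (i + l) b hb (br a c) (hL.mem i l a ha c hc)
  rw [h2, smul_neg, smul_smul, ← Int.negOnePow_add] at h1
  have h3 : (i * j + j * (i + l)).negOnePow = (j * l).negOnePow := by
    rw [Int.negOnePow_eq_iff]
    exact ⟨i * j, by ring⟩
  rw [h3] at h1
  rw [h1]
  abel

/-- The nested bracket `[⋯[[D, y_{j_r}], y_{j_{r-1}}], ⋯, y_{j_1}]` along a list `[j_1, …, j_r]`. -/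
def nestedList (br : L →ₗ[k] L →ₗ[k] L) (y : ι → L) (D : L) (l : List ι) : L :=
  l.foldr (fun j a => br a (y j)) D

omit [DecidableEq ι] in
lemma nestedList_cons (y : ι → L) (D : L) (a : ι) (l : List ι) :
    nestedList br y D (a :: l) = br (nestedList br y D l) (y a) := rfl

omit [DecidableEq ι] in
lemma nestedList_mem (hL : IsGradedLieAlgebra 𝒥 br) {y : ι → L} {d : ι → ℤ}
    (hy : ∀ j, y j ∈ 𝒥 (d j)) {D : L} {e : ℤ} (hD : D ∈ 𝒥 e) (l : List ι) :
    nestedList br y D l ∈ 𝒥 (e + (l.map d).sum) := by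
  induction l with
  | nil => simpa [nestedList] using hD
  | cons a l ih =>
    have := hL.mem _ _ _ ih _ (hy a)
    rw [nestedList_cons, List.map_cons, List.sum_cons]
    convert this using 2
    ring

/-- The sign of the Leibniz rule: it moves the factors in `S` to the front of those not in `S`
and past an element of degree `e`. -/
def splitSign (d : ι → ℤ) (e : ℤ) (S : Finset ι) : List ι → ℤˣ
  | [] => 1
  | a :: l => (if a ∈ S then (d a * (e + ((l.filter (· ∉ S)).map d).sum)).negOnePow else 1) *
      splitSign d e S l

lemma filter_insert_eq {a : ι} {l : List ι} (ha : a ∉ l) (S : Finset ι) :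
    l.filter (· ∈ insert a S) = l.filter (· ∈ S) := by
  refine List.filter_congr fun x hx => ?_
  have : x ≠ a := fun h => ha (h ▸ hx)
  simp [this]

lemma filter_not_insert_eq {a : ι} {l : List ι} (ha : a ∉ l) (S : Finset ι) :
    l.filter (· ∉ insert a S) = l.filter (· ∉ S) := by
  refine List.filter_congr fun x hx => ?_
  have : x ≠ a := fun h => ha (h ▸ hx)
  simp [this]

lemma splitSign_insert (d : ι → ℤ) (e : ℤ) {a : ι} {l : List ι} (ha : a ∉ l) (S : Finset ι) :
    splitSign d e (insert a S) l = splitSign d e S l := by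
  induction l with
  | nil => rfl
  | cons b l ih =>
    have hb : b ≠ a := fun h => ha (by simp [h])
    have hl : a ∉ l := fun h => ha (by simp [h])
    rw [splitSign, splitSign, ih hl, filter_not_insert_eq hl]
    simp [hb]

/-- The iterated Leibniz rule. -/
lemma nestedList_bracket (hL : IsGradedLieAlgebra 𝒥 br) {y : ι → L} {d : ι → ℤ}
    (hy : ∀ j, y j ∈ 𝒥 (d j)) {D D' : L} {e e' : ℤ} (hD : D ∈ 𝒥 e) (hD' : D' ∈ 𝒥 e')
    (l : List ι) (hl : l.Nodup) :
    nestedList br y (br D D') l = ∑ S ∈ l.toFinset.powerset, splitSign d e' S l •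
      br (nestedList br y D (l.filter (· ∈ S))) (nestedList br y D' (l.filter (· ∉ S))) := by
  induction l with
  | nil => simp [splitSign, nestedList]
  | cons a l ih =>
    rw [List.nodup_cons] at hl
    obtain ⟨ha, hl⟩ := hl
    rw [nestedList_cons, ih hl, List.toFinset_cons,
      Finset.sum_powerset_insert (by simpa using ha), map_sum, LinearMap.sum_apply,
      ← Finset.sum_add_distrib]
    refine Finset.sum_congr rfl fun S hS => ?_
    have haS : a ∉ S := fun h => ha (by simpa using Finset.mem_powerset.1 hS h)
    -- The Leibniz rule sends `a` either to the side of `D'`, the term of `S`, or to the side of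
    -- `D`, the term of `insert a S`.
    rw [map_units_smul_left, hL.leibniz_right (nestedList_mem hL hy hD _)
      (nestedList_mem hL hy hD' _) (hy a), smul_add, splitSign, splitSign, if_neg haS, one_mul,
      if_pos (Finset.mem_insert_self a S), splitSign_insert d e' ha, filter_not_insert_eq ha]
    congr 1
    · rw [List.filter_cons_of_neg (by simpa using haS), List.filter_cons_of_pos (by simpa using haS),
        nestedList_cons]
    · rw [List.filter_cons_of_pos (by simp), filter_insert_eq ha,
        List.filter_cons_of_neg (by simp), filter_not_insert_eq ha, nestedList_cons, smul_smul,
        mul_comm, mul_comm (d a)]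

/-- Moving the innermost bracket out. -/
lemma nestedList_bracket_right (hL : IsGradedLieAlgebra 𝒥 br) {y : ι → L} {d : ι → ℤ}
    (hy : ∀ j, y j ∈ 𝒥 (d j)) {D z : L} {e c : ℤ} (hD : D ∈ 𝒥 e) (hz : z ∈ 𝒥 c)
    (hzy : ∀ j, br z (y j) = 0) (l : List ι) :
    nestedList br y (br D z) l =
      (c * (l.map d).sum).negOnePow • br (nestedList br y D l) z := by
  induction l with
  | nil => simp [nestedList]
  | cons a l ih =>
    rw [nestedList_cons, ih, map_units_smul_left, hL.leibniz_right (nestedList_mem hL hy hD _)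
      hz (hy a), hzy, map_zero, zero_add, smul_smul, ← Int.negOnePow_add, nestedList_cons,
      List.map_cons, List.sum_cons]
    congr 2
    ring

/-- A pair with one member in `S` and one outside is counted in exactly one of the two factors,
according to its order in the list. This gives the product of the two degree sums; passing an
element of degree 1 gives the sums themselves. -/
lemma splitSign_mul_compl [Fintype ι] (d : ι → ℤ) (S : Finset ι) (l : List ι) :
    splitSign d 1 S l * splitSign d 1 Sᶜ l =
      (((l.filter (· ∈ S)).map d).sum + ((l.filter (· ∉ S)).map d).sum +
        ((l.filter (· ∈ S)).map d).sum * ((l.filter (· ∉ S)).map d).sum).negOnePow := by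
  induction l with
  | nil => simp [splitSign]
  | cons a l ih =>
    rw [splitSign, splitSign, mul_mul_mul_comm, ih]
    by_cases ha : a ∈ S
    · rw [if_pos ha, if_neg (by simpa using ha), mul_one, ← Int.negOnePow_add,
        List.filter_cons_of_pos (by simpa using ha), List.filter_cons_of_neg (by simpa using ha),
        List.map_cons, List.sum_cons]
      congr 1
      ring
    · rw [if_neg ha, if_pos (by simpa using ha), one_mul, ← Int.negOnePow_add,
        List.filter_cons_of_neg (by simpa using ha), List.filter_cons_of_pos (by simpa using ha),
        List.map_cons, List.sum_cons]
      have : l.filter (· ∉ Sᶜ) = l.filter (· ∈ S) := List.filter_congr fun x _ => by simp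
      rw [this]
      congr 1
      ring

/-- Splits off the cost of passing the element of degree `e`. The case `e = 0` is a pure reordering
sign, to be compared with the Koszul sign. -/
lemma splitSign_eq (d : ι → ℤ) (e : ℤ) (S : Finset ι) (l : List ι) :
    splitSign d e S l = (e * ((l.filter (· ∈ S)).map d).sum).negOnePow * splitSign d 0 S l := by
  induction l with
  | nil => simp [splitSign]
  | cons a l ih =>
    rw [splitSign, splitSign, ih, ← mul_assoc, ← mul_assoc]
    congr 1
    by_cases ha : a ∈ S
    · rw [if_pos ha, if_pos ha, List.filter_cons_of_pos (by simpa using ha), List.map_cons,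
        List.sum_cons, ← Int.negOnePow_add, ← Int.negOnePow_add]
      congr 1
      ring
    · rw [if_neg ha, if_neg ha, List.filter_cons_of_neg (by simpa using ha), one_mul, mul_one]

end Nested

/-! ### The projected form of `[Δ, Δ] = 0` -/

section DerivedJacobi

variable {k L V : Type*} [Field k] [CharZero k] [AddCommGroup L] [Module k L]
  [AddCommGroup V] [Module k V]
variable {𝒥 : ℤ → Submodule k L} {br : L →ₗ[k] L →ₗ[k] L} {ι : V →ₗ[k] L} {p : L →ₗ[k] V} {Δ : L}

lemma eq_zero_of_add_self {W : Type*} [AddCommGroup W] [Module k W] {x : W} (h : x + x = 0) :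
    x = 0 := by
  rw [← two_smul k] at h
  exact (smul_eq_zero.1 h).resolve_left two_ne_zero

/-- The elements `a - P a` and `b - P b` lie in the kernel of `P`, hence so does their bracket;
expanding it and using `[P a, P b] = 0` leaves the stated terms. -/
lemma IsCurvedVData.proj_bracket (hV : IsCurvedVData 𝒥 br (LinearMap.range ι) (ι ∘ₗ p) Δ)
    (hpι : ∀ v, p (ι v) = v) (a b : L) :
    p (br a b) = p (br (ι (p a)) b) + p (br a (ι (p b))) := by
  have h1 : br (a - ι (p a)) (b - ι (p b)) ∈ LinearMap.ker (ι ∘ₗ p) :=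
    hV.ker.closed _ (by simp [hpι]) _ (by simp [hpι])
  have h2 : br (ι (p a)) (ι (p b)) = 0 := hV.abelian _ ⟨_, rfl⟩ _ ⟨_, rfl⟩
  have h3 : p (br (a - ι (p a)) (b - ι (p b))) = 0 := by
    have := congrArg p (LinearMap.mem_ker.1 h1)
    simpa [hpι] using this
  simp only [map_sub, LinearMap.sub_apply, h2, sub_zero, map_zero] at h3
  rw [sub_sub, sub_eq_zero] at h3
  rw [h3, add_comm]

/-- The sum of all `± P [P Δ_S, Δ_{Sᶜ}]` vanishes. -/
lemma IsCurvedVData.sum_split (hV : IsCurvedVData 𝒥 br (LinearMap.range ι) (ι ∘ₗ p) Δ)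
    (hpι : ∀ v, p (ι v) = v) (hp : ∀ i, ∀ x ∈ 𝒥 i, ι (p x) ∈ 𝒥 i) {T : Type*} [Fintype T]
    [DecidableEq T] {y : T → L} {d : T → ℤ} (hy : ∀ j, y j ∈ 𝒥 (d j)) (l : List T)
    (hl : l.Nodup) (hl' : ∀ j, j ∈ l) :
    ∑ S : Finset T, splitSign d 1 S l • p (br (ι (p (nestedList br y Δ (l.filter (· ∈ S)))))
      (nestedList br y Δ (l.filter (· ∉ S)))) = 0 := by
  have h0 : ∀ l : List T, nestedList br y (br Δ Δ) l = 0 := by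
    intro l
    induction l with
    | nil => exact hV.bracket_self
    | cons a l ih => rw [nestedList_cons, ih, map_zero, LinearMap.zero_apply]
  have h1 := nestedList_bracket hV.gradedLie hy hV.mem_one hV.mem_one l hl
  have h2 : l.toFinset.powerset = Finset.univ := by
    ext S
    simp only [Finset.mem_powerset, Finset.mem_univ, iff_true]
    intro j _
    simpa using hl' j
  rw [h0, h2] at h1
  have h3 := congrArg p h1.symm
  rw [map_sum, map_zero] at h3
  rw [Finset.sum_congr rfl fun S _ => show p (splitSign d 1 S l • br _ _) = _ by
    rw [map_units_smul, hV.proj_bracket hpι, smul_add], Finset.sum_add_distrib] at h3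
  -- The two halves of `h3` are exchanged by `S ↦ Sᶜ`, so twice the wanted sum vanishes.
  refine eq_zero_of_add_self (k := k) ?_
  convert h3 using 2
  refine Fintype.sum_equiv (Equiv.mk compl compl compl_compl compl_compl) _ _ fun S => ?_
  have e1 : l.filter (· ∉ Sᶜ) = l.filter (· ∈ S) := List.filter_congr fun x _ => by simp
  have e2 : l.filter (· ∈ Sᶜ) = l.filter (· ∉ S) := List.filter_congr fun x _ => by simp
  simp only [Equiv.coe_fn_mk]
  rw [e1, e2, hV.gradedLie.skew _ _ _ (nestedList_mem hV.gradedLie hy hV.mem_one _) _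
    (hp _ _ (nestedList_mem hV.gradedLie hy hV.mem_one (l.filter (· ∈ S)))), map_neg,
    map_units_smul, smul_neg, smul_smul]
  have e3 := splitSign_mul_compl d S l
  have e4 : splitSign d 1 Sᶜ l = splitSign d 1 S l *
      (((l.filter (· ∈ S)).map d).sum + ((l.filter (· ∉ S)).map d).sum +
        ((l.filter (· ∈ S)).map d).sum * ((l.filter (· ∉ S)).map d).sum).negOnePow := by
    rw [← e3, ← mul_assoc, Int.units_mul_self, one_mul]
  rw [e4, mul_assoc, ← Int.negOnePow_add, mul_smul, ← smul_neg]
  congr 1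
  rw [Int.negOnePow_odd, Units.neg_smul, one_smul, neg_neg]
  generalize ((l.filter (· ∈ S)).map d).sum = u
  generalize ((l.filter (· ∉ S)).map d).sum = v
  -- The exponents are `u + v + u v` from the complementary split and `(1 + u)(1 + v)` from
  -- skew-symmetry. Their sum is odd and compensates the minus sign of skew-symmetry.
  exact ⟨u + v + u * v, by ring⟩

end DerivedJacobi

/-! ### Nested brackets along lists -/

section ListForm

variable {k L : Type*} [Field k] [AddCommGroup L] [Module k L] {br : L →ₗ[k] L →ₗ[k] L}

lemma nestedList_map {ι ι' : Type*} (y : ι → L) (D : L) (φ : ι' → ι) (l : List ι') :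
    nestedList br y D (l.map φ) = nestedList br (y ∘ φ) D l := by
  rw [nestedList, List.foldr_map]
  rfl

/-- The list is reversed because the head of a list is the outermost bracket. -/
lemma nestedBracket_eq_nestedList (D : L) (n : ℕ) (y : Fin n → L) :
    nestedBracket br D n y = nestedList br y D (List.finRange n).reverse := by
  induction n with
  | zero => simp [nestedList]
  | succ n ih =>
    rw [nestedBracket_succ, ih, List.finRange_succ_last, List.reverse_append,
      List.reverse_singleton, List.singleton_append, nestedList_cons, ← List.map_reverse,
      nestedList_map]
    rfl

/-- The recursion removes the outermost bracket, whereas here the innermost one is absorbed into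
`D`. This serves for the inner operation in the higher Jacobi identity, which occupies the first
argument. -/
lemma nestedBracket_cons (D z : L) (n : ℕ) (y : Fin n → L) :
    nestedBracket br D (n + 1) (Fin.cons z y) = nestedBracket br (br D z) n y := by
  rw [nestedBracket_eq_nestedList, nestedBracket_eq_nestedList, List.finRange_succ,
    List.reverse_cons, nestedList, List.foldr_append, ← List.map_reverse]
  change nestedList br _ (br D z) _ = _
  rw [nestedList_map]
  congr 1

lemma map_finRange_eq_filter {i n : ℕ} (φ : Fin i → Fin n) (hφ : StrictMono φ)
    (S : Finset (Fin n)) (hS : ∀ a, a ∈ S ↔ ∃ b, φ b = a) :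
    (List.finRange i).map φ = (List.finRange n).filter (· ∈ S) := by
  refine List.SortedLT.eq_of_mem_iff ?_ ?_ ?_
  · exact (List.Pairwise.map φ (fun a b h => hφ h) (List.pairwise_lt_finRange i)).sortedLT
  · exact ((List.pairwise_lt_finRange n).filter _).sortedLT
  · intro a
    simp [hS]

/-- An increasing map lists its image in order, so the arguments in one block of a shuffle become a
filtered list as in the iterated Leibniz rule. -/
lemma nestedBracket_comp {i n : ℕ} (D : L) (y : Fin n → L) (φ : Fin i → Fin n)
    (hφ : StrictMono φ) (S : Finset (Fin n)) (hS : ∀ a, a ∈ S ↔ ∃ b, φ b = a) :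
    nestedBracket br D i (y ∘ φ) =
      nestedList br y D ((List.finRange n).reverse.filter (· ∈ S)) := by
  rw [nestedBracket_eq_nestedList, ← nestedList_map, List.map_reverse,
    map_finRange_eq_filter φ hφ S hS, List.filter_reverse]

end ListForm

/-! ### Shuffles as subsets, and their Koszul signs -/

section Shuffles

variable {n : ℕ}

/-- The image of `{0, …, i - 1}` under a permutation. -/
def firstBlock (i : ℕ) (σ : Equiv.Perm (Fin n)) : Finset (Fin n) :=
  Finset.univ.filter fun a => (σ⁻¹ a : ℕ) < i

lemma mem_firstBlock {i : ℕ} {σ : Equiv.Perm (Fin n)} {a : Fin n} :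
    a ∈ firstBlock i σ ↔ (σ⁻¹ a : ℕ) < i := by
  simp [firstBlock]

lemma apply_mem_firstBlock {i : ℕ} {σ : Equiv.Perm (Fin n)} {a : Fin n} :
    σ a ∈ firstBlock i σ ↔ (a : ℕ) < i := by
  simp [mem_firstBlock]

lemma card_firstBlock {i : ℕ} (hi : i ≤ n) (σ : Equiv.Perm (Fin n)) :
    (firstBlock i σ).card = i := by
  have : firstBlock i σ = (Finset.univ : Finset (Fin i)).map
      ((Fin.castLEEmb hi).trans σ.toEmbedding) := by
    ext a
    obtain ⟨a, rfl⟩ := σ.surjective a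
    rw [apply_mem_firstBlock]
    simp only [Finset.mem_map, Finset.mem_univ, true_and, Function.Embedding.trans_apply,
      Equiv.coe_toEmbedding, EmbeddingLike.apply_eq_iff_eq]
    exact ⟨fun h => ⟨⟨a, h⟩, rfl⟩, by rintro ⟨b, rfl⟩; exact b.2⟩
  rw [this]
  simp

lemma mem_shuffles {i : ℕ} {σ : Equiv.Perm (Fin n)} : σ ∈ shuffles i n ↔
    (∀ a b : Fin n, a < b → (b : ℕ) < i → σ a < σ b) ∧
    (∀ a b : Fin n, i ≤ (a : ℕ) → a < b → σ a < σ b) := by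
  simp [shuffles]

/-- On each block a shuffle is the unique increasing enumeration of its image. -/
lemma shuffle_ext {i : ℕ} (hi : i ≤ n) {σ σ' : Equiv.Perm (Fin n)} (h : σ ∈ shuffles i n)
    (h' : σ' ∈ shuffles i n) (e : firstBlock i σ = firstBlock i σ') : σ = σ' := by
  rw [mem_shuffles] at h h'
  ext1 a
  rcases lt_or_ge (a : ℕ) i with ha | ha
  · have h1 : (fun b : Fin i => σ ⟨b, by omega⟩) = (firstBlock i σ).orderEmbOfFin
        (card_firstBlock hi σ) := by
      refine Finset.orderEmbOfFin_unique _ (fun b => ?_) fun b c hbc => h.1 _ _ hbc c.2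
      exact apply_mem_firstBlock.2 b.2
    have h2 : (fun b : Fin i => σ' ⟨b, by omega⟩) = (firstBlock i σ).orderEmbOfFin
        (card_firstBlock hi σ) := by
      refine Finset.orderEmbOfFin_unique _ (fun b => ?_) fun b c hbc => h'.1 _ _ hbc c.2
      rw [e]
      exact apply_mem_firstBlock.2 b.2
    exact congrFun (h1.trans h2.symm) ⟨a, ha⟩
  · have hc : ((firstBlock i σ)ᶜ).card = n - i := by
      rw [Finset.card_compl, card_firstBlock hi, Fintype.card_fin]
    have h1 : (fun b : Fin (n - i) => σ ⟨i + b, by omega⟩) =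
        ((firstBlock i σ)ᶜ).orderEmbOfFin hc := by
      refine Finset.orderEmbOfFin_unique _ (fun b => ?_) fun b c hbc => h.2 _ _ ?_ ?_
      · rw [Finset.mem_compl, apply_mem_firstBlock]
        exact not_lt.2 (Nat.le_add_right i b)
      · exact Nat.le_add_right i b
      · exact Nat.add_lt_add_left hbc i
    have h2 : (fun b : Fin (n - i) => σ' ⟨i + b, by omega⟩) =
        ((firstBlock i σ)ᶜ).orderEmbOfFin hc := by
      refine Finset.orderEmbOfFin_unique _ (fun b => ?_) fun b c hbc => h'.2 _ _ ?_ ?_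
      · rw [Finset.mem_compl, e, apply_mem_firstBlock]
        exact not_lt.2 (Nat.le_add_right i b)
      · exact Nat.le_add_right i b
      · exact Nat.add_lt_add_left hbc i
    have h3 := congrFun (h1.trans h2.symm) ⟨(a : ℕ) - i, by omega⟩
    have h4 : (⟨i + ((a : ℕ) - i), by omega⟩ : Fin n) = a := by
      ext
      simp only
      omega
    simpa only [h4] using h3

/-- The shuffle enumerates `S` in increasing order, followed by its complement. -/
lemma exists_shuffle_firstBlock (S : Finset (Fin n)) :
    ∃ σ ∈ shuffles S.card n, firstBlock S.card σ = S := by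
  have hle : S.card ≤ n := by simpa using S.card_le_univ
  have hc : (Sᶜ).card = n - S.card := by rw [Finset.card_compl, Fintype.card_fin]
  let E : Fin S.card ⊕ Fin (n - S.card) ≃ Fin n := finSumFinEquiv.trans (finCongr (by omega))
  let σ : Equiv.Perm (Fin n) := E.symm.trans (finSumEquivOfFinset rfl hc)
  have hE1 : ∀ b, ((E (Sum.inl b) : Fin n) : ℕ) = b := fun b => rfl
  have hE2 : ∀ b, ((E (Sum.inr b) : Fin n) : ℕ) = S.card + b := fun b => rfl
  have hσ1 : ∀ b, σ (E (Sum.inl b)) = S.orderEmbOfFin rfl b := fun b => by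
    simp [σ]
  have hσ2 : ∀ b, σ (E (Sum.inr b)) = (Sᶜ).orderEmbOfFin hc b := fun b => by
    simp [σ]
  refine ⟨σ, mem_shuffles.2 ⟨fun a b hab hb => ?_, fun a b ha hab => ?_⟩, ?_⟩
  · obtain ⟨a | a, rfl⟩ := E.surjective a <;> obtain ⟨b | b, rfl⟩ := E.surjective b <;>
      rw [Fin.lt_def] at hab <;> simp only [hE1, hE2] at hab hb
    · rw [hσ1, hσ1]
      exact (S.orderEmbOfFin rfl).strictMono hab
    all_goals omega
  · obtain ⟨a | a, rfl⟩ := E.surjective a <;> obtain ⟨b | b, rfl⟩ := E.surjective b <;>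
      rw [Fin.lt_def] at hab <;> simp only [hE1, hE2] at hab ha
    · omega
    · omega
    · omega
    · rw [hσ2, hσ2]
      exact ((Sᶜ).orderEmbOfFin hc).strictMono (Fin.lt_def.2 (by omega))
  · ext a
    obtain ⟨a, rfl⟩ := σ.surjective a
    rw [apply_mem_firstBlock]
    obtain ⟨a | a, rfl⟩ := E.surjective a
    · rw [hE1, hσ1]
      simp
    · rw [hE2, hσ2]
      have := (Sᶜ).orderEmbOfFin_mem hc a
      rw [Finset.mem_compl] at this
      simp [this]

/-- Shuffles correspond to subsets. -/
lemma sum_shuffles_firstBlock {W : Type*} [AddCommMonoid W] (g : Finset (Fin n) → W) :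
    ∑ i : Fin (n + 1), ∑ σ ∈ shuffles i n, g (firstBlock i σ) = ∑ S, g S := by
  rw [Finset.sum_sigma']
  refine Finset.sum_bij (fun x _ => firstBlock x.1 x.2) (fun _ _ => Finset.mem_univ _) ?_ ?_
    (fun _ _ => rfl)
  · rintro ⟨i, σ⟩ h ⟨i', σ'⟩ h' e
    simp only [Finset.mem_sigma, Finset.mem_univ, true_and] at h h' e
    have e1 : (i : ℕ) = i' := by
      rw [← card_firstBlock (Nat.lt_succ_iff.1 i.2) σ, e,
        card_firstBlock (Nat.lt_succ_iff.1 i'.2)]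
    obtain rfl : i = i' := Fin.ext e1
    rw [shuffle_ext (Nat.lt_succ_iff.1 i.2) h h' e]
  · intro S _
    obtain ⟨σ, h1, h2⟩ := exists_shuffle_firstBlock S
    have hle : S.card ≤ n := by simpa using S.card_le_univ
    exact ⟨⟨⟨S.card, by omega⟩, σ⟩, by simpa using h1, h2⟩

/-- In a decreasing list the entries after `a` are the smaller ones, so the recursive sign counts
the pairs `b < a` with `a` in `S` and `b` outside. -/
lemma splitSign_eq_prod (d : Fin n → ℤ) (S : Finset (Fin n)) (l : List (Fin n))
    (hl : l.Pairwise (· > ·)) : splitSign d 0 S l = ∏ a ∈ l.toFinset, ∏ b ∈ l.toFinset,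
      if a ∈ S ∧ b ∉ S ∧ b < a then (d a * d b).negOnePow else 1 := by
  induction l with
  | nil => simp [splitSign]
  | cons a l ih =>
    rw [List.pairwise_cons] at hl
    have ha : a ∉ l.toFinset := fun h => lt_irrefl _ (hl.1 a (by simpa using h))
    have key : ∀ l : List (Fin n), l.Nodup → (d a * ((l.filter (· ∉ S)).map d).sum).negOnePow =
        ∏ b ∈ l.toFinset, if b ∉ S then (d a * d b).negOnePow else 1 := by
      intro l hl
      induction l with
      | nil => simp
      | cons b l ih =>
        rw [List.nodup_cons] at hl
        rw [List.toFinset_cons, Finset.prod_insert (by simpa using hl.1), ← ih hl.2]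
        by_cases hb : b ∈ S
        · rw [List.filter_cons_of_neg (by simpa using hb), if_neg (by simpa using hb), one_mul]
        · rw [List.filter_cons_of_pos (by simpa using hb), if_pos hb, List.map_cons,
            List.sum_cons, mul_add, Int.negOnePow_add]
    rw [splitSign, ih hl.2, List.toFinset_cons, Finset.prod_insert ha, Finset.prod_insert ha]
    congr 1
    · rw [if_neg (show ¬(a ∈ S ∧ a ∉ S ∧ a < a) from fun h => lt_irrefl _ h.2.2), one_mul]
      by_cases haS : a ∈ S
      · rw [if_pos haS, zero_add, key l (hl.2.imp fun h => ne_of_gt h)]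
        refine Finset.prod_congr rfl fun b hb => ?_
        have : b < a := hl.1 b (by simpa using hb)
        simp [haS, this]
      · simp [haS]
    · refine Finset.prod_congr rfl fun a' ha' => ?_
      have : ¬ a < a' := (hl.1 a' (by simpa using ha')).not_gt
      rw [Finset.prod_insert ha, if_neg (by simp [this]), one_mul]

/-- A shuffle has no inversion within a block, so each of its inversions has one position in the
first block and the other in the second. -/
lemma koszulSign_eq_splitSign (d : Fin n → ℤ) {i : ℕ} {σ : Equiv.Perm (Fin n)}
    (h : σ ∈ shuffles i n) :
    koszulSign σ d = splitSign d 0 (firstBlock i σ) (List.finRange n).reverse := by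
  rw [splitSign_eq_prod d _ _ (by
    rw [List.pairwise_reverse]
    exact List.pairwise_lt_finRange n)]
  have : (List.finRange n).reverse.toFinset = Finset.univ := by
    ext
    simp
  rw [this, ← Equiv.prod_comp σ, koszulSign]
  refine Finset.prod_congr rfl fun a _ => ?_
  rw [← Equiv.prod_comp σ fun b => if σ a ∈ firstBlock i σ ∧ b ∉ firstBlock i σ ∧ b < σ a then
    (d (σ a) * d b).negOnePow else 1]
  refine Finset.prod_congr rfl fun b _ => ?_
  rw [mem_shuffles] at h
  refine if_congr ?_ rfl rfl
  rw [apply_mem_firstBlock, apply_mem_firstBlock]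
  constructor
  · rintro ⟨hab, hba⟩
    refine ⟨?_, ?_, hba⟩
    · by_contra hc
      exact (h.2 a b (not_lt.1 hc) hab).not_gt hba
    · intro hc
      exact (h.1 a b hab hc).not_gt hba
  · rintro ⟨ha, hb, hba⟩
    refine ⟨?_, hba⟩
    rw [Fin.lt_def]
    omega

end Shuffles

/-! ### The Koszul sign under adjacent transpositions -/

section KoszulSign

variable {n : ℕ}

lemma koszulSign_one (d : Fin n → ℤ) : koszulSign 1 d = 1 := by
  refine Finset.prod_eq_one fun i _ => Finset.prod_eq_one fun j _ => if_neg ?_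
  rintro ⟨h1, h2⟩
  exact lt_asymm h1 h2

/-- An adjacent transposition changes the order of one pair of positions only, and of the two orders
of this pair exactly one is an inversion. -/
lemma koszulSign_mul_swap (σ : Equiv.Perm (Fin (n + 1))) (d : Fin (n + 1) → ℤ) (i : Fin n) :
    koszulSign (σ * Equiv.swap i.castSucc i.succ) d =
      (d (σ i.castSucc) * d (σ i.succ)).negOnePow * koszulSign σ d := by
  set a := i.castSucc with ha
  set b := i.succ with hb
  have hab : a < b := Fin.castSucc_lt_succ
  have hne : a ≠ b := hab.ne
  set τ := Equiv.swap a b with hτ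
  set F : Fin (n + 1) → Fin (n + 1) → ℤˣ := fun x y =>
    if x < y ∧ σ y < σ x then (d (σ x) * d (σ y)).negOnePow else 1 with hF
  set F' : Fin (n + 1) → Fin (n + 1) → ℤˣ := fun x y =>
    if τ x < τ y ∧ σ y < σ x then (d (σ x) * d (σ y)).negOnePow else 1 with hF'
  have h1 : koszulSign (σ * τ) d = ∏ x, ∏ y, F' x y := by
    rw [koszulSign, ← Equiv.prod_comp τ]
    refine Finset.prod_congr rfl fun x _ => ?_
    rw [← Equiv.prod_comp τ]
    refine Finset.prod_congr rfl fun y _ => ?_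
    simp only [Equiv.Perm.mul_apply, hF', hτ, Equiv.swap_apply_self]
  have hlt : ∀ x y, ¬ (x = a ∧ y = b) → ¬ (x = b ∧ y = a) → (τ x < τ y ↔ x < y) := by
    intro x y h1 h2
    have hv : ∀ z, ((τ z : Fin (n + 1)) : ℕ) =
        if (z : ℕ) = i then (i : ℕ) + 1 else if (z : ℕ) = i + 1 then (i : ℕ) else z := by
      intro z
      rw [hτ, Equiv.swap_apply_def]
      simp only [Fin.ext_iff, ha, hb, Fin.val_castSucc, Fin.val_succ]
      split_ifs <;> simp
    rw [Fin.lt_def, Fin.lt_def, hv, hv]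
    simp only [Fin.ext_iff, ha, hb, Fin.val_castSucc, Fin.val_succ] at h1 h2
    split_ifs <;> omega
  -- Off the pairs `(a, b)` and `(b, a)` the two factors coincide, and a unit of `ℤ` squares to 1.
  have h2 : ∀ x y, F' x y * F x y =
      (if x = a then if y = b then
        if σ b < σ a then (d (σ a) * d (σ b)).negOnePow else 1 else 1 else 1) *
      (if x = b then if y = a then
        if σ a < σ b then (d (σ a) * d (σ b)).negOnePow else 1 else 1 else 1) := by
    intro x y
    by_cases hx : x = a ∧ y = b
    · obtain ⟨rfl, rfl⟩ := hx
      simp [hF, hF', hτ, hab, hab.not_gt, hne]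
    by_cases hy : x = b ∧ y = a
    · obtain ⟨rfl, rfl⟩ := hy
      simp [hF, hF', hτ, hab, hab.not_gt, hne.symm, mul_comm (d (σ b))]
    have e1 : F' x y = F x y := by
      simp only [hF, hF', hlt x y hx hy]
    rw [e1, Int.units_mul_self]
    rw [not_and] at hx hy
    by_cases h3 : x = a
    · simp [h3, hx h3, hne]
    · by_cases h4 : x = b
      · simp [h4, hy h4, hne.symm]
      · simp [h3, h4]
  have h3 : koszulSign (σ * τ) d * koszulSign σ d = (d (σ a) * d (σ b)).negOnePow := by
    rw [h1, koszulSign, ← Finset.prod_mul_distrib]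
    simp only [← Finset.prod_mul_distrib]
    rw [Finset.prod_congr rfl fun x _ => Finset.prod_congr rfl fun y _ => h2 x y]
    simp only [Finset.prod_mul_distrib]
    rw [Finset.prod_eq_single a (fun x _ hx => by simp [hx]) (by simp),
      Finset.prod_eq_single b (fun x _ hx => by simp [hx]) (by simp)]
    simp only [if_true]
    rw [Finset.prod_eq_single b (fun x _ hx => by simp [hx]) (by simp),
      Finset.prod_eq_single a (fun x _ hx => by simp [hx]) (by simp)]
    simp only [if_true]
    rcases lt_or_gt_of_ne (fun h => hne (σ.injective h) : σ a ≠ σ b) with h | h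
    · simp [h, h.not_gt]
    · simp [h, h.not_gt]
  rw [← h3, mul_assoc, Int.units_mul_self, mul_one]

end KoszulSign

/-! ### Curved `L∞`-algebras from curved V-data -/

section CurvedLInfty

variable {k L V : Type*} [Field k] [CharZero k] [AddCommGroup L] [Module k L]
  [AddCommGroup V] [Module k V]
variable {𝒥 : ℤ → Submodule k L} {𝒱 : ℤ → Submodule k V}
variable {br : L →ₗ[k] L →ₗ[k] L} {ι : V →ₗ[k] L} {p : L →ₗ[k] V} {Δ : L}

lemma nestedBracket_mem (hL : IsGradedLieAlgebra 𝒥 br) {n : ℕ} {y : Fin n → L} {d : Fin n → ℤ}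
    (hy : ∀ j, y j ∈ 𝒥 (d j)) {D : L} {e : ℤ} (hD : D ∈ 𝒥 e) :
    nestedBracket br D n y ∈ 𝒥 (∑ i, d i + e) := by
  rw [nestedBracket_eq_nestedList]
  convert nestedList_mem hL hy hD (List.finRange n).reverse using 2
  rw [add_comm, List.map_reverse, List.sum_reverse, ← List.ofFn_eq_map, List.sum_ofFn]

/-- Exchanging two neighbouring arguments that commute. -/
lemma nestedBracket_swap (hL : IsGradedLieAlgebra 𝒥 br) {n : ℕ} {D : L} {e : ℤ} (hD : D ∈ 𝒥 e)
    {y : Fin (n + 1) → L} {d : Fin (n + 1) → ℤ} (hy : ∀ j, y j ∈ 𝒥 (d j))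
    (hc : ∀ i j, br (y i) (y j) = 0) (i : Fin n) :
    nestedBracket br D (n + 1) (y ∘ Equiv.swap i.castSucc i.succ) =
      (d i.castSucc * d i.succ).negOnePow • nestedBracket br D (n + 1) y := by
  induction n with
  | zero => exact i.elim0
  | succ n ih =>
    rcases Fin.eq_castSucc_or_eq_last i with ⟨i, rfl⟩ | rfl
    · have h1 : Fin.init (y ∘ Equiv.swap i.castSucc.castSucc i.castSucc.succ) =
          Fin.init y ∘ Equiv.swap i.castSucc i.succ := by
        ext j
        simp only [Fin.init, Function.comp_apply]
        congr 1
        rw [← Fin.castSucc_succ, Equiv.swap_apply_def, Equiv.swap_apply_def]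
        simp only [Fin.castSucc_inj]
        split_ifs <;> rfl
      have h2 : (y ∘ Equiv.swap i.castSucc.castSucc i.castSucc.succ) (Fin.last (n + 1)) =
          y (Fin.last (n + 1)) := by
        rw [Function.comp_apply, Equiv.swap_apply_of_ne_of_ne]
        · exact (Fin.castSucc_lt_last _).ne'
        · rw [Fin.succ_castSucc]
          exact (Fin.castSucc_lt_last _).ne'
      have h3 := ih (y := Fin.init y) (fun j => hy j.castSucc) (fun _ _ => hc _ _) i
      rw [nestedBracket_succ _ _ (n + 1), nestedBracket_succ _ _ (n + 1), h1, h2, h3,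
        map_units_smul_left]
      rfl
    · have h1 : Fin.init (Fin.init
          (y ∘ Equiv.swap (Fin.last n).castSucc (Fin.last n).succ)) = Fin.init (Fin.init y) := by
        ext j
        simp only [Fin.init, Function.comp_apply]
        rw [Equiv.swap_apply_of_ne_of_ne]
        · exact fun h => (Fin.castSucc_lt_last j).ne (Fin.castSucc_injective _ h)
        · rw [Fin.succ_last]
          exact (Fin.castSucc_lt_last _).ne
      have h3 : (Fin.last n).succ = Fin.last (n + 1) := Fin.succ_last n
      rw [nestedBracket_succ, nestedBracket_succ, nestedBracket_succ, nestedBracket_succ, h1]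
      simp only [Fin.init, Function.comp_apply, h3, Equiv.swap_apply_left, Equiv.swap_apply_right]
      have hm := nestedBracket_mem hL (y := Fin.init (Fin.init y))
        (d := fun j => d j.castSucc.castSucc) (fun j => hy _) hD
      have := hL.leibniz_right hm (hy (Fin.last (n + 1))) (hy (Fin.last n).castSucc)
      rw [hc, map_zero, zero_add, mul_comm] at this
      exact this

lemma derivedBracket_apply (n : ℕ) (x : Fin n → V) :
    derivedBracket br Δ ι p n x = p (nestedBracket br Δ n (ι ∘ x)) := rfl

/-- Adjacent transpositions generate the symmetric group, and for them the claim is the Leibniz rule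
with the term `[ι v, ι w]` equal to zero. -/
lemma derivedBracket_comp_perm (hL : IsGradedLieAlgebra 𝒥 br) {e : ℤ} (hΔ : Δ ∈ 𝒥 e)
    (hι : ∀ i, ∀ v ∈ 𝒱 i, ι v ∈ 𝒥 i) (hc : ∀ v w, br (ι v) (ι w) = 0) {n : ℕ}
    (d : Fin n → ℤ) (x : Fin n → V) (hx : ∀ i, x i ∈ 𝒱 (d i)) (σ : Equiv.Perm (Fin n)) :
    derivedBracket br Δ ι p n (x ∘ σ) = koszulSign σ d • derivedBracket br Δ ι p n x := by
  cases n with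
  | zero =>
    have : σ = 1 := Subsingleton.elim _ _
    rw [this, koszulSign_one, one_smul]
    rfl
  | succ n =>
    have hσ : σ ∈ Submonoid.closure
        (Set.range fun i : Fin n => Equiv.swap i.castSucc i.succ) := by
      rw [Equiv.Perm.mclosure_swap_castSucc_succ]
      trivial
    induction hσ using Submonoid.closure_induction_right with
    | one =>
      rw [koszulSign_one, one_smul]
      rfl
    | mul_right σ _ τ hτ ih =>
      obtain ⟨i, rfl⟩ := hτ
      have := nestedBracket_swap hL hΔ (y := ι ∘ x ∘ σ) (d := d ∘ σ)
        (fun j => hι _ _ (hx (σ j))) (fun _ _ => hc _ _) i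
      rw [koszulSign_mul_swap, mul_smul, ← ih, derivedBracket_apply, derivedBracket_apply,
        ← map_units_smul]
      exact congrArg p this

/-- A curved V-datum induces a curved `L∞`-algebra structure. -/
theorem IsCurvedVData.isCurvedLInfty
    (hV : IsCurvedVData 𝒥 br (LinearMap.range ι) (ι ∘ₗ p) Δ) (hpι : ∀ v, p (ι v) = v)
    (h𝒱 : DirectSum.IsInternal 𝒱) (hι : ∀ i, ∀ v ∈ 𝒱 i, ι v ∈ 𝒥 i)
    (hp : ∀ i, ∀ x ∈ 𝒥 i, p x ∈ 𝒱 i) :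
    IsCurvedLInfty 𝒱 (derivedBracket br Δ ι p) := by
  have hL := hV.gradedLie
  have hc : ∀ v w, br (ι v) (ι w) = 0 := fun v w => hV.abelian _ ⟨_, rfl⟩ _ ⟨_, rfl⟩
  refine ⟨h𝒱, fun n d x hx => hp _ _ (nestedBracket_mem hL (fun j => hι _ _ (hx j)) hV.mem_one),
    fun n d x hx σ => derivedBracket_comp_perm hL hV.mem_one hι hc d x hx σ,
    fun n d x hx => ?_⟩
  set y := ι ∘ x with hy'
  have hy : ∀ j, y j ∈ 𝒥 (d j) := fun j => hι _ _ (hx j)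
  set l := (List.finRange n).reverse with hl
  -- This is the higher Jacobi identity as a sum over subsets; it remains to match the term of each
  -- subset with that of its shuffle.
  have hsum := hV.sum_split hpι (fun i x hx => hι _ _ (hp _ _ hx)) hy l
    (List.nodup_reverse.2 (List.nodup_finRange n)) (fun j => by simp [hl])
  rw [← hsum, ← sum_shuffles_firstBlock]
  refine Finset.sum_congr rfl fun i _ => Finset.sum_congr rfl fun σ hσ => ?_
  have hσ' := mem_shuffles.1 hσ
  set S := firstBlock (i : ℕ) σ with hS
  have hi : (i : ℕ) ≤ n := Nat.lt_succ_iff.1 i.2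
  have e1 : nestedBracket br Δ i (ι ∘ fun a : Fin i => x (σ ⟨a, by omega⟩)) =
      nestedList br y Δ (l.filter (· ∈ S)) := by
    refine nestedBracket_comp Δ y (fun a : Fin i => σ ⟨a, by omega⟩) ?_ S ?_
    · exact fun a b hab => hσ'.1 _ _ hab b.2
    · intro a
      rw [hS, mem_firstBlock]
      constructor
      · exact fun h => ⟨⟨_, h⟩, by simp⟩
      · rintro ⟨b, rfl⟩
        simp
  -- Here `D` is kept free because it will be the bracket of `Δ` with the value of the inner
  -- operation.
  have e2 : ∀ D, nestedBracket br D (n - i) (ι ∘ fun b : Fin (n - i) => x (σ ⟨i + b, by omega⟩)) =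
      nestedList br y D (l.filter (· ∉ S)) := by
    intro D
    have hf : l.filter (· ∉ S) = l.filter (· ∈ Sᶜ) :=
      List.filter_congr fun x _ => by simp
    rw [hf]
    refine nestedBracket_comp D y (fun b : Fin (n - i) => σ ⟨i + b, by omega⟩) ?_ Sᶜ ?_
    · exact fun a b hab => hσ'.2 _ _ (Nat.le_add_right _ _) (Nat.add_lt_add_left hab i)
    · intro a
      rw [Finset.mem_compl, hS, mem_firstBlock]
      constructor
      · intro h
        refine ⟨⟨(σ⁻¹ a : ℕ) - i, by omega⟩, ?_⟩
        have : (⟨i + ((σ⁻¹ a : ℕ) - i), by omega⟩ : Fin n) = σ⁻¹ a := by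
          ext
          simp only
          omega
        simp only [this]
        simp
      · rintro ⟨b, rfl⟩
        simp
  set E := nestedList br y Δ (l.filter (· ∈ S)) with hE
  have hEm : E ∈ 𝒥 (1 + ((l.filter (· ∈ S)).map d).sum) := nestedList_mem hL hy hV.mem_one _
  have hzm : ι (p E) ∈ 𝒥 (1 + ((l.filter (· ∈ S)).map d).sum) := hι _ _ (hp _ _ hEm)
  have e3 : derivedBracket br Δ ι p (n - i + 1) (Fin.cons
        (derivedBracket br Δ ι p i fun a : Fin i => x (σ ⟨a, by omega⟩))
        (fun b : Fin (n - i) => x (σ ⟨i + b, by omega⟩))) =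
      p (nestedBracket br (br Δ (ι (p E))) (n - i)
        (ι ∘ fun b : Fin (n - i) => x (σ ⟨i + b, by omega⟩))) := by
    rw [derivedBracket_apply, derivedBracket_apply, e1, ← nestedBracket_cons]
    congr 2
    ext j
    refine Fin.cases rfl (fun j => rfl) j
  rw [e3, e2, nestedList_bracket_right hL hy hV.mem_one hzm (fun j => hc _ _),
    hL.skew _ _ _ (nestedList_mem hL hy hV.mem_one _) _ hzm, koszulSign_eq_splitSign d hσ,
    splitSign_eq d 1, smul_neg, map_neg, map_units_smul, map_units_smul, smul_neg, smul_smul,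
    smul_smul]
  generalize ((l.filter (· ∈ S)).map d).sum = u
  generalize ((l.filter (· ∉ S)).map d).sum = v
  rw [mul_assoc, ← Int.negOnePow_add, mul_comm (splitSign d 0 S l)]
  rw [← Units.neg_smul, ← neg_mul, ← Int.negOnePow_succ]
  congr 2
  rw [Int.negOnePow_eq_iff]
  -- Moving `ι (p E)`, of degree `1 + u`, out of the nested bracket costs `(1 + u) v`, and
  -- skew-symmetry costs `1 + (1 + u)(1 + v)`. Their sum is congruent to `u`, by which `splitSign d
  -- 1` exceeds the Koszul sign.
  exact ⟨v + u * v + 1, by ring⟩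

end CurvedLInfty

/-! ### The grading of the space of cochains -/

section Grading

variable {k H : Type*} [Field k] [Ring H] [HopfAlgebra k H] [Coalgebra.IsCocomm k H]
variable {M N : Type*} [AddCommGroup M] [Module k M] [Module H M]
  [AddCommGroup N] [Module k N] [Module H N]

/-- The component in `C^{n+1}(M, N)`. -/
def Cochains.component (n : ℕ) : Cochains k H M N →ₗ[k] Cochain k H (n + 1) M N :=
  DirectSum.component k ℕ (fun n => Cochain k H (n + 1) M N) n

lemma Cochains.component_of_self (n : ℕ) (f : Cochain k H (n + 1) M N) :
    Cochains.component n (Cochains.of n f) = f :=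
  DirectSum.component.lof_self (R := k) (M := fun n => Cochain k H (n + 1) M N) n f

lemma Cochains.component_of_ne {n m : ℕ} (h : m ≠ n) (f : Cochain k H (m + 1) M N) :
    Cochains.component n (Cochains.of m f) = 0 :=
  (DirectSum.component.of (R := k) (M := fun n => Cochain k H (n + 1) M N) n m f).trans
    (dif_neg h)

lemma Cochains.of_injective (n : ℕ) :
    Function.Injective (Cochains.of (k := k) (H := H) (M := M) (N := N) n) :=
  Function.LeftInverse.injective (Cochains.component_of_self n)

@[elab_as_elim]
lemma Cochains.induction {motive : Cochains k H M N → Prop} (x : Cochains k H M N)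
    (zero : motive 0) (of : ∀ n (f : Cochain k H (n + 1) M N), motive (Cochains.of n f))
    (add : ∀ x y, motive x → motive y → motive (x + y)) : motive x :=
  DirectSum.induction_on (β := fun n => Cochain k H (n + 1) M N) x zero of add

lemma Cochains.of_mem_grading (n : ℕ) (f : Cochain k H (n + 1) M N) :
    Cochains.of n f ∈ Cochains.grading k H M N n :=
  ⟨f, rfl⟩

lemma Cochains.mem_grading {i : ℤ} {x : Cochains k H M N} (h : x ∈ Cochains.grading k H M N i) :
    x = 0 ∨ ∃ (n : ℕ) (f : Cochain k H (n + 1) M N), i = n ∧ Cochains.of n f = x := by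
  rcases i with n | n
  · obtain ⟨f, rfl⟩ := h
    exact Or.inr ⟨n, f, rfl, rfl⟩
  · exact Or.inl h

lemma Cochains.isInternal_grading : DirectSum.IsInternal (Cochains.grading k H M N) := by
  refine DirectSum.isInternal_submodule_of_iSupIndep_of_iSup_eq_top ?_ ?_
  · rw [iSupIndep_def]
    intro i
    rw [Submodule.disjoint_def]
    intro x hx hx'
    rcases Cochains.mem_grading hx with rfl | ⟨n, f, rfl, rfl⟩
    · rfl
    · have : ⨆ j, ⨆ _ : j ≠ (n : ℤ), Cochains.grading k H M N j ≤
          LinearMap.ker (Cochains.component n) := by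
        refine iSup₂_le fun j hj y hy => ?_
        rcases Cochains.mem_grading hy with rfl | ⟨m, g, rfl, rfl⟩
        · exact zero_mem _
        · exact Cochains.component_of_ne (fun h => hj (congrArg _ h)) g
      have h0 := LinearMap.mem_ker.1 (this hx')
      rw [Cochains.component_of_self] at h0
      rw [h0, map_zero]
  · refine eq_top_iff.2 fun x _ => ?_
    induction x using Cochains.induction with
    | zero => exact zero_mem _
    | of n f => exact Submodule.mem_iSup_of_mem (n : ℤ) (Cochains.of_mem_grading n f)
    | add x y hx hy => exact add_mem (hx trivial) (hy trivial)

/-- A subspace is graded if it contains the homogeneous components of its elements. -/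
def Cochains.IsGraded (S : Submodule k (Cochains k H M N)) : Prop :=
  ∀ x ∈ S, ∀ n, Cochains.of n (Cochains.component n x) ∈ S

lemma Cochains.IsGraded.eq_iSup {S : Submodule k (Cochains k H M N)} (hS : Cochains.IsGraded S) :
    S = ⨆ i, S ⊓ Cochains.grading k H M N i := by
  classical
  refine le_antisymm (fun x hx => ?_) (iSup_le fun i => inf_le_left)
  have : x = ∑ n ∈ DFinsupp.support (β := fun n => Cochain k H (n + 1) M N) x,
      Cochains.of n (Cochains.component n x) :=
    (DirectSum.sum_support_of (β := fun n => Cochain k H (n + 1) M N) x).symm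
  rw [this]
  exact sum_mem fun n _ => Submodule.mem_iSup_of_mem (n : ℤ) ⟨hS x hx n, Cochains.of_mem_grading _ _⟩

/-- Elements of graded subspaces are sums of homogeneous elements of the same subspaces, so closure
under the bracket can be tested where it is given by `circ`. -/
lemma Cochains.IsGraded.bilin_mem {M' N' M'' N'' : Type*}
    [AddCommGroup M'] [Module k M'] [Module H M'] [AddCommGroup N'] [Module k N'] [Module H N']
    [AddCommGroup M''] [Module k M''] [Module H M''] [AddCommGroup N''] [Module k N'']
    [Module H N'']
    {S : Submodule k (Cochains k H M N)} {T : Submodule k (Cochains k H M' N')}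
    {U : Submodule k (Cochains k H M'' N'')} (hS : Cochains.IsGraded S)
    (hT : Cochains.IsGraded T)
    (F : Cochains k H M N →ₗ[k] Cochains k H M' N' →ₗ[k] Cochains k H M'' N'')
    (h : ∀ m n (f : Cochain k H (m + 1) M N) (g : Cochain k H (n + 1) M' N'),
      Cochains.of m f ∈ S → Cochains.of n g ∈ T → F (Cochains.of m f) (Cochains.of n g) ∈ U) :
    ∀ x ∈ S, ∀ y ∈ T, F x y ∈ U := by
  intro x hx y hy
  rw [hS.eq_iSup] at hx
  rw [hT.eq_iSup] at hy
  induction hx using Submodule.iSup_induction' with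
  | zero => simp
  | add x x' _ _ h h' =>
    rw [map_add, LinearMap.add_apply]
    exact add_mem h h'
  | mem i x hx =>
    induction hy using Submodule.iSup_induction' with
    | zero => simp
    | add y y' _ _ h h' =>
      rw [map_add]
      exact add_mem h h'
    | mem j y hy =>
      rcases Cochains.mem_grading hx.2 with rfl | ⟨m, f, rfl, rfl⟩
      · simp
      rcases Cochains.mem_grading hy.2 with rfl | ⟨n, g, rfl, rfl⟩
      · simp
      exact h m n f g hx.1 hy.1

end Grading

/-! ### The graded Lie algebra of cochains -/

section GradedLie

variable {k H : Type*} [Field k] [CharZero k] [Ring H] [HopfAlgebra k H] [Coalgebra.IsCocomm k H]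
variable {M : Type*} [AddCommGroup M] [Module k M] [Module H M]

lemma negOnePow_smul_eq {V : Type*} [AddCommGroup V] [Module k V] (m n : ℕ) (v : V) :
    ((m : ℤ) * (n : ℤ)).negOnePow • v = (-1 : k) ^ (m * n) • v := by
  rw [← units_smul_eq, ← Int.natCast_mul, Int.negOnePow_def, zpow_natCast]

/-- The Nijenhuis–Richardson bracket is a graded Lie bracket. -/
theorem nrBracket_isGradedLieAlgebra :
    IsGradedLieAlgebra (Cochains.grading k H M M) (nrBracket k H M) := by
  refine ⟨Cochains.isInternal_grading, fun i j x hx y hy => ?_, fun i j x hx y hy => ?_,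
    fun i j l x hx y hy z hz => ?_⟩
  · rcases Cochains.mem_grading hx with rfl | ⟨m, f, rfl, rfl⟩
    · simp
    rcases Cochains.mem_grading hy with rfl | ⟨n, g, rfl, rfl⟩
    · simp
    rw [nrBracket_of, ← Int.natCast_add]
    refine sub_mem (Cochains.of_mem_grading _ _) (Submodule.smul_mem _ _ ?_)
    rw [add_comm m n]
    exact Cochains.of_mem_grading _ _
  · rcases Cochains.mem_grading hx with rfl | ⟨m, f, rfl, rfl⟩
    · simp
    rcases Cochains.mem_grading hy with rfl | ⟨n, g, rfl, rfl⟩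
    · simp
    rw [negOnePow_smul_eq (k := k), nrBracket_of, nrBracket_of, smul_sub, smul_smul, mul_comm n m,
      ← mul_pow, neg_one_mul, neg_neg, one_pow, one_smul, neg_sub]
  · rcases Cochains.mem_grading hx with rfl | ⟨m, f, rfl, rfl⟩
    · simp
    rcases Cochains.mem_grading hy with rfl | ⟨n, g, rfl, rfl⟩
    · simp
    rcases Cochains.mem_grading hz with rfl | ⟨p, h, rfl, rfl⟩
    · simp
    rw [negOnePow_smul_eq (k := k)]
    exact nrBracket_jacobi f g h

end GradedLie

/-! ### Naturality in the modules -/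

section Naturality

variable {k H : Type*} [Field k] [Ring H] [HopfAlgebra k H] [Coalgebra.IsCocomm k H]
variable {I J J₀ : Type*} [Fintype I] [DecidableEq I] [Fintype J] [DecidableEq J]
  [Fintype J₀] [DecidableEq J₀]
variable {M M' M'' N N' N'' : Type*}
  [AddCommGroup M] [Module k M] [Module H M] [IsScalarTower k H M]
  [AddCommGroup M'] [Module k M'] [Module H M'] [IsScalarTower k H M']
  [AddCommGroup M''] [Module k M''] [Module H M''] [IsScalarTower k H M'']
  [AddCommGroup N] [Module k N] [Module H N] [IsScalarTower k H N]
  [AddCommGroup N'] [Module k N'] [Module H N'] [IsScalarTower k H N']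
  [AddCommGroup N''] [Module k N''] [Module H N''] [IsScalarTower k H N'']

lemma PTensor.map_map (ψ : N →ₗ[H] N') (ψ' : N' →ₗ[H] N'') (w : PTensor k H J N) :
    PTensor.map ψ' (PTensor.map ψ w) = PTensor.map (ψ' ∘ₗ ψ) w := by
  induction w using PTensor.induction with
  | h0 => simp
  | hmk b z => simp
  | hadd x y hx hy => simp only [map_add, hx, hy]

lemma PTensor.map_id (w : PTensor k H J N) : PTensor.map LinearMap.id w = w := by
  induction w using PTensor.induction with
  | h0 => simp
  | hmk b z => simp
  | hadd x y hx hy => simp only [map_add, hx, hy]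

lemma PTensor.map_zero_left (w : PTensor k H J N) :
    PTensor.map (0 : N →ₗ[H] N') w = 0 := by
  induction w using PTensor.induction with
  | h0 => simp
  | hmk b z => rw [PTensor.map_mk, LinearMap.zero_apply, ← PTensor.mkLin_apply, map_zero]
  | hadd x y hx hy => simp only [map_add, hx, hy, add_zero]

lemma PTensor.map_add_left (ψ ψ' : N →ₗ[H] N') (w : PTensor k H J N) :
    PTensor.map (ψ + ψ') w = PTensor.map ψ w + PTensor.map ψ' w := by
  induction w using PTensor.induction with
  | h0 => simp
  | hmk b z =>
    rw [PTensor.map_mk, PTensor.map_mk, PTensor.map_mk, LinearMap.add_apply, ← PTensor.mkLin_apply,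
      ← PTensor.mkLin_apply, ← PTensor.mkLin_apply, map_add]
  | hadd x y hx hy =>
    simp only [map_add, hx, hy]
    abel

lemma PTensor.map_perm (ψ : N →ₗ[H] N') (σ : Equiv.Perm J) (w : PTensor k H J N) :
    PTensor.map ψ (PTensor.perm σ w) = PTensor.perm σ (PTensor.map ψ w) :=
  PTensor.map_baseMap ψ _ _ w

/-- Insertion multiplies and expands the coefficients in `H^{⊗ J}`, while module maps act on the
second tensor factor; the two do not interfere. -/
lemma insertAt_map (G : Graft I J₀ J) {f : PMap k H I M N} {f' : PMap k H I M' N'}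
    (φ : M' →ₗ[H] M) (ψ : N →ₗ[H] N') (h : ∀ y, f'.1 y = PTensor.map ψ (f.1 (φ ∘ y)))
    (x : I → M') (w : PTensor k H J₀ M') :
    insertAt G f' x w = PTensor.map ψ (insertAt G f (φ ∘ x) (PTensor.map φ w)) := by
  induction w using PTensor.induction with
  | h0 => simp
  | hmk b z =>
    rw [insertAt_mk, PTensor.map_mk, insertAt_mk, PTensor.map_smul, PTensor.map_expand, h,
      Function.comp_update]
  | hadd x y hx hy => simp only [map_add, hx, hy]

lemma Cochain.map_apply {n : ℕ} (φ : M' →ₗ[H] M) (ψ : N →ₗ[H] N') (f : Cochain k H n M N)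
    (x : Fin n → M') : (Cochain.map φ ψ f).1 x = PTensor.map ψ (f.1 (φ ∘ x)) := rfl

lemma Cochain.map_map {n : ℕ} (φ : M' →ₗ[H] M) (φ' : M'' →ₗ[H] M') (ψ : N →ₗ[H] N')
    (ψ' : N' →ₗ[H] N'') (f : Cochain k H n M N) :
    Cochain.map φ' ψ' (Cochain.map φ ψ f) = Cochain.map (φ ∘ₗ φ') (ψ' ∘ₗ ψ) f := by
  ext x
  rw [Cochain.map_apply, Cochain.map_apply, Cochain.map_apply, PTensor.map_map]
  rfl

lemma Cochain.map_id {n : ℕ} (f : Cochain k H n M N) :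
    Cochain.map LinearMap.id LinearMap.id f = f := by
  ext x
  exact PTensor.map_id _

lemma circ_apply {m n : ℕ} (f : Cochain k H (m + 1) M N) (g : Cochain k H (n + 1) M M)
    (x : Fin (m + n + 1) → M) : (circ f g).1 x =
      ∑ σ ∈ shuffles (n + 1) (m + n + 1), Equiv.Perm.sign σ • PTensor.perm σ
        (insertAt (Graft.first m n) (Cochain.toPMap f) (x ∘ σ ∘ (Graft.first m n).s)
          (g.1 (x ∘ σ ∘ (Graft.first m n).e))) := by
  change (Cochain.toPMap (circ f g)).1 x = _
  rw [toPMap_circ, Submodule.coe_sum, sum_apply]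
  refine Finset.sum_congr rfl fun σ _ => ?_
  change (signedPerm σ (circFirst f g)).1 x = _
  rw [signedPerm_apply]
  rfl

/-- Naturality of the circle product. -/
lemma circ_map {m n : ℕ} (φ : M' →ₗ[H] M) (ψ : N →ₗ[H] N') (f : Cochain k H (m + 1) M N)
    (g : Cochain k H (n + 1) M M) (g' : Cochain k H (n + 1) M' M')
    (h : ∀ y, PTensor.map φ (g'.1 y) = g.1 (φ ∘ y)) :
    Cochain.map φ ψ (circ f g) = circ (Cochain.map φ ψ f) g' := by
  ext x
  rw [Cochain.map_apply, circ_apply, circ_apply, map_sum]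
  refine Finset.sum_congr rfl fun σ _ => ?_
  rw [map_units_smul, PTensor.map_perm, insertAt_map (f := Cochain.toPMap f) (Graft.first m n) φ ψ (fun y => rfl), h]
  rfl

/-- Functoriality of `⨁_{n ≥ 0} C^{n+1}(M, N)`. -/
def Cochains.map (φ : M' →ₗ[H] M) (ψ : N →ₗ[H] N') :
    Cochains k H M N →ₗ[k] Cochains k H M' N' :=
  Cochains.lift fun n => (Cochains.of n).comp (Cochain.map φ ψ)

lemma Cochains.map_of (φ : M' →ₗ[H] M) (ψ : N →ₗ[H] N') (n : ℕ) (f : Cochain k H (n + 1) M N) :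
    Cochains.map φ ψ (Cochains.of n f) = Cochains.of n (Cochain.map φ ψ f) :=
  Cochains.lift_of _ n f

lemma Cochains.of_component_map (φ : M' →ₗ[H] M) (ψ : N →ₗ[H] N') (n : ℕ)
    (x : Cochains k H M N) :
    Cochains.of n (Cochains.component n (Cochains.map φ ψ x)) =
      Cochains.map φ ψ (Cochains.of n (Cochains.component n x)) := by
  induction x using Cochains.induction with
  | zero => simp
  | of m f =>
    rw [Cochains.map_of]
    by_cases h : m = n
    · subst h
      rw [Cochains.component_of_self, Cochains.component_of_self, Cochains.map_of]
    · rw [Cochains.component_of_ne h, Cochains.component_of_ne h, map_zero, map_zero, map_zero]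
  | add x y hx hy => simp only [map_add, hx, hy]

lemma Cochains.map_map (φ : M' →ₗ[H] M) (φ' : M'' →ₗ[H] M') (ψ : N →ₗ[H] N')
    (ψ' : N' →ₗ[H] N'') (x : Cochains k H M N) :
    Cochains.map φ' ψ' (Cochains.map φ ψ x) = Cochains.map (φ ∘ₗ φ') (ψ' ∘ₗ ψ) x := by
  induction x using Cochains.induction with
  | zero => simp
  | of m f => rw [Cochains.map_of, Cochains.map_of, Cochains.map_of, Cochain.map_map]
  | add x y hx hy => simp only [map_add, hx, hy]

lemma Cochains.map_id (x : Cochains k H M N) :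
    Cochains.map LinearMap.id LinearMap.id x = x := by
  induction x using Cochains.induction with
  | zero => simp
  | of m f => rw [Cochains.map_of, Cochain.map_id]
  | add x y hx hy => simp only [map_add, hx, hy]

lemma Cochains.map_mem_grading (φ : M' →ₗ[H] M) (ψ : N →ₗ[H] N') {i : ℤ} {x : Cochains k H M N}
    (h : x ∈ Cochains.grading k H M N i) :
    Cochains.map φ ψ x ∈ Cochains.grading k H M' N' i := by
  rcases Cochains.mem_grading h with rfl | ⟨n, f, rfl, rfl⟩
  · rw [_root_.map_zero]
    exact zero_mem _
  · rw [Cochains.map_of]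
    exact Cochains.of_mem_grading _ _

end Naturality

/-! ### The curved V-datum -/

section VData

variable {k H : Type*} [Field k] [Ring H] [HopfAlgebra k H] [Coalgebra.IsCocomm k H]
variable {A B : Type*}
  [AddCommGroup A] [Module k A] [Module H A] [IsScalarTower k H A]
  [AddCommGroup B] [Module k B] [Module H B] [IsScalarTower k H B]

lemma inclK_eq_map :
    inclK k H A B = Cochains.map (LinearMap.snd H A B) (LinearMap.inl H A B) := rfl

lemma projK_eq_map :
    projK k H A B = Cochains.map (LinearMap.inr H A B) (LinearMap.fst H A B) := rfl

lemma projK_inclK (f : Cochains k H B A) : projK k H A B (inclK k H A B f) = f := by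
  rw [inclK_eq_map, projK_eq_map, Cochains.map_map, LinearMap.fst_comp_inl,
    LinearMap.snd_comp_inr, Cochains.map_id]

lemma isGraded_range_inclK : Cochains.IsGraded (LinearMap.range (inclK k H A B)) := by
  rintro _ ⟨f, rfl⟩ n
  rw [inclK_eq_map, Cochains.of_component_map]
  exact ⟨_, rfl⟩

lemma isGraded_ker_projK : Cochains.IsGraded (LinearMap.ker (projK k H A B)) := by
  intro x hx n
  rw [LinearMap.mem_ker, projK_eq_map] at hx ⊢
  rw [← Cochains.of_component_map, hx, map_zero, map_zero]

/-- The inner cochain has values in `A`, while the outer one reads only `B`-components. By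
naturality along the projection to `B`, the inner cochain may be replaced by 0. -/
lemma circ_incl_incl {m n : ℕ} (f : Cochain k H (m + 1) B A) (g : Cochain k H (n + 1) B A) :
    circ (Cochain.map (LinearMap.snd H A B) (LinearMap.inl H A B) f)
      (Cochain.map (LinearMap.snd H A B) (LinearMap.inl H A B) g) = 0 := by
  rw [← circ_map (LinearMap.snd H A B) (LinearMap.inl H A B) f 0]
  · have := circ_smul_right (0 : k) f (0 : Cochain k H (n + 1) B B)
    rw [zero_smul, zero_smul] at this
    rw [this, map_zero]
  · intro y
    rw [Cochain.map_apply, PTensor.map_map, LinearMap.snd_comp_inl, PTensor.map_zero_left]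
    rfl

lemma nrBracket_inclK (f g : Cochains k H B A) :
    nrBracket k H (A × B) (inclK k H A B f) (inclK k H A B g) = 0 := by
  induction f using Cochains.induction with
  | zero => simp
  | add x y hx hy => rw [map_add, map_add, LinearMap.add_apply, hx, hy, add_zero]
  | of m f =>
    induction g using Cochains.induction with
    | zero => simp
    | add x y hx hy => rw [map_add, map_add, hx, hy, add_zero]
    | of n g =>
      rw [inclK_eq_map, Cochains.map_of, Cochains.map_of, nrBracket_of, circ_incl_incl,
        circ_incl_incl, map_zero, map_zero, smul_zero, sub_zero]

lemma PTensor.inl_fst_add_inr_snd {J : Type*} [Fintype J] [DecidableEq J]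
    (w : PTensor k H J (A × B)) :
    PTensor.map (LinearMap.inl H A B) (PTensor.map (LinearMap.fst H A B) w) +
      PTensor.map (LinearMap.inr H A B) (PTensor.map (LinearMap.snd H A B) w) = w := by
  rw [PTensor.map_map, PTensor.map_map, ← PTensor.map_add_left]
  convert PTensor.map_id w
  ext x <;> simp

/-- By `hg`, arguments from `B` give `g` a value in `B`, so `g` restricts to a cochain on `B`.
Naturality along the inclusion of `B` then turns the projected composite into a composite whose
outer map is the projection of `f`, which is 0. -/
lemma proj_circ_eq_zero {m n : ℕ} (f : Cochain k H (m + 1) (A × B) (A × B))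
    (g : Cochain k H (n + 1) (A × B) (A × B))
    (hf : Cochain.map (LinearMap.inr H A B) (LinearMap.fst H A B) f = 0)
    (hg : Cochain.map (LinearMap.inr H A B) (LinearMap.fst H A B) g = 0) :
    Cochain.map (LinearMap.inr H A B) (LinearMap.fst H A B) (circ f g) = 0 := by
  rw [circ_map (LinearMap.inr H A B) (LinearMap.fst H A B) f g
    (Cochain.map (LinearMap.inr H A B) (LinearMap.snd H A B) g), hf]
  · have := circ_smul_left (0 : k) (0 : Cochain k H (m + 1) B A)
      (Cochain.map (LinearMap.inr H A B) (LinearMap.snd H A B) g)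
    rwa [zero_smul, zero_smul] at this
  · intro y
    have h : PTensor.map (LinearMap.fst H A B) (g.1 (LinearMap.inr H A B ∘ y)) = 0 :=
      congrArg (fun F : Cochain k H (n + 1) B A => F.1 y) hg
    rw [Cochain.map_apply]
    conv_rhs => rw [← PTensor.inl_fst_add_inr_snd (g.1 _), h, map_zero, zero_add]

lemma nrBracket_mem_ker_projK : ∀ x ∈ LinearMap.ker (projK k H A B),
    ∀ y ∈ LinearMap.ker (projK k H A B),
      nrBracket k H (A × B) x y ∈ LinearMap.ker (projK k H A B) := by
  refine isGraded_ker_projK.bilin_mem isGraded_ker_projK _ fun m n f g hf hg => ?_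
  rw [LinearMap.mem_ker, projK_eq_map, Cochains.map_of] at hf hg
  have hf' := Cochains.of_injective m (hf.trans (map_zero _).symm)
  have hg' := Cochains.of_injective n (hg.trans (map_zero _).symm)
  rw [LinearMap.mem_ker, projK_eq_map, nrBracket_of, map_sub, map_smul, Cochains.map_of,
    Cochains.map_of, proj_circ_eq_zero f g hf' hg', proj_circ_eq_zero g f hg' hf', map_zero,
    map_zero, smul_zero, sub_zero]

/-- `⨁ C^{n+1}(B, A)` in `⨁ C^{n+1}(A × B, A × B)` and a Maurer–Cartan element of the latter form
a curved V-datum. -/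
theorem isCurvedVData_nrBracket [CharZero k] {Δ : Cochains k H (A × B) (A × B)}
    (hΔ : Δ ∈ Cochains.grading k H (A × B) (A × B) 1) (h : nrBracket k H (A × B) Δ Δ = 0) :
    IsCurvedVData (Cochains.grading k H (A × B) (A × B)) (nrBracket k H (A × B))
      (LinearMap.range (inclK k H A B)) (inclK k H A B ∘ₗ projK k H A B) Δ := by
  have hab : ∀ x ∈ LinearMap.range (inclK k H A B), ∀ y ∈ LinearMap.range (inclK k H A B),
      nrBracket k H (A × B) x y = 0 := by
    rintro _ ⟨f, rfl⟩ _ ⟨g, rfl⟩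
    exact nrBracket_inclK f g
  have hker : LinearMap.ker (inclK k H A B ∘ₗ projK k H A B) = LinearMap.ker (projK k H A B) :=
    LinearMap.ker_comp_of_ker_eq_bot _
      (LinearMap.ker_eq_bot.2 (Function.LeftInverse.injective projK_inclK))
  refine ⟨nrBracket_isGradedLieAlgebra, ⟨isGraded_range_inclK.eq_iSup, fun x hx y hy => ?_⟩, hab,
    fun x => ?_, ?_, ?_, hΔ, h⟩
  · rw [hab x hx y hy]
    exact zero_mem _
  · rw [LinearMap.comp_apply, LinearMap.comp_apply, projK_inclK]
  · exact LinearMap.range_comp_of_range_eq_top _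
      (LinearMap.range_eq_top.2 (Function.RightInverse.surjective projK_inclK))
  · rw [hker]
    exact ⟨isGraded_ker_projK.eq_iSup, nrBracket_mem_ker_projK⟩

end VData

/-! ### Weights under rescaling the first summand -/

section Weights

variable {k H : Type*} [Field k] [CharZero k] [Ring H] [HopfAlgebra k H] [Coalgebra.IsCocomm k H]
variable {A B : Type*}
  [AddCommGroup A] [Module k A] [Module H A] [IsScalarTower k H A]
  [AddCommGroup B] [Module k B] [Module H B] [IsScalarTower k H B]

variable (H A B) in
/-- The map `(a, b) ↦ (2 a, b)`. -/
def doubleFst : A × B →ₗ[H] A × B :=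
  (LinearMap.fst H A B + LinearMap.fst H A B).prod (LinearMap.snd H A B)

variable (k H A B) in
/-- The subspace of cochains `f` with `φ f = 2 ^ w f (φ ·)` for `φ (a, b) = (2 a, b)`. -/
def weight (w : ℤ) : Submodule k (Cochains k H (A × B) (A × B)) :=
  LinearMap.ker (Cochains.map LinearMap.id (doubleFst H A B) -
    (2 : k) ^ w • Cochains.map (doubleFst H A B) LinearMap.id)

lemma mem_weight {w : ℤ} {x : Cochains k H (A × B) (A × B)} :
    x ∈ weight k H A B w ↔ Cochains.map LinearMap.id (doubleFst H A B) x =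
      (2 : k) ^ w • Cochains.map (doubleFst H A B) LinearMap.id x := by
  rw [weight, LinearMap.mem_ker, LinearMap.sub_apply, LinearMap.smul_apply, sub_eq_zero]

lemma of_mem_weight {w : ℤ} {n : ℕ} {f : Cochain k H (n + 1) (A × B) (A × B)} :
    Cochains.of n f ∈ weight k H A B w ↔ Cochain.map LinearMap.id (doubleFst H A B) f =
      (2 : k) ^ w • Cochain.map (doubleFst H A B) LinearMap.id f := by
  rw [mem_weight, Cochains.map_of, Cochains.map_of, ← map_smul]
  exact (Cochains.of_injective n).eq_iff

lemma of_mem_weight_apply {w : ℤ} {n : ℕ} {f : Cochain k H (n + 1) (A × B) (A × B)} :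
    Cochains.of n f ∈ weight k H A B w ↔ ∀ x, PTensor.map (doubleFst H A B) (f.1 x) =
      (2 : k) ^ w • f.1 (doubleFst H A B ∘ x) := by
  rw [of_mem_weight]
  constructor
  · intro h x
    have := congrArg (fun F : Cochain k H (n + 1) (A × B) (A × B) => F.1 x) h
    rw [← PTensor.map_id (f.1 (doubleFst H A B ∘ x))]
    exact this
  · intro h
    refine Subtype.ext (MultilinearMap.ext fun x => (h x).trans ?_)
    exact congrArg ((2 : k) ^ w • ·) (PTensor.map_id _).symm

lemma isGraded_weight (w : ℤ) : Cochains.IsGraded (weight k H A B w) := by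
  intro x hx n
  rw [mem_weight] at hx ⊢
  rw [← Cochains.of_component_map, ← Cochains.of_component_map, hx, map_smul, map_smul]

/-- With `φ = doubleFst`: `φ f (g x, y) = 2^v f (φ g x, φ y) = 2^(v+w) f (g (φ x), φ y)`. -/
lemma circ_mem_weight {v w : ℤ} {m n : ℕ} {f : Cochain k H (m + 1) (A × B) (A × B)}
    {g : Cochain k H (n + 1) (A × B) (A × B)} (hf : Cochains.of m f ∈ weight k H A B v)
    (hg : Cochains.of n g ∈ weight k H A B w) :
    Cochains.of (m + n) (circ f g) ∈ weight k H A B (v + w) := by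
  rw [of_mem_weight] at hf ⊢
  have h1 : Cochain.map LinearMap.id (doubleFst H A B) (circ f g) =
      circ (Cochain.map LinearMap.id (doubleFst H A B) f) g :=
    circ_map _ _ f g g fun y => PTensor.map_id _
  have h2 : Cochain.map (doubleFst H A B) LinearMap.id (circ f ((2 : k) ^ w • g)) =
      circ (Cochain.map (doubleFst H A B) LinearMap.id f) g :=
    circ_map _ _ f _ g (of_mem_weight_apply.1 hg)
  rw [circ_smul_right, map_smul] at h2
  rw [h1, hf, circ_smul_left, ← h2, smul_smul, zpow_add₀ two_ne_zero]

lemma nrBracket_mem_weight {v w : ℤ} : ∀ x ∈ weight k H A B v, ∀ y ∈ weight k H A B w,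
    nrBracket k H (A × B) x y ∈ weight k H A B (v + w) := by
  refine (isGraded_weight v).bilin_mem (isGraded_weight w) _ fun m n f g hf hg => ?_
  rw [nrBracket_of]
  refine sub_mem (circ_mem_weight hf hg) (Submodule.smul_mem _ _ ?_)
  rw [add_comm v w]
  exact circ_mem_weight hg hf

/-- In characteristic 0 the field contains `ℚ`, where the powers of 2 are distinct. This is what
makes the weight well defined. -/
lemma two_zpow_injective : Function.Injective fun w : ℤ => (2 : k) ^ w := by
  intro a b h
  have h' : (((2 : ℚ) ^ a : ℚ) : k) = ((2 : ℚ) ^ b : ℚ) := by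
    push_cast
    exact h
  exact zpow_right_injective₀ (by norm_num) (by norm_num) (Rat.cast_injective h')

lemma eq_zero_of_zpow_smul {V : Type*} [AddCommGroup V] [Module k V] {a b : ℤ} (hab : a ≠ b)
    {x : V} (h : (2 : k) ^ a • x = (2 : k) ^ b • x) : x = 0 := by
  rw [← sub_eq_zero, ← sub_smul] at h
  exact (smul_eq_zero.1 h).resolve_left (sub_ne_zero.2 fun h => hab (two_zpow_injective h))

lemma Cochain.map_add_right {M M' N N' : Type*}
    [AddCommGroup M] [Module k M] [Module H M] [IsScalarTower k H M]
    [AddCommGroup M'] [Module k M'] [Module H M'] [IsScalarTower k H M']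
    [AddCommGroup N] [Module k N] [Module H N] [IsScalarTower k H N]
    [AddCommGroup N'] [Module k N'] [Module H N'] [IsScalarTower k H N'] {n : ℕ}
    (φ : M' →ₗ[H] M) (ψ ψ' : N →ₗ[H] N') (f : Cochain k H n M N) :
    Cochain.map φ (ψ + ψ') f = Cochain.map φ ψ f + Cochain.map φ ψ' f := by
  ext x
  exact PTensor.map_add_left ψ ψ' _

/-- The rescaling is trivial on arguments from `B` and doubles values in `A`, so the component
extracted by `projK` can only scale with weight 1. -/
lemma projK_eq_zero_of_mem_weight {w : ℤ} (hw : w ≠ 1) {x : Cochains k H (A × B) (A × B)}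
    (hx : x ∈ weight k H A B w) : projK k H A B x = 0 := by
  have h := congrArg (projK k H A B) (mem_weight.1 hx)
  rw [map_smul, projK_eq_map, Cochains.map_map, Cochains.map_map] at h
  refine eq_zero_of_zpow_smul (k := k) hw (Eq.symm ?_)
  rw [zpow_one]
  refine Eq.trans ?_ (h.trans ?_)
  · rw [two_smul, projK_eq_map]
    have : LinearMap.fst H A B ∘ₗ doubleFst H A B = LinearMap.fst H A B + LinearMap.fst H A B :=
      LinearMap.fst_prod _ _
    rw [this, LinearMap.id_comp]
    clear h hx
    induction x using Cochains.induction with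
    | zero => simp
    | of n f => simp only [Cochains.map_of, Cochain.map_add_right, map_add]
    | add x y hx hy =>
      simp only [map_add, ← hx, ← hy]
      abel
  · congr 3
    ext x <;> simp [doubleFst]

lemma doubleFst_inl (a : A) : doubleFst H A B (a, 0) = (2 : k) • (a, (0 : B)) := by
  simp [doubleFst, two_smul]

lemma doubleFst_inr (b : B) : doubleFst H A B (0, b) = (0, b) := by
  simp [doubleFst]

lemma doubleFst_comp_piecewise {n : ℕ} (x : Fin n → A × B) (S : Finset (Fin n)) :
    doubleFst H A B ∘ (S.piecewise (fun i => ((x i).1, (0 : B))) fun i => (0, (x i).2)) =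
      fun i => (if i ∈ S then (2 : k) else 1) •
        S.piecewise (fun i => ((x i).1, (0 : B))) (fun i => (0, (x i).2)) i := by
  funext i
  by_cases hi : i ∈ S
  · simp only [Function.comp_apply, Finset.piecewise_eq_of_mem _ _ _ hi, if_pos hi]
    exact doubleFst_inl _
  · simp only [Function.comp_apply, Finset.piecewise_eq_of_notMem _ _ _ hi, if_neg hi, one_smul]
    exact doubleFst_inr _

/-- Splitting each argument into its `A`- and `B`-part gives one term for each set `S` of places
filled from `A`. Weight 1 makes that term an eigenvector of `doubleFst` for `2^(1+|S|)`, whereas the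
eigenvalues are 2 on `A` and 1 on `B`. Only `S = ∅` with a value in `A` survives. -/
lemma inclK_projK_of_mem_weight_one {x : Cochains k H (A × B) (A × B)}
    (hx : x ∈ weight k H A B 1) : inclK k H A B (projK k H A B x) = x := by
  have hg := isGraded_weight (k := k) (H := H) (A := A) (B := B) 1
  rw [hg.eq_iSup] at hx
  induction hx using Submodule.iSup_induction' with
  | zero => simp
  | add x y _ _ hx hy => rw [map_add, map_add, hx, hy]
  | mem i x hx =>
    rcases Cochains.mem_grading hx.2 with rfl | ⟨n, f, rfl, rfl⟩
    · simp
    have hf := of_mem_weight_apply.1 hx.1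
    rw [inclK_eq_map, projK_eq_map, Cochains.map_of, Cochains.map_of, Cochain.map_map]
    congr 1
    ext x
    set y := fun S : Finset (Fin (n + 1)) =>
      S.piecewise (fun i => ((x i).1, (0 : B))) (fun i => ((0 : A), (x i).2)) with hy
    have hw : ∀ S : Finset (Fin (n + 1)), PTensor.map (doubleFst H A B) (f.1 (y S)) =
        (2 : k) ^ (1 + (S.card : ℤ)) • f.1 (y S) := by
      intro S
      rw [hf, hy, doubleFst_comp_piecewise (k := k), MultilinearMap.map_smul_univ,
        Finset.prod_ite_mem, Finset.univ_inter, Finset.prod_const, smul_smul,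
        zpow_add₀ two_ne_zero, zpow_natCast]
    have hfst : ∀ S : Finset (Fin (n + 1)), S ≠ ∅ →
        PTensor.map (LinearMap.fst H A B) (f.1 (y S)) = 0 := by
      intro S hS
      have h := congrArg (PTensor.map (LinearMap.fst H A B)) (hw S)
      have e : LinearMap.fst H A B ∘ₗ doubleFst H A B =
        LinearMap.fst H A B + LinearMap.fst H A B := LinearMap.fst_prod _ _
      rw [PTensor.map_map, e, PTensor.map_add_left, ← two_smul k, map_smul] at h
      refine eq_zero_of_zpow_smul (k := k) (a := 1) (b := 1 + S.card) ?_ (by rwa [zpow_one])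
      have := Finset.card_ne_zero.2 (Finset.nonempty_iff_ne_empty.2 hS)
      omega
    have hsnd : ∀ S : Finset (Fin (n + 1)),
        PTensor.map (LinearMap.snd H A B) (f.1 (y S)) = 0 := by
      intro S
      have h := congrArg (PTensor.map (LinearMap.snd H A B)) (hw S)
      have e : LinearMap.snd H A B ∘ₗ doubleFst H A B = LinearMap.snd H A B :=
        LinearMap.snd_prod _ _
      rw [PTensor.map_map, e, map_smul] at h
      refine eq_zero_of_zpow_smul (k := k) (a := 0) (b := 1 + S.card) ?_
        (by rwa [zpow_zero, one_smul])
      omega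
    have hz : ∀ S : Finset (Fin (n + 1)), S ≠ ∅ → f.1 (y S) = 0 := by
      intro S hS
      rw [← PTensor.inl_fst_add_inr_snd (f.1 (y S)), hfst S hS, hsnd S, map_zero, map_zero,
        add_zero]
    have hx : f.1 x = f.1 (y ∅) := by
      have e : x = (fun i => ((x i).1, (0 : B))) + fun i => ((0 : A), (x i).2) := by
        funext i
        simp
      conv_lhs => rw [e, MultilinearMap.map_add_univ]
      exact Finset.sum_eq_single ∅ (fun S _ hS => hz S hS) (by simp)
    have hy0 : y ∅ = (LinearMap.inr H A B ∘ₗ LinearMap.snd H A B) ∘ x := by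
      funext i
      simp [hy]
    rw [hx, Cochain.map_apply, ← hy0, ← PTensor.map_map]
    conv_rhs => rw [← PTensor.inl_fst_add_inr_snd (f.1 (y ∅)), hsnd, map_zero, add_zero]

lemma inclK_mem_weight (f : Cochains k H B A) : inclK k H A B f ∈ weight k H A B 1 := by
  induction f using Cochains.induction with
  | zero =>
    rw [map_zero]
    exact zero_mem _
  | add x y hx hy =>
    rw [map_add]
    exact add_mem hx hy
  | of n f =>
    rw [inclK_eq_map, Cochains.map_of, of_mem_weight_apply]
    intro x
    have e : doubleFst H A B ∘ₗ LinearMap.inl H A B =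
        LinearMap.inl H A B + LinearMap.inl H A B := by
      ext x <;> simp [doubleFst]
    rw [Cochain.map_apply, Cochain.map_apply, PTensor.map_map, e, PTensor.map_add_left, zpow_one,
      two_smul]
    rfl

lemma nestedBracket_mem_weight {w : ℤ} {D : Cochains k H (A × B) (A × B)}
    (hD : D ∈ weight k H A B w) (n : ℕ) (x : Fin n → Cochains k H (A × B) (A × B))
    (hx : ∀ i, x i ∈ weight k H A B 1) :
    nestedBracket (nrBracket k H (A × B)) D n x ∈ weight k H A B (w + n) := by
  induction n with
  | zero => simpa using hD
  | succ n ih =>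
    rw [nestedBracket_succ, Nat.cast_succ, ← add_assoc]
    exact nrBracket_mem_weight _ (ih _ fun i => hx _) _ (hx _)

lemma nestedBracket_add_left {L : Type*} [AddCommGroup L] [Module k L] (br : L →ₗ[k] L →ₗ[k] L)
    (D D' : L) (n : ℕ) (x : Fin n → L) :
    nestedBracket br (D + D') n x = nestedBracket br D n x + nestedBracket br D' n x := by
  induction n with
  | zero => rfl
  | succ n ih => rw [nestedBracket_succ, ih, map_add]; rfl

variable (Ω : Cochain k H 2 (A × B) (A × B))

/-- The `A`-value counts 1 and each of the two `A`-arguments counts `-1`. The weights of the other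
components follow by the same count. -/
lemma hatπ_mem_weight : hatπ Ω ∈ weight k H A B (-1) := by
  rw [hatπ, of_mem_weight_apply]
  intro x
  have e : doubleFst H A B ∘ₗ LinearMap.inl H A B =
      LinearMap.inl H A B + LinearMap.inl H A B := by
    ext x <;> simp [doubleFst]
  have e' : LinearMap.fst H A B ∘ doubleFst H A B ∘ x =
      fun i => (2 : k) • (LinearMap.fst H A B ∘ x) i := by
    funext i
    simp [doubleFst, two_smul]
  rw [Cochain.map_apply, Cochain.map_apply, PTensor.map_map, e, PTensor.map_add_left, e',
    MultilinearMap.map_smul_univ, map_smul, smul_smul, ← two_smul k (PTensor.map _ _)]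
  congr 1
  norm_num

lemma hatθ_mem_weight : hatθ Ω ∈ weight k H A B (-2) := by
  rw [hatθ, of_mem_weight_apply]
  intro x
  have e : doubleFst H A B ∘ₗ LinearMap.inr H A B = LinearMap.inr H A B := by
    ext x <;> simp [doubleFst]
  have e' : LinearMap.fst H A B ∘ doubleFst H A B ∘ x =
      fun i => (2 : k) • (LinearMap.fst H A B ∘ x) i := by
    funext i
    simp [doubleFst, two_smul]
  rw [Cochain.map_apply, Cochain.map_apply, PTensor.map_map, e, e',
    MultilinearMap.map_smul_univ, map_smul, smul_smul]
  rw [show (2 : k) ^ (-2 : ℤ) * ∏ _i : Fin (1 + 1), (2 : k) = 1 by norm_num, one_smul]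

lemma hatμ_mem_weight : hatμ Ω ∈ weight k H A B 0 := by
  rw [hatμ, of_mem_weight_apply]
  intro x
  have e : doubleFst H A B ∘ₗ LinearMap.inr H A B = LinearMap.inr H A B := by
    ext x <;> simp [doubleFst]
  rw [Cochain.map_apply, Cochain.map_apply, PTensor.map_map, e, zpow_zero, one_smul]
  rfl

/-- Each of the two terms of the lift has exactly one argument from `A`. -/
lemma Mixed.lift_doubleFst {N : Type*} [AddCommGroup N] [Module k N] [Module H N]
    [IsScalarTower k H N] (α : Mixed k H A B N) (x : Fin 2 → A × B) :
    (Mixed.lift α).1 (doubleFst H A B ∘ x) = (2 : k) • (Mixed.lift α).1 x := by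
  change α.1 ((x 0).1 + (x 0).1) (x 1).2 -
      PTensor.perm (Equiv.swap 0 1) (α.1 ((x 1).1 + (x 1).1) (x 0).2) =
    (2 : k) • (α.1 (x 0).1 (x 1).2 - PTensor.perm (Equiv.swap 0 1) (α.1 (x 1).1 (x 0).2))
  rw [map_add, map_add, LinearMap.add_apply, LinearMap.add_apply, PTensor.perm_add, two_smul]
  abel

lemma hatη_mem_weight : hatη Ω ∈ weight k H A B 0 := by
  rw [hatη, of_mem_weight_apply]
  intro x
  have e : doubleFst H A B ∘ₗ LinearMap.inl H A B =
      LinearMap.inl H A B + LinearMap.inl H A B := by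
    ext x <;> simp [doubleFst]
  rw [Cochain.map_apply, Cochain.map_apply, PTensor.map_map, e, PTensor.map_add_left, zpow_zero,
    one_smul, ← two_smul k (PTensor.map _ _), ← map_smul]
  exact congrArg _ (Mixed.lift_doubleFst _ _).symm

lemma hatρ_mem_weight : hatρ Ω ∈ weight k H A B (-1) := by
  rw [hatρ, of_mem_weight_apply]
  intro x
  have e : doubleFst H A B ∘ₗ LinearMap.inr H A B = LinearMap.inr H A B := by
    ext x <;> simp [doubleFst]
  rw [Cochain.map_apply, Cochain.map_apply, PTensor.map_map, e, ← map_smul]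
  refine congrArg _ ?_
  refine Eq.trans ?_ (congrArg _ (Mixed.lift_doubleFst _ _).symm)
  rw [smul_smul]
  norm_num

end Weights

/-! ### The operations `lₙ` -/

section Operations

variable {k H : Type*} [Field k] [CharZero k] [Ring H] [HopfAlgebra k H] [Coalgebra.IsCocomm k H]
variable {A B : Type*}
  [AddCommGroup A] [Module k A] [Module H A] [IsScalarTower k H A]
  [AddCommGroup B] [Module k B] [Module H B] [IsScalarTower k H B]
variable (Ω : Cochain k H 2 (A × B) (A × B))

lemma projK_nestedBracket {w : ℤ} {D : Cochains k H (A × B) (A × B)}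
    (hD : D ∈ weight k H A B w) {n : ℕ} (h : w + n ≠ 1) (x : Fin n → Cochains k H B A) :
    projK k H A B (nestedBracket (nrBracket k H (A × B)) D n (inclK k H A B ∘ x)) = 0 :=
  projK_eq_zero_of_mem_weight h
    (nestedBracket_mem_weight hD n _ fun i => inclK_mem_weight (x i))

lemma inclK_projK_nestedBracket {w : ℤ} {D : Cochains k H (A × B) (A × B)}
    (hD : D ∈ weight k H A B w) {n : ℕ} (h : w + n = 1) (x : Fin n → Cochains k H B A) :
    inclK k H A B (projK k H A B
      (nestedBracket (nrBracket k H (A × B)) D n (inclK k H A B ∘ x))) =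
      nestedBracket (nrBracket k H (A × B)) D n (inclK k H A B ∘ x) :=
  inclK_projK_of_mem_weight_one
    (h ▸ nestedBracket_mem_weight hD n _ fun i => inclK_mem_weight (x i))

/-- The components of `Δ` are grouped by weight, `-1`, `0` and `-2`; for given `n`, only a group
whose weight is `1 - n` can contribute. -/
lemma lOp_eq (n : ℕ) (x : Fin n → Cochains k H B A) : lOp Ω n x =
    projK k H A B (nestedBracket (nrBracket k H (A × B)) (hatπ Ω + hatρ Ω) n
      (inclK k H A B ∘ x)) +
    projK k H A B (nestedBracket (nrBracket k H (A × B)) (hatμ Ω + hatη Ω) n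
      (inclK k H A B ∘ x)) +
    projK k H A B (nestedBracket (nrBracket k H (A × B)) (hatθ Ω) n (inclK k H A B ∘ x)) := by
  rw [← map_add, ← nestedBracket_add_left, ← map_add, ← nestedBracket_add_left, ← add_assoc]
  rfl

lemma hatπ_add_hatρ_mem_weight : hatπ Ω + hatρ Ω ∈ weight k H A B (-1) :=
  add_mem (hatπ_mem_weight Ω) (hatρ_mem_weight Ω)

lemma hatμ_add_hatη_mem_weight : hatμ Ω + hatη Ω ∈ weight k H A B 0 :=
  add_mem (hatμ_mem_weight Ω) (hatη_mem_weight Ω)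

/-- No component in `Δ` has weight 1: a part `B ⊗ B → A` is absent from it. -/
lemma lOp_zero : lOp Ω 0 = 0 := by
  refine MultilinearMap.ext fun x => ?_
  rw [lOp_eq, projK_nestedBracket (hatπ_add_hatρ_mem_weight Ω) (by norm_num),
    projK_nestedBracket (hatμ_add_hatη_mem_weight Ω) (by norm_num),
    projK_nestedBracket (hatθ_mem_weight Ω) (by norm_num), add_zero, add_zero]
  rfl

lemma lOp_one (f : Cochains k H B A) : inclK k H A B (lOp Ω 1 ![f]) =
    nrBracket k H (A × B) (hatμ Ω + hatη Ω) (inclK k H A B f) := by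
  rw [lOp_eq, projK_nestedBracket (hatπ_add_hatρ_mem_weight Ω) (by norm_num),
    projK_nestedBracket (hatθ_mem_weight Ω) (by norm_num), zero_add, add_zero,
    inclK_projK_nestedBracket (hatμ_add_hatη_mem_weight Ω) (by norm_num)]
  rfl

lemma lOp_two (f g : Cochains k H B A) : inclK k H A B (lOp Ω 2 ![f, g]) =
    nrBracket k H (A × B) (nrBracket k H (A × B) (hatπ Ω + hatρ Ω) (inclK k H A B f))
      (inclK k H A B g) := by
  rw [lOp_eq, projK_nestedBracket (hatμ_add_hatη_mem_weight Ω) (by norm_num),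
    projK_nestedBracket (hatθ_mem_weight Ω) (by norm_num), add_zero, add_zero,
    inclK_projK_nestedBracket (hatπ_add_hatρ_mem_weight Ω) (by norm_num)]
  rfl

lemma lOp_three (f g h : Cochains k H B A) : inclK k H A B (lOp Ω 3 ![f, g, h]) =
    nrBracket k H (A × B) (nrBracket k H (A × B) (nrBracket k H (A × B) (hatθ Ω)
      (inclK k H A B f)) (inclK k H A B g)) (inclK k H A B h) := by
  rw [lOp_eq, projK_nestedBracket (hatμ_add_hatη_mem_weight Ω) (by norm_num),
    projK_nestedBracket (hatπ_add_hatρ_mem_weight Ω) (by norm_num), zero_add, zero_add,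
    inclK_projK_nestedBracket (hatθ_mem_weight Ω) (by norm_num)]
  rfl

lemma lOp_of_four_le {n : ℕ} (hn : 4 ≤ n) : lOp Ω n = 0 := by
  refine MultilinearMap.ext fun x => ?_
  rw [lOp_eq, projK_nestedBracket (hatπ_add_hatρ_mem_weight Ω) (by omega),
    projK_nestedBracket (hatμ_add_hatη_mem_weight Ω) (by omega),
    projK_nestedBracket (hatθ_mem_weight Ω) (by omega), add_zero, add_zero]
  rfl

end Operations

/-! ### Decomposition of the pseudobracket, and `[Ω, Ω] = 0` -/

section Delta

variable {k H : Type*} [Field k] [Ring H] [HopfAlgebra k H] [Coalgebra.IsCocomm k H]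
variable {A B : Type*}
  [AddCommGroup A] [Module k A] [Module H A] [IsScalarTower k H A]
  [AddCommGroup B] [Module k B] [Module H B] [IsScalarTower k H B]
variable {M N : Type*} [AddCommGroup M] [Module k M] [Module H M]
  [AddCommGroup N] [Module k N] [Module H N]

lemma Cochain.swap_pair (f : Cochain k H 2 M N) (x y : M) :
    f.1 ![y, x] = -PTensor.perm (Equiv.swap 0 1) (f.1 ![x, y]) := by
  have h := f.2.2 (Equiv.swap 0 1) ![y, x]
  have e : (![y, x] : Fin 2 → M) ∘ Equiv.swap (0 : Fin 2) 1 = ![x, y] := by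
    funext i
    fin_cases i <;> rfl
  rwa [e, Equiv.Perm.sign_swap (by decide), Units.neg_smul, one_smul] at h

lemma Cochain.pair_add_left (f : Cochain k H 2 M N) (x x' y : M) :
    f.1 ![x + x', y] = f.1 ![x, y] + f.1 ![x', y] := by
  have := f.1.map_update_add ![x, y] 0 x x'
  rwa [update_pair_zero, update_pair_zero, update_pair_zero] at this

lemma Cochain.pair_add_right (f : Cochain k H 2 M N) (x y y' : M) :
    f.1 ![x, y + y'] = f.1 ![x, y] + f.1 ![x, y'] := by
  have := f.1.map_update_add ![x, y] 1 y y'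
  rwa [update_pair_one, update_pair_one, update_pair_one] at this

lemma Cochain.pair_zero_left (f : Cochain k H 2 M N) (y : M) : f.1 ![0, y] = 0 :=
  f.1.map_coord_zero 0 rfl

lemma Cochain.pair_zero_right (f : Cochain k H 2 M N) (x : M) : f.1 ![x, 0] = 0 :=
  f.1.map_coord_zero 1 rfl

lemma Cochain.pair_ext {f g : Cochain k H 2 M N} (h : ∀ x y, f.1 ![x, y] = g.1 ![x, y]) :
    f = g := by
  refine Subtype.ext (MultilinearMap.ext fun x => ?_)
  have e : x = ![x 0, x 1] := by
    funext i
    fin_cases i <;> rfl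
  rw [e]
  exact h _ _

variable {Ω : Cochain k H 2 (A × B) (A × B)}

lemma IsQuasiTwilled.fst_eq_zero (hΩ : IsQuasiTwilled Ω) (u v : B) :
    PTensor.map (LinearMap.fst H A B) (Ω.1 ![((0, u) : A × B), (0, v)]) = 0 := by
  obtain ⟨w, hw⟩ := hΩ.sub u v
  rw [← hw, PTensor.map_map, LinearMap.fst_comp_inr, PTensor.map_zero_left]

lemma comp_pair {X Y : Type*} (φ : X → Y) (x y : X) : φ ∘ ![x, y] = ![φ x, φ y] := by
  funext i
  fin_cases i <;> rfl

/-- A quasi-twilled pseudobracket is the sum of its components. -/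
lemma deltaElt_eq (hΩ : IsQuasiTwilled Ω) : deltaElt Ω = Cochains.of 1 Ω := by
  rw [deltaElt, hatπ, hatρ, hatμ, hatη, hatθ, ← map_add, ← map_add, ← map_add, ← map_add]
  congr 1
  refine Cochain.pair_ext ?_
  rintro ⟨a, u⟩ ⟨b, v⟩
  -- Bilinear expansion into four blocks, where the block `B ⊗ A` is expressed through `A ⊗ B` by
  -- skew-symmetry.
  have e : Ω.1 ![(a, u), (b, v)] = Ω.1 ![((a, 0) : A × B), (b, 0)] + Ω.1 ![((a, 0) : A × B), (0, v)]
      - PTensor.perm (Equiv.swap 0 1) (Ω.1 ![((b, 0) : A × B), (0, u)]) +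
      Ω.1 ![((0, u) : A × B), (0, v)] := by
    have h1 : (a, u) = ((a, 0) : A × B) + (0, u) := by simp
    have h2 : (b, v) = ((b, 0) : A × B) + (0, v) := by simp
    rw [h1, h2, Cochain.pair_add_left, Cochain.pair_add_right, Cochain.pair_add_right,
      Cochain.swap_pair Ω (b, 0) (0, u)]
    abel
  set ωab := Ω.1 ![((a, 0) : A × B), (b, 0)] with hab
  set ωav := Ω.1 ![((a, 0) : A × B), (0, v)] with hav
  set ωbu := Ω.1 ![((b, 0) : A × B), (0, u)] with hbu
  set ωuv := Ω.1 ![((0, u) : A × B), (0, v)] with huv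
  have hπ : (Cochain.map (LinearMap.fst H A B) (LinearMap.inl H A B) (compπ Ω)).1
      ![(a, u), (b, v)] = PTensor.map (LinearMap.inl H A B)
        (PTensor.map (LinearMap.fst H A B) ωab) := by
    rw [Cochain.map_apply, compπ, Cochain.map_apply, comp_pair, comp_pair]
    rfl
  have hθ : (Cochain.map (LinearMap.fst H A B) (LinearMap.inr H A B) (compθ Ω)).1
      ![(a, u), (b, v)] = PTensor.map (LinearMap.inr H A B)
        (PTensor.map (LinearMap.snd H A B) ωab) := by
    rw [Cochain.map_apply, compθ, Cochain.map_apply, comp_pair, comp_pair]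
    rfl
  have hμ : (Cochain.map (LinearMap.snd H A B) (LinearMap.inr H A B) (compμ Ω)).1
      ![(a, u), (b, v)] = PTensor.map (LinearMap.inr H A B)
        (PTensor.map (LinearMap.snd H A B) ωuv) := by
    rw [Cochain.map_apply, compμ, Cochain.map_apply, comp_pair, comp_pair]
    rfl
  have hη : (Cochain.map LinearMap.id (LinearMap.inl H A B) (Mixed.lift (compη Ω))).1
      ![(a, u), (b, v)] = PTensor.map (LinearMap.inl H A B)
        (PTensor.map (LinearMap.fst H A B) ωav -
          PTensor.perm (Equiv.swap 0 1) (PTensor.map (LinearMap.fst H A B) ωbu)) := rfl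
  have hρ : (Cochain.map LinearMap.id (LinearMap.inr H A B) (Mixed.lift (compρ Ω))).1
      ![(a, u), (b, v)] = PTensor.map (LinearMap.inr H A B)
        (PTensor.map (LinearMap.snd H A B) ωav -
          PTensor.perm (Equiv.swap 0 1) (PTensor.map (LinearMap.snd H A B) ωbu)) := rfl
  change (_ : PTensor k H (Fin 2) (A × B)) + _ + _ + _ + _ = _
  rw [hπ, hθ, hμ, hη, hρ, e, ← PTensor.map_perm, ← PTensor.map_perm, ← map_sub, ← map_sub]
  have h1 := PTensor.inl_fst_add_inr_snd ωab
  have h2 := PTensor.inl_fst_add_inr_snd (ωav - PTensor.perm (Equiv.swap 0 1) ωbu)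
  have h3 := PTensor.inl_fst_add_inr_snd ωuv
  -- Closure of `B` under the pseudobracket enters here: it removes the `A`-part on `B ⊗ B`, the one
  -- part without a counterpart in `Δ`.
  rw [huv, hΩ.fst_eq_zero, map_zero, zero_add, ← huv] at h3
  rw [h3, add_sub_assoc]
  conv_rhs => rw [← h1, ← h2]
  abel

/-- Skew-symmetry of the outer `Ω` rewrites `Ω (x₀, Ω (x₁, x₂))` as minus `Ω (Ω (x₁, x₂), x₀)`, an
even cyclic shift of the left composition. -/
lemma graftComp_right_eq (Ω : Cochain k H 2 M M) :
    graftComp Graft.right (Cochain.toPMap Ω) (Cochain.toPMap Ω) =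
      -signedPerm (finRotate 3) (graftComp Graft.left (Cochain.toPMap Ω) (Cochain.toPMap Ω)) := by
  have h1 : Cochain.toPMap Ω = -PMap.reindex (Equiv.swap 0 1) (Cochain.toPMap Ω) := by
    rw [reindex_eq_signedPerm, signedPerm_toPMap, Equiv.Perm.sign_swap (by decide), Units.neg_smul,
      one_smul, neg_neg]
  rw [signedPerm_eq_reindex, show Equiv.Perm.sign (finRotate 3) = 1 by decide, one_smul,
    reindex_graftComp]
  conv_lhs => rw [h1]
  rw [graftComp_neg_left, graftComp_reindex_left]
  congr 1
  -- Rewriting by `h1` also changed the inner copy of `Ω`, which is restored here.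
  conv_lhs => rw [← h1]
  exact graftComp_congr (by decide) (by decide) (by decide) _ _

lemma graftComp_first_eq_left (Ω : Cochain k H 2 M M) :
    circFirst (m := 1) (n := 1) Ω Ω =
      graftComp Graft.left (Cochain.toPMap Ω) (Cochain.toPMap Ω) := by
  refine graftComp_congr (G := Graft.first 1 1) (G' := Graft.left) ?_ ?_ ?_ _ _ <;> decide

/-- A Lie pseudobracket squares to zero under the circle product. -/
lemma IsLiePseudobracket.circ_self {Ω : Cochain k H 2 M M} (h : IsLiePseudobracket Ω) :
    circ (m := 1) (n := 1) Ω Ω = 0 := by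
  set Λ := graftComp Graft.left (Cochain.toPMap Ω) (Cochain.toPMap Ω) with hΛ
  -- The Jacobi identity in terms of the left composition alone. The transposition `(0 1)` after the
  -- cyclic shift is `(1 2)`, so its three terms are those of the three `(2,1)`-shuffles.
  have h1 : -signedPerm (finRotate 3) Λ = Λ + signedPerm (Equiv.swap 1 2) Λ := by
    have h2 : -signedPerm (finRotate 3) Λ =
        Λ + PMap.reindex (Equiv.swap 0 1) (-signedPerm (finRotate 3) Λ) := by
      rw [← graftComp_right_eq]
      ext x
      have e : x = ![x 0, x 1, x 2] := by
        funext i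
        fin_cases i <;> rfl
      have e' : (![x 0, x 1, x 2] : Fin 3 → M) ∘ Equiv.swap (0 : Fin 3) 1 =
          ![x 1, x 0, x 2] := by
        funext i
        fin_cases i <;> rfl
      rw [e, Submodule.coe_add, add_apply, PMap.reindex_apply, e']
      rw [← PTensor.perm_eq_expand]
      exact h (x 0) (x 1) (x 2)
    have h3 : PMap.reindex (Equiv.swap 0 1) (-signedPerm (finRotate 3) Λ) =
        signedPerm (Equiv.swap 1 2) Λ := by
      rw [reindex_eq_signedPerm, Equiv.Perm.sign_swap (by decide), Units.neg_smul, one_smul]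
      have h4 : signedPerm (Equiv.swap 0 1) (-signedPerm (finRotate 3) Λ) =
          -signedPerm (Equiv.swap 0 1) (signedPerm (finRotate 3) Λ) :=
        map_neg (signedPermLin (Equiv.swap 0 1)) _
      rw [h4, neg_neg, ← signedPerm_mul]
      congr 1
      decide
    rwa [h3] at h2
  apply Cochain.toPMap_injective
  rw [toPMap_circ, graftComp_first_eq_left,
    show shuffles (1 + 1) (1 + 1 + 1) = {1, Equiv.swap 1 2, finRotate 3} by decide,
    Finset.sum_insert (by decide), Finset.sum_insert (by decide), Finset.sum_singleton]
  change signedPerm 1 Λ + (signedPerm (Equiv.swap 1 2) Λ + signedPerm (finRotate 3) Λ) = 0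
  rw [signedPerm_one, ← add_assoc, ← h1, neg_add_cancel]

lemma IsLiePseudobracket.nrBracket_self {Ω : Cochain k H 2 M M} (h : IsLiePseudobracket Ω) :
    nrBracket k H M (Cochains.of 1 Ω) (Cochains.of 1 Ω) = 0 := by
  rw [nrBracket_of, h.circ_self, map_zero, smul_zero, sub_zero]

end Delta

/-! ### Iterated brackets with a linear map of square zero -/

section MaurerCartan

variable {k H : Type*} [Field k] [Ring H] [HopfAlgebra k H] [Coalgebra.IsCocomm k H]
variable {M N : Type*} [AddCommGroup M] [Module k M] [Module H M] [IsScalarTower k H M]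
  [AddCommGroup N] [Module k N] [Module H N] [IsScalarTower k H N]

lemma place_id {J : Type*} [Fintype J] [DecidableEq J] {e : J → J} (he : Function.Injective e)
    (h : ∀ j, e j = j) (b : HPow k H J) : place k e he b = b := by
  obtain rfl : e = id := funext h
  exact congr($(place_one (k := k) (H := H) (J := J)) b)

lemma PTensor.expand_id {J : Type*} [Fintype J] [DecidableEq J] {τ : J → J} (h : ∀ j, τ j = j)
    (w : PTensor k H J N) : PTensor.expand τ w = w := by
  obtain rfl : τ = ((1 : Equiv.Perm J).symm : J → J) := funext h
  rw [← PTensor.perm_eq_expand, PTensor.perm_one]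

/-- The two `(1,1)`-shuffles apply `τ` to either argument; skew-symmetry of `F` restores the order
in the second term. -/
lemma circ_linear_right (F : Cochain k H 2 M N) (t : Cochain k H 1 M M) (τ : M →ₗ[H] M)
    (ht : ∀ x, t.1 x = PTensor.mk k 1 (τ (x 0))) (x y : M) :
    (circ (m := 1) (n := 0) F t).1 ![x, y] = F.1 ![τ x, y] + F.1 ![x, τ y] := by
  have key : ∀ z : Fin 2 → M, insertAt (Graft.first 1 0) (Cochain.toPMap (n := 1 + 1) F)
      (z ∘ (Graft.first 1 0).s) (t.1 (z ∘ (Graft.first 1 0).e)) = F.1 ![τ (z 0), z 1] := by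
    intro z
    rw [ht, insertAt_mk, map_one, one_smul, PTensor.expand_id (by decide)]
    congr 1
    funext i
    fin_cases i <;> rfl
  rw [circ_apply, show shuffles (0 + 1) (1 + 0 + 1) = {1, Equiv.swap 0 1} by decide,
    Finset.sum_pair (by decide), Equiv.Perm.sign_one, one_smul, PTensor.perm_one,
    Equiv.Perm.sign_swap (by decide), Units.neg_smul, one_smul, Cochain.swap_pair F (τ y) x]
  exact congrArg₂ (fun u v => u + -PTensor.perm (Equiv.swap 0 1) v) (key ![x, y])
    (key (![x, y] ∘ Equiv.swap (0 : Fin 2) 1))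

/-- There is only one shuffle, and the coproduct of 1 is 1, so `τ` just acts on the value of `F`. -/
lemma circ_linear_left (F : Cochain k H 2 M M) (t : Cochain k H 1 M M) (τ : M →ₗ[H] M)
    (ht : ∀ x, t.1 x = PTensor.mk k 1 (τ (x 0))) (x : Fin 2 → M) :
    (circ (m := 0) (n := 1) t F).1 x = PTensor.map τ (F.1 x) := by
  have key : ∀ w : PTensor k H (Fin 2) M, insertAt (Graft.first 0 1)
      (Cochain.toPMap (n := 0 + 1) t) (x ∘ (Graft.first 0 1).s) w = PTensor.map τ w := by
    intro w
    induction w using PTensor.induction with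
    | h0 => simp
    | hmk b z =>
      have h1 : (Cochain.toPMap (n := 0 + 1) t).1
          (Function.update (x ∘ (Graft.first 0 1).s) (Graft.first 0 1).i₀ z) =
          PTensor.mk k 1 (τ z) := by
        refine (ht _).trans ?_
        congr 2
      rw [insertAt_mk, h1, PTensor.expand_mk, map_one, PTensor.smul_mk, mul_one,
        place_id _ (by decide), PTensor.map_mk]
    | hadd x y hx hy => simp only [map_add, hx, hy]
  rw [circ_apply, show shuffles (1 + 1) (0 + 1 + 1) = {1} by decide, Finset.sum_singleton,
    Equiv.Perm.sign_one, one_smul, PTensor.perm_one]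
  exact key _

/-- The bracket `[F, t]` of `F ∈ C²(M, M)` and an element `t` of `C¹(M, M)`. -/
def bracketRight (t : Cochain k H 1 M M) (F : Cochain k H 2 M M) : Cochain k H 2 M M :=
  circ (m := 1) (n := 0) F t - circ (m := 0) (n := 1) t F

lemma nrBracket_of_one_of_zero (t : Cochain k H 1 M M) (F : Cochain k H 2 M M) :
    nrBracket k H M (Cochains.of 1 F) (Cochains.of 0 t) = Cochains.of 1 (bracketRight t F) := by
  rw [nrBracket_of, Nat.mul_zero, pow_zero, one_smul, bracketRight, map_sub]

variable {t : Cochain k H 1 M M} {τ : M →ₗ[H] M}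

lemma bracketRight_apply (ht : ∀ x, t.1 x = PTensor.mk k 1 (τ (x 0))) (F : Cochain k H 2 M M)
    (x y : M) : (bracketRight t F).1 ![x, y] =
      F.1 ![τ x, y] + F.1 ![x, τ y] - PTensor.map τ (F.1 ![x, y]) := by
  rw [← circ_linear_right F t τ ht, ← circ_linear_left F t τ ht]
  rfl

/-- Since `τ² = 0`, each argument and the value can take `τ` at most once. Of the terms of the
second iterate those with `τ` at two different places remain, each arising in two orders. -/
lemma bracketRight_bracketRight_apply (ht : ∀ x, t.1 x = PTensor.mk k 1 (τ (x 0)))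
    (hτ : ∀ x, τ (τ x) = 0) (F : Cochain k H 2 M M) (x y : M) :
    (bracketRight t (bracketRight t F)).1 ![x, y] = (2 : k) •
      (F.1 ![τ x, τ y] - PTensor.map τ (F.1 ![τ x, y]) - PTensor.map τ (F.1 ![x, τ y])) := by
  have h : τ ∘ₗ τ = 0 := LinearMap.ext hτ
  simp only [bracketRight_apply ht, hτ, Cochain.pair_zero_left, Cochain.pair_zero_right, map_add,
    map_sub, PTensor.map_map, h, PTensor.map_zero_left, two_smul]
  abel

/-- All three places must now carry `τ`; the single remaining term arises in `3! = 6` orders. -/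
lemma bracketRight_bracketRight_bracketRight_apply
    (ht : ∀ x, t.1 x = PTensor.mk k 1 (τ (x 0))) (hτ : ∀ x, τ (τ x) = 0) (F : Cochain k H 2 M M)
    (x y : M) : (bracketRight t (bracketRight t (bracketRight t F))).1 ![x, y] =
      -(6 : k) • PTensor.map τ (F.1 ![τ x, τ y]) := by
  have h : τ ∘ₗ τ = 0 := LinearMap.ext hτ
  rw [bracketRight_bracketRight_apply ht hτ]
  simp only [bracketRight_apply ht, hτ, Cochain.pair_zero_left, Cochain.pair_zero_right,
    map_sub, PTensor.map_map, h, PTensor.map_zero_left, zero_add, add_zero, sub_zero, zero_sub]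
  rw [show -(6 : k) = 2 * (-3) by norm_num, mul_smul, neg_smul,
    show (3 : k) = 1 + 1 + 1 by norm_num, add_smul, add_smul, one_smul]
  congr 1
  abel

end MaurerCartan

/-! ### Deformation maps of type II as Maurer–Cartan elements -/

section TypeII

variable {k H : Type*} [Field k] [CharZero k] [Ring H] [HopfAlgebra k H] [Coalgebra.IsCocomm k H]
variable {A B : Type*}
  [AddCommGroup A] [Module k A] [Module H A] [IsScalarTower k H A]
  [AddCommGroup B] [Module k B] [Module H B] [IsScalarTower k H B]
variable {Ω : Cochain k H 2 (A × B) (A × B)}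

lemma exists_of_zero_eq_ofLinear (T : B →ₗ[H] A) : ∃ c : Cochain k H 1 B A,
    ofLinear T = Cochains.of 0 c ∧ ∀ x, c.1 x = PTensor.mk k 1 (T (x 0)) :=
  ⟨_, rfl, fun _ => rfl⟩

lemma compπ_pair (a b : A) : (compπ Ω).1 ![a, b] =
    PTensor.map (LinearMap.fst H A B) (Ω.1 ![((a, 0) : A × B), (b, 0)]) := by
  rw [compπ, Cochain.map_apply, comp_pair]
  rfl

lemma compθ_pair (a b : A) : (compθ Ω).1 ![a, b] =
    PTensor.map (LinearMap.snd H A B) (Ω.1 ![((a, 0) : A × B), (b, 0)]) := by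
  rw [compθ, Cochain.map_apply, comp_pair]
  rfl

lemma compμ_pair (u v : B) : (compμ Ω).1 ![u, v] =
    PTensor.map (LinearMap.snd H A B) (Ω.1 ![((0, u) : A × B), (0, v)]) := by
  rw [compμ, Cochain.map_apply, comp_pair]
  rfl

lemma compη_apply (a : A) (u : B) : (compη Ω).1 a u =
    PTensor.map (LinearMap.fst H A B) (Ω.1 ![((a, 0) : A × B), (0, u)]) := rfl

lemma compρ_apply (a : A) (u : B) : (compρ Ω).1 a u =
    PTensor.map (LinearMap.snd H A B) (Ω.1 ![((a, 0) : A × B), (0, u)]) := rfl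

/-- With `τ` the extension of `T` by zero, the argument on the left is `(1 - τ) Ω ((1 + τ) x, (1 +
τ) y) - Ω (x, y)` at `x = (0, u)`, `y = (0, v)`. Its `A`-part is the difference of the two sides of
the type II equation. -/
lemma fst_deformed_pair (Ω : Cochain k H 2 (A × B) (A × B)) (T : B →ₗ[H] A) (u v : B) :
    PTensor.map (LinearMap.fst H A B)
      (Ω.1 ![((T u, 0) : A × B), (0, v)] + Ω.1 ![((0, u) : A × B), (T v, 0)] -
          PTensor.map (LinearMap.inl H A B ∘ₗ T ∘ₗ LinearMap.snd H A B)
            (Ω.1 ![((0, u) : A × B), (0, v)]) +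
        (Ω.1 ![((T u, 0) : A × B), (T v, 0)] -
          PTensor.map (LinearMap.inl H A B ∘ₗ T ∘ₗ LinearMap.snd H A B)
            (Ω.1 ![((T u, 0) : A × B), (0, v)]) -
          PTensor.map (LinearMap.inl H A B ∘ₗ T ∘ₗ LinearMap.snd H A B)
            (Ω.1 ![((0, u) : A × B), (T v, 0)])) -
        PTensor.map (LinearMap.inl H A B ∘ₗ T ∘ₗ LinearMap.snd H A B)
          (Ω.1 ![((T u, 0) : A × B), (T v, 0)])) =
      ((compπ Ω).1 ![T u, T v] + (compη Ω).1 (T u) v -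
        PTensor.perm (Equiv.swap 0 1) ((compη Ω).1 (T v) u)) -
      PTensor.map T ((compρ Ω).1 (T u) v - PTensor.perm (Equiv.swap 0 1) ((compρ Ω).1 (T v) u) +
        (compμ Ω).1 ![u, v] + (compθ Ω).1 ![T u, T v]) := by
  have hfτ : ∀ w : PTensor k H (Fin 2) (A × B), PTensor.map (LinearMap.fst H A B)
      (PTensor.map (LinearMap.inl H A B ∘ₗ T ∘ₗ LinearMap.snd H A B) w) =
        PTensor.map T (PTensor.map (LinearMap.snd H A B) w) := by
    intro w
    rw [PTensor.map_map, PTensor.map_map, ← LinearMap.comp_assoc, LinearMap.fst_comp_inl,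
      LinearMap.id_comp]
  rw [compπ_pair, compθ_pair, compμ_pair, compη_apply, compη_apply, compρ_apply, compρ_apply,
    Cochain.swap_pair Ω (T v, 0) (0, u)]
  generalize Ω.1 ![((T u, 0) : A × B), (0, v)] = w₁
  generalize Ω.1 ![((T v, 0) : A × B), (0, u)] = w₂
  generalize Ω.1 ![((0, u) : A × B), (0, v)] = w₃
  generalize Ω.1 ![((T u, 0) : A × B), (T v, 0)] = w₄
  simp only [map_add, map_sub, map_neg, hfτ, PTensor.map_perm]
  abel

/-- The Maurer–Cartan equation for a linear map is the equation for deformation maps. -/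
lemma isTypeII_iff_isMaurerCartan (hΩ : IsQuasiTwilled Ω) (T : B →ₗ[H] A) :
    IsTypeII Ω T ↔ IsMaurerCartan (Cochains.grading k H B A) (lOp Ω) (ofLinear T) := by
  obtain ⟨c, hc, hcT⟩ := exists_of_zero_eq_ofLinear (k := k) T
  set t := Cochain.map (LinearMap.snd H A B) (LinearMap.inl H A B) c with ht_def
  set τ : A × B →ₗ[H] A × B := LinearMap.inl H A B ∘ₗ T ∘ₗ LinearMap.snd H A B with hτ_def
  have ht : ∀ x, t.1 x = PTensor.mk k 1 (τ (x 0)) := by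
    intro x
    rw [ht_def, Cochain.map_apply, hcT, PTensor.map_mk]
    rfl
  have hτ : ∀ x, τ (τ x) = 0 := by
    intro x
    simp [hτ_def]
  have hinc : inclK k H A B (ofLinear T) = Cochains.of 0 t := by
    rw [hc, inclK_eq_map, Cochains.map_of]
  have hproj : ∀ F : Cochain k H 2 (A × B) (A × B), projK k H A B (Cochains.of 1 F) =
      Cochains.of 1 (Cochain.map (LinearMap.inr H A B) (LinearMap.fst H A B) F) := fun F => by
    rw [projK_eq_map, Cochains.map_of]
  set F₁ := bracketRight t Ω with hF₁
  set F₂ := bracketRight t F₁ with hF₂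
  set F₃ := bracketRight t F₂ with hF₃
  have hnest : ∀ n, lOp Ω (n + 1) (fun _ => ofLinear T) = projK k H A B (nrBracket k H (A × B)
      (nestedBracket (nrBracket k H (A × B)) (deltaElt Ω) n fun _ => Cochains.of 0 t)
        (Cochains.of 0 t)) := by
    intro n
    rw [← hinc]
    rfl
  have hsucc : ∀ n, nestedBracket (nrBracket k H (A × B)) (deltaElt Ω) (n + 1)
      (fun _ => Cochains.of 0 t) = nrBracket k H (A × B)
        (nestedBracket (nrBracket k H (A × B)) (deltaElt Ω) n fun _ => Cochains.of 0 t)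
        (Cochains.of 0 t) := fun _ => rfl
  have h₁ : lOp Ω 1 (fun _ => ofLinear T) = projK k H A B (Cochains.of 1 F₁) := by
    rw [hnest, nestedBracket_zero, deltaElt_eq hΩ, nrBracket_of_one_of_zero]
  have h₂ : lOp Ω 2 (fun _ => ofLinear T) = projK k H A B (Cochains.of 1 F₂) := by
    rw [hnest, hsucc, nestedBracket_zero, deltaElt_eq hΩ, nrBracket_of_one_of_zero,
      nrBracket_of_one_of_zero]
  have h₃ : lOp Ω 3 (fun _ => ofLinear T) = projK k H A B (Cochains.of 1 F₃) := by
    rw [hnest, hsucc, hsucc, nestedBracket_zero, deltaElt_eq hΩ,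
      nrBracket_of_one_of_zero, nrBracket_of_one_of_zero, nrBracket_of_one_of_zero]
  have hsupp : ∀ n, n ∉ Finset.range 4 → lOp Ω n (fun _ => ofLinear T) = 0 := by
    intro n hn
    rw [lOp_of_four_le Ω (by simpa using hn)]
    rfl
  -- The Maurer–Cartan sum before projection: the coefficients are `1/1!`, `1/2!` and `1/3!`, and
  -- there is no further term since `lₙ = 0` for `n = 0` and `n ≥ 4`.
  set X : Cochain k H 2 (A × B) (A × B) := F₁ + (2 : k)⁻¹ • F₂ + (6 : k)⁻¹ • F₃ with hX
  have hsum : ∑ᶠ n : ℕ, ((n.factorial : k)⁻¹) • lOp Ω n (fun _ => ofLinear T) =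
      Cochains.of 1 (Cochain.map (LinearMap.inr H A B) (LinearMap.fst H A B) X) := by
    rw [finsum_eq_sum_of_support_subset _ (s := Finset.range 4) (by
      intro n hn
      by_contra h
      exact hn (by simp only [hsupp n h, smul_zero])), Finset.sum_range_succ,
      Finset.sum_range_succ, Finset.sum_range_succ, Finset.sum_range_one, lOp_zero, h₁, h₂, h₃,
      ← hproj, hX, map_add, map_add, map_add, map_add, map_smul, map_smul, map_smul, map_smul]
    simp [Nat.factorial]
  have hval : ∀ u v : B, (Cochain.map (LinearMap.inr H A B) (LinearMap.fst H A B) X).1 ![u, v] =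
      ((compπ Ω).1 ![T u, T v] + (compη Ω).1 (T u) v -
        PTensor.perm (Equiv.swap 0 1) ((compη Ω).1 (T v) u)) -
      PTensor.map T ((compρ Ω).1 (T u) v - PTensor.perm (Equiv.swap 0 1) ((compρ Ω).1 (T v) u) +
        (compμ Ω).1 ![u, v] + (compθ Ω).1 ![T u, T v]) := by
    intro u v
    have hτu : ∀ u : B, τ (0, u) = (T u, 0) := fun u => rfl
    have e1 : X.1 ![((0, u) : A × B), (0, v)] =
        Ω.1 ![((T u, 0) : A × B), (0, v)] + Ω.1 ![((0, u) : A × B), (T v, 0)] -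
          PTensor.map τ (Ω.1 ![((0, u) : A × B), (0, v)]) +
        (Ω.1 ![((T u, 0) : A × B), (T v, 0)] - PTensor.map τ (Ω.1 ![((T u, 0) : A × B), (0, v)]) -
          PTensor.map τ (Ω.1 ![((0, u) : A × B), (T v, 0)])) -
        PTensor.map τ (Ω.1 ![((T u, 0) : A × B), (T v, 0)]) := by
      -- The factors 2 and `-6` of the iterated brackets cancel the inverse factorials up to sign.
      change F₁.1 _ + (2 : k)⁻¹ • F₂.1 _ + (6 : k)⁻¹ • F₃.1 _ = _
      rw [hF₃, hF₂, hF₁, bracketRight_bracketRight_bracketRight_apply ht hτ,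
        bracketRight_bracketRight_apply ht hτ, bracketRight_apply ht, smul_smul, smul_smul,
        inv_mul_cancel₀ two_ne_zero, one_smul, mul_neg, inv_mul_cancel₀ (by norm_num), neg_smul,
        one_smul, ← sub_eq_add_neg]
      rfl
    rw [Cochain.map_apply, comp_pair, ← fst_deformed_pair]
    exact congrArg (PTensor.map (LinearMap.fst H A B)) e1
  have hof : ∀ G : Cochain k H 2 B A, Cochains.of 1 G = 0 ↔ ∀ u v : B, G.1 ![u, v] = 0 := by
    intro G
    rw [← map_zero (Cochains.of 1), (Cochains.of_injective 1).eq_iff]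
    exact ⟨fun h u v => by rw [h]; rfl, fun h => Cochain.pair_ext h⟩
  have hiff : IsTypeII Ω T ↔
      ∑ᶠ n : ℕ, ((n.factorial : k)⁻¹) • lOp Ω n (fun _ => ofLinear T) = 0 := by
    rw [hsum, hof]
    refine forall₂_congr fun u v => ?_
    rw [hval, sub_eq_zero]
  rw [hiff]
  refine ⟨fun h => ⟨?_, ?_, h⟩, fun h => h.2.2⟩
  · rw [hc]
    have := Cochains.of_mem_grading 0 c
    rwa [Nat.cast_zero] at this
  · refine (Finset.range 4).finite_toSet.subset fun n hn => ?_
    by_contra h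
    exact hn (hsupp n h)

end TypeII

end Pseudo

end

theorem theorem4p11 {k : Type*} [Field k] [CharZero k]
    {H : Type*} [Ring H] [HopfAlgebra k H] [Coalgebra.IsCocomm k H]
    {𝔤 : Type*} [AddCommGroup 𝔤] [Module k 𝔤] [Module H 𝔤] [IsScalarTower k H 𝔤]
    {𝔥 : Type*} [AddCommGroup 𝔥] [Module k 𝔥] [Module H 𝔥] [IsScalarTower k H 𝔥]
    (Ω : Cochain k H 2 (𝔤 × 𝔥) (𝔤 × 𝔥)) (hΩ : IsQuasiTwilled Ω) :
    -- `Δ = π + ρ + μ + η + θ` is the pseudobracket `Ω`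
    deltaElt Ω = Cochains.of 1 Ω ∧
    -- `⨁ C^{n+1}(𝔥, 𝔤)` is a subspace of `⨁ C^{n+1}(𝔤 × 𝔥, 𝔤 × 𝔥)`
    (∀ f : Cochains k H 𝔥 𝔤, projK k H 𝔤 𝔥 (inclK k H 𝔤 𝔥 f) = f) ∧
    -- the curved V-datum
    IsCurvedVData (Cochains.grading k H (𝔤 × 𝔥) (𝔤 × 𝔥)) (nrBracket k H (𝔤 × 𝔥))
      (LinearMap.range (inclK k H 𝔤 𝔥)) (inclK k H 𝔤 𝔥 ∘ₗ projK k H 𝔤 𝔥) (deltaElt Ω) ∧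
    -- the induced curved `L∞`-structure and its operations
    IsCurvedLInfty (Cochains.grading k H 𝔥 𝔤) (lOp Ω) ∧
    lOp Ω 0 = 0 ∧
    (∀ f : Cochains k H 𝔥 𝔤, inclK k H 𝔤 𝔥 (lOp Ω 1 ![f]) =
      nrBracket k H (𝔤 × 𝔥) (hatμ Ω + hatη Ω) (inclK k H 𝔤 𝔥 f)) ∧
    (∀ f g : Cochains k H 𝔥 𝔤, inclK k H 𝔤 𝔥 (lOp Ω 2 ![f, g]) =
      nrBracket k H (𝔤 × 𝔥)
        (nrBracket k H (𝔤 × 𝔥) (hatπ Ω + hatρ Ω) (inclK k H 𝔤 𝔥 f)) (inclK k H 𝔤 𝔥 g)) ∧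
    (∀ f g h : Cochains k H 𝔥 𝔤, inclK k H 𝔤 𝔥 (lOp Ω 3 ![f, g, h]) =
      nrBracket k H (𝔤 × 𝔥)
        (nrBracket k H (𝔤 × 𝔥)
          (nrBracket k H (𝔤 × 𝔥) (hatθ Ω) (inclK k H 𝔤 𝔥 f)) (inclK k H 𝔤 𝔥 g))
        (inclK k H 𝔤 𝔥 h)) ∧
    (∀ n : ℕ, 4 ≤ n → lOp Ω n = 0) ∧
    -- type II deformation maps are Maurer–Cartan elements
    ∀ T : 𝔥 →ₗ[H] 𝔤, IsTypeII Ω T ↔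
      IsMaurerCartan (Cochains.grading k H 𝔥 𝔤) (lOp Ω) (ofLinear T) := by
  -- Identifying `Δ` with `Ω` supplies both conditions on `Δ` in the V-datum, degree 1 and `[Δ, Δ] =
  -- 0`.
  have hΔ := deltaElt_eq hΩ
  have hV := isCurvedVData_nrBracket (k := k) (Δ := deltaElt Ω)
    (by rw [hΔ]; exact Cochains.of_mem_grading 1 Ω) (by rw [hΔ]; exact hΩ.lie.nrBracket_self)
  exact ⟨hΔ, projK_inclK, hV,
    hV.isCurvedLInfty projK_inclK Cochains.isInternal_grading
      (fun _ _ h => Cochains.map_mem_grading _ _ h) (fun _ _ h => Cochains.map_mem_grading _ _ h),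
    lOp_zero Ω, lOp_one Ω, lOp_two Ω, lOp_three Ω, fun _ hn => lOp_of_four_le Ω hn,
    isTypeII_iff_isMaurerCartan hΩ⟩
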